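/- Let $r\ge 5$ and let $f_\varepsilon$, $\varepsilon\in\mathbb R^2$ small, be a two-parameter family of symplectic $C^r$-diffeomorphisms of a two-dimensional symplectic manifold, with a saddle fixed point $O_\varepsilon$ with eigenvalues $\lambda(\varepsilon),\lambda(\varepsilon)^{-1}$, $0<|\lambda(\varepsilon)|<1$. Let $(x,y)$ be canonical coordinates near $O_\varepsilon=(0,0)$ in which the local map $T_0=f_\varepsilon$ has the form $$\bar x=\lambda x(1+\beta xy)+x|xy|\,O(|x|+|y|),\qquad \bar y=\lambda^{-1}y(1+\beta xy)^{-1}+y|xy|\,O(|x|+|y|),$$ uniformly in $\varepsilon$. Suppose that for $\varepsilon=0$ the global map $T_1=f_\varepsilon^q=(F,G)(x,y,\varepsilon)$ sends the point $M^-=(0,y^-)$ to $M^+=(x^+,0)$, with $x^+,y^->0$, and that $\{x=0\}$ is mapped to a curve having a cubic tangency with $\{y=0\}$ at $M^+$: $G=G_y=G_{yy}=0\ne G_{yyy}$ at $(0,y^-,0)$. The maps $T_0$ and $T_1$ in these coordinates are of class $C^r$ in $(x,y)$, with derivatives continuous in $(x,y,\varepsilon)$, and of class $C^{r-2}$ jointly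 in $(x,y,\varepsilon)$. Suppose that the family unfolds the tangency generally, i.e. $\varepsilon\mapsto (G,G_y)(0,y^-,\varepsilon)$ has an invertible derivative at $0$. Put, at the point $(0,y^-,0)$, $c=G_x$, $d=G_{yyy}/6$, $f_{11}=G_{xy}$, and write $\lambda=\lambda(0)$. Then, near $\varepsilon=0$, the splitting parameters $\mu_1=G(0,y^-(\varepsilon),\varepsilon)$, $\mu_2=G_y(0,y^-(\varepsilon),\varepsilon)$, where $y^-(\varepsilon)$ is the continuous solution of $G_{yy}(0,y^-(\varepsilon),\varepsilon)=0$ with $y^-(0)=y^-$, are local $C^1$ coordinates in the parameter plane, and there are invertible affine changes of parameters $(\mu_1,\mu_2)\mapsto(M_1,M_2)$ (depending on $k$) and of coordinates (depending on $k$ and the parameters) with the following properties. For every $R>0$ and all sufficiently large $k$, every $(M_1,M_2)$ with $\max(|M_1|,|M_2|)\le R$ corresponds to parameters $\mu$ near $0$, and, in the new coordinates, the first return map $T_k=T_1T_0^k$ is defined on $\{\max(|x|,|y|)<R\}$ (which corresponds to points of a prescribed neighbourhood $\Pi^+$ of $M^+$ that $T_0^k$ takes, inside the given neighbourhood of $O$,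 to a neighbourhood $\Pi^-$ of $M^-$), and is there a $C^r$ map of the form $$\bar x=y+O(|\lambda|^{k/2}),\qquad \bar y=M_1-x+M_2y+\nu y^3+O(|\lambda|^{k/2}),\qquad \nu=\operatorname{sign}(d\lambda^k),$$ where $$M_1=\sqrt{|d|}\,|\lambda|^{-k/2}\lambda^{-k}\left(\mu_1-\lambda^k(y^--cx^+)+O(k\lambda^{2k})\right),\qquad M_2=\lambda^{-k}\left(\mu_2+f_{11}\lambda^kx^++O(k\lambda^{2k})\right).$$ The constants in the $O$-terms depend on $R$ but not on $k$, $(x,y)$, $(M_1,M_2)$; the $O(|\lambda|^{k/2})$-terms have this order together with all their derivatives in $(x,y)$ up to any finite order $n\le r-2$ (the constant and the lower bound on $k$ may depend on $n$). So the first return maps are asymptotically close to the conservative cubic Hénon maps $\mathbf C^1_\pm:\ \bar x=y,\ \bar y=M_1-x+M_2y\pm y^3$. -/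

import Mathlib

open Set Filter Topology
open scoped Manifold ContDiff

noncomputable section

/-- The standard area form `dx ∧ dy` of the plane. -/
def stdArea (u v : ℝ × ℝ) : ℝ := u.1 * v.2 - u.2 * v.1

/-- A symplectic form of class `C^(r-1)` on a two-dimensional manifold of class `C^r`
(in dimension two closedness is automatic). -/
structure SymplecticForm (r : ℕ∞) (M : Type*) [TopologicalSpace M] [ChartedSpace (ℝ × ℝ) M] where
  /-- the bilinear form on each tangent plane -/
  form : ∀ p : M, TangentSpace 𝓘(ℝ, ℝ × ℝ) p →ₗ[ℝ] TangentSpace 𝓘(ℝ, ℝ × ℝ) p →ₗ[ℝ] ℝ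
  alternating : ∀ p v, form p v v = 0
  nondegenerate : ∀ p v, v ≠ 0 → ∃ w, form p v w ≠ 0
  contDiffOn : ∀ φ ∈ atlas (ℝ × ℝ) M,
    ContDiffOn ℝ ((r - 1 : ℕ∞) : WithTop ℕ∞)
      (fun z : ℝ × ℝ => form (φ.symm z)
        (mfderiv 𝓘(ℝ, ℝ × ℝ) 𝓘(ℝ, ℝ × ℝ) φ.symm z ((1, 0) : ℝ × ℝ))
        (mfderiv 𝓘(ℝ, ℝ × ℝ) 𝓘(ℝ, ℝ × ℝ) φ.symm z ((0, 1) : ℝ × ℝ))) φ.target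

namespace SymplecticForm

variable {r : ℕ∞} {M : Type*} [TopologicalSpace M] [ChartedSpace (ℝ × ℝ) M]

/-- The (differentiable) map `g` is symplectic: `g^* Ω = Ω`. -/
def IsPreservedBy (Ω : SymplecticForm r M) (g : M → M) : Prop :=
  ∀ (p : M) (u v : TangentSpace 𝓘(ℝ, ℝ × ℝ) p),
    Ω.form (g p) (mfderiv 𝓘(ℝ, ℝ × ℝ) 𝓘(ℝ, ℝ × ℝ) g p u)
      (mfderiv 𝓘(ℝ, ℝ × ℝ) 𝓘(ℝ, ℝ × ℝ) g p v) = Ω.form p u v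

/-- The chart `φ` is a system of canonical coordinates of class `C^r`: `Ω = dx ∧ dy` in it. -/
def IsCanonical [IsManifold 𝓘(ℝ, ℝ × ℝ) (r : WithTop ℕ∞) M] (Ω : SymplecticForm r M)
    (φ : OpenPartialHomeomorph M (ℝ × ℝ)) : Prop :=
  φ ∈ IsManifold.maximalAtlas 𝓘(ℝ, ℝ × ℝ) (r : WithTop ℕ∞) M ∧
  ∀ p ∈ φ.source, ∀ u v : TangentSpace 𝓘(ℝ, ℝ × ℝ) p,
    Ω.form p u v = stdArea (mfderiv 𝓘(ℝ, ℝ × ℝ) 𝓘(ℝ, ℝ × ℝ) φ p u)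
      (mfderiv 𝓘(ℝ, ℝ × ℝ) 𝓘(ℝ, ℝ × ℝ) φ p v)

end SymplecticForm

/-- The open rectangle `|x| < δ₁`, `|y| < δ₂`. -/
def rect (δ₁ δ₂ : ℝ) : Set (ℝ × ℝ) := {z | |z.1| < δ₁ ∧ |z.2| < δ₂}

/-- The family `T ε` of planar maps, `ε ∈ V`, on the open set `U`: each map is of class `C^r`, its
derivatives in the coordinates up to order `r` are continuous in `(ε, z)`, and the family is of
class `C^(r-2)` in `(ε, z)` jointly. -/
def IsSmoothFamilyOn (r : ℕ∞) (T : ℝ × ℝ → ℝ × ℝ → ℝ × ℝ) (V U : Set (ℝ × ℝ)) : Prop :=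
  (∀ ε ∈ V, ContDiffOn ℝ (r : WithTop ℕ∞) (T ε) U) ∧
  (∀ i : ℕ, (i : ℕ∞) ≤ r →
    ContinuousOn (fun p : (ℝ × ℝ) × (ℝ × ℝ) => iteratedFDeriv ℝ i (T p.1) p.2) (V ×ˢ U)) ∧
  ContDiffOn ℝ ((r - 2 : ℕ∞) : WithTop ℕ∞)
    (fun p : (ℝ × ℝ) × (ℝ × ℝ) => T p.1 p.2) (V ×ˢ U)

/-- The map `g` read in the coordinates `φ`. -/
def inCoords {M : Type*} [TopologicalSpace M] (φ : OpenPartialHomeomorph M (ℝ × ℝ)) (g : M → M) :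
    ℝ × ℝ → ℝ × ℝ :=
  fun z => φ (g (φ.symm z))

/-- The family `T ε`, `ε ∈ V`, has on `U` the normal form
`x̄ = λ x (1 + β x y) + x |x y| O(|x| + |y|)`,
`ȳ = λ⁻¹ y (1 + β x y)⁻¹ + y |x y| O(|x| + |y|)`
of a symplectic saddle, where `λ` and `β` depend on `ε`. -/
def HasSaddleNormalForm (T : ℝ × ℝ → ℝ × ℝ → ℝ × ℝ) (lam beta : ℝ × ℝ → ℝ)
    (V U : Set (ℝ × ℝ)) : Prop :=
  ∃ C : ℝ, ∀ ε ∈ V, ∀ z ∈ U,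
    |(T ε z).1 - lam ε * z.1 * (1 + beta ε * (z.1 * z.2))|
        ≤ C * (|z.1| * |z.1 * z.2| * (|z.1| + |z.2|)) ∧
    |(T ε z).2 - (lam ε)⁻¹ * z.2 * (1 + beta ε * (z.1 * z.2))⁻¹|
        ≤ C * (|z.2| * |z.1 * z.2| * (|z.1| + |z.2|))

/-- A two-parameter family `f ε` of symplectic `C^r`-diffeomorphisms of a symplectic surface which
unfolds generally (at `ε = 0`) a cubic homoclinic tangency of a saddle fixed point `O`, together
with the canonical coordinates near `O` in which the saddle has its normal form. In these
coordinates `O` is the origin, and by the normal form the axes `{y = 0}` and `{x = 0}` are its local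
stable and unstable manifolds. -/
structure CubicTangencyFamily (r : ℕ∞) (M : Type*) [TopologicalSpace M] [ChartedSpace (ℝ × ℝ) M]
    [IsManifold 𝓘(ℝ, ℝ × ℝ) (r : WithTop ℕ∞) M] (Ω : SymplecticForm r M) where
  /-- the neighbourhood of zero in the parameter plane -/
  V : Set (ℝ × ℝ)
  isOpen_V : IsOpen V
  zero_mem_V : (0 : ℝ × ℝ) ∈ V
  /-- the family of diffeomorphisms -/
  f : ℝ × ℝ → (M ≃ₘ^(r : WithTop ℕ∞)⟮𝓘(ℝ, ℝ × ℝ), 𝓘(ℝ, ℝ × ℝ)⟯ M)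
  symplectic : ∀ ε ∈ V, Ω.IsPreservedBy (f ε)
  /-- the coordinates near the saddle -/
  coords : ℝ × ℝ → OpenPartialHomeomorph M (ℝ × ℝ)
  canonical : ∀ ε ∈ V, Ω.IsCanonical (coords ε)
  /-- half-width of the neighbourhood `U₀` of `O`, in the coordinates -/
  δ₁ : ℝ
  /-- half-height of the neighbourhood `U₀` of `O`, in the coordinates -/
  δ₂ : ℝ
  δ₁_pos : 0 < δ₁
  δ₂_pos : 0 < δ₂
  rect_subset : ∀ ε ∈ V, rect δ₁ δ₂ ⊆ (coords ε).target
  local_mapsTo : ∀ ε ∈ V, ∀ z ∈ rect δ₁ δ₂, f ε ((coords ε).symm z) ∈ (coords ε).source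
  /-- the multiplier `λ` of the saddle -/
  lam : ℝ × ℝ → ℝ
  /-- the first Birkhoff coefficient -/
  beta : ℝ × ℝ → ℝ
  lam_ne_zero : ∀ ε ∈ V, lam ε ≠ 0
  abs_lam_lt_one : ∀ ε ∈ V, |lam ε| < 1
  local_smooth :
    IsSmoothFamilyOn r (fun ε => inCoords (coords ε) (f ε)) V (rect δ₁ δ₂)
  local_normalForm :
    HasSaddleNormalForm (fun ε => inCoords (coords ε) (f ε)) lam beta V (rect δ₁ δ₂)
  /-- the homoclinic point `(x⁺, 0)` on the local stable manifold at `ε = 0` -/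
  xPlus : ℝ
  /-- the homoclinic point `(0, y⁻)` on the local unstable manifold at `ε = 0` -/
  yMinus : ℝ
  xPlus_pos : 0 < xPlus
  xPlus_lt : xPlus < δ₁
  yMinus_pos : 0 < yMinus
  /-- the number of iterations in the global map -/
  q : ℕ
  /-- the neighbourhood of the homoclinic point `(0, y⁻)`, in the coordinates -/
  PiMinus : Set (ℝ × ℝ)
  isOpen_PiMinus : IsOpen PiMinus
  mem_PiMinus : ((0 : ℝ), yMinus) ∈ PiMinus
  PiMinus_subset : PiMinus ⊆ rect δ₁ δ₂
  global_mapsTo : ∀ ε ∈ V, ∀ z ∈ PiMinus,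
    (f ε)^[q] ((coords ε).symm z) ∈ (coords ε).source
  global_smooth :
    IsSmoothFamilyOn r (fun ε => inCoords (coords ε) ((f ε)^[q])) V PiMinus
  /-- the orbit of `(0, y⁻)` is homoclinic at `ε = 0` -/
  homoclinic : inCoords (coords 0) ((f 0)^[q]) (0, yMinus) = (xPlus, 0)
  /-- at `ε = 0` the image of the local unstable manifold under the global map has a contact with
  the local stable manifold `{y = 0}` at `(x⁺, 0)` which is exactly cubic -/
  tangency :
    deriv (fun y => (inCoords (coords 0) ((f 0)^[q]) (0, y)).2) yMinus = 0 ∧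
    iteratedDeriv 2 (fun y => (inCoords (coords 0) ((f 0)^[q]) (0, y)).2) yMinus = 0 ∧
    iteratedDeriv 3 (fun y => (inCoords (coords 0) ((f 0)^[q]) (0, y)).2) yMinus ≠ 0
  /-- the family is transverse at `ε = 0` to the codimension-two surface of maps with a cubic
  tangency: the value and the slope of `y ↦ G(0, y, ε)` are split independently -/
  transverse : Function.Bijective (fderiv ℝ (fun ε : ℝ × ℝ =>
    ((inCoords (coords ε) ((f ε)^[q]) (0, yMinus)).2,
      deriv (fun y => (inCoords (coords ε) ((f ε)^[q]) (0, y)).2) yMinus)) 0)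

namespace CubicTangencyFamily

variable {r : ℕ∞} {M : Type*} [TopologicalSpace M] [ChartedSpace (ℝ × ℝ) M]
  [IsManifold 𝓘(ℝ, ℝ × ℝ) (r : WithTop ℕ∞) M] {Ω : SymplecticForm r M}

/-- The local map `T₀(ε)` in the coordinates. -/
def localMap (F : CubicTangencyFamily r M Ω) (ε : ℝ × ℝ) : ℝ × ℝ → ℝ × ℝ :=
  inCoords (F.coords ε) (F.f ε)

/-- The global map `T₁(ε) = f_ε^q` in the coordinates. -/
def globalMap (F : CubicTangencyFamily r M Ω) (ε : ℝ × ℝ) : ℝ × ℝ → ℝ × ℝ :=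
  inCoords (F.coords ε) ((F.f ε)^[F.q])

/-- The first return map `T_k = T₁ T₀^k`. -/
def firstReturn (F : CubicTangencyFamily r M Ω) (k : ℕ) (ε : ℝ × ℝ) : ℝ × ℝ → ℝ × ℝ :=
  fun z => F.globalMap ε ((F.localMap ε)^[k] z)

/-- The strip on which `T_k` is defined: points of `PiPlus` whose orbit under the local map
stays in the neighbourhood `U₀` of the saddle and is in `PiMinus` after `k` steps. -/
def strip (F : CubicTangencyFamily r M Ω) (PiPlus : Set (ℝ × ℝ)) (k : ℕ) (ε : ℝ × ℝ) :
    Set (ℝ × ℝ) :=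
  {z | z ∈ PiPlus ∧ (∀ j < k, (F.localMap ε)^[j] z ∈ rect F.δ₁ F.δ₂) ∧
    (F.localMap ε)^[k] z ∈ F.PiMinus}

/-- The second component `G(0, y, ε)` of the global map on the local unstable manifold. -/
def unstableHeight (F : CubicTangencyFamily r M Ω) (ε : ℝ × ℝ) (y : ℝ) : ℝ :=
  (F.globalMap ε (0, y)).2

/-- The multiplier at `ε = 0`. -/
def lam0 (F : CubicTangencyFamily r M Ω) : ℝ := F.lam 0

/-- The coefficient `c = G_x` at the homoclinic point, `ε = 0`. -/
def c (F : CubicTangencyFamily r M Ω) : ℝ :=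
  deriv (fun x => (F.globalMap 0 (x, F.yMinus)).2) 0

/-- The coefficient `d = G_yyy / 6` at the homoclinic point, `ε = 0`. -/
def d (F : CubicTangencyFamily r M Ω) : ℝ :=
  iteratedDeriv 3 (F.unstableHeight 0) F.yMinus / 6

/-- The coefficient `f₁₁ = G_xy` at the homoclinic point, `ε = 0`. -/
def f11 (F : CubicTangencyFamily r M Ω) : ℝ :=
  deriv (fun y => deriv (fun x => (F.globalMap 0 (x, y)).2) 0) F.yMinus

/-- The local change of parameters `e : ε ↦ (μ₁, μ₂)` introduces the splitting parameters: for
`y⁻(ε)`, the inflection point of `y ↦ G(0, y, ε)` that continues `y⁻`, one has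
`μ₁ = G(0, y⁻(ε), ε)` and `μ₂ = G_y(0, y⁻(ε), ε)`. -/
def IsSplitting (F : CubicTangencyFamily r M Ω) (e : OpenPartialHomeomorph (ℝ × ℝ) (ℝ × ℝ)) :
    Prop :=
  (0 : ℝ × ℝ) ∈ e.source ∧ e.source ⊆ F.V ∧
  ContDiffOn ℝ 1 e e.source ∧ ContDiffOn ℝ 1 e.symm e.target ∧
  ∃ yI : ℝ × ℝ → ℝ, ContinuousOn yI e.source ∧ yI 0 = F.yMinus ∧
    ∀ ε ∈ e.source, ((0 : ℝ), yI ε) ∈ F.PiMinus ∧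
      iteratedDeriv 2 (F.unstableHeight ε) (yI ε) = 0 ∧
      e ε = (F.unstableHeight ε (yI ε), deriv (F.unstableHeight ε) (yI ε))

end CubicTangencyFamily

/-- The cubic Hénon map `x̄ = y`, `ȳ = M₁ + M₂ y - J x + ν y³`, where `m = (M₁, M₂)`. -/
def cubicHenon (J ν : ℝ) (m : ℝ × ℝ) : ℝ × ℝ → ℝ × ℝ :=
  fun z => (z.2, m.1 + m.2 * z.2 - J * z.1 + ν * z.2 ^ 3)

end

/-! Passage near the saddle. Write the initial point of `T₀ᵏ` as `(x, λᵏ y)` and follow the rescaled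
orbit `Zᵢ = (λ⁻ⁱ xᵢ, λⁱ⁻ᵏ yᵢ)`, which would be constant if `T₀` were linear. By the normal form the
nonlinear part of the first component of `T₀` vanishes to order two on `x = 0` and to order one on
`y = 0`, and symmetrically for the second component. At `xᵢ ~ λⁱ`, `yᵢ ~ λᵏ⁻ⁱ` this makes every
increment of `Zᵢ` of order `λᵏ` in `Cⁿ`, uniformly in `i` (`cnBound_saddleIncr`), so the whole
passage is the identity up to `O(kλᵏ)` with derivatives (`cnBound_saddleOrbit`). No boundary value
problem has to be solved. To the next order, the resonant term contributes `kβλᵏ(x²y, -xy²)`; the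
remainder of the normal form carries an extra factor `|λ|ⁱ + |λ|ᵏ⁻ⁱ`, which sums geometrically, so
the error is `O(λᵏ)` (`abs_saddleOrbit_sub_le`).

Global map. The orbit arrives at `x ~ λᵏ`, and `y` is measured from the inflection point `y⁻(ε)` in
units of `s = √|λᵏ/d|`. So `x` has weight two and `y` weight one in powers of `s`. At the inflection
point `G` has no `y²` term, hence up to weight three it is `μ₁ + μ₂ y + c x + f₁₁ x y + d y³`, with
a remainder of size `s⁴`; for the first component `x⁺ + b y` with remainder `s²` is enough
(`exists_taylor_globalMap`). Dividing by the scales `b s` and `λᵏ s` turns both remainders into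
`O(s)`, and `O(s)` is `O(|λ|^{k/2})`. Area preservation at the tangency gives `b c = -1`
(`b_mul_c`), whence the coefficient `-1` of `x`, and `d s²/λᵏ` is exactly the sign `ν`.

Parameters. The constant term is divided by `s`, so its bracket is needed up to `O(λᵏ)`, and terms
of order `kλᵏ` may not be dropped. They have two sources: the shift of the homoclinic point by the
passage, proportional to `kβλᵏ`, and the ratio `λ(0)ᵏ/λ(ε)ᵏ`, which is `1 - kℓ(μ)` up to `O(λᵏ)`
with a linear form `ℓ`. Together they form `correction`, which is affine in `μ`; therefore it can be
absorbed in an affine change of parameters (`isBigO_constant_term`, `paramChange`). For the linear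
and cubic coefficients `O(s)` accuracy suffices.

Low regularity has to be bypassed in two places: `β(ε)` is not assumed continuous, and `G_yyy` need
not be Lipschitz in `ε` when `r = 5`. Both are compared with their values at `ε = 0` by evaluating
at points which approach the base point at a rate depending on `k` (`isBigO_beta_sub`,
`isBigO_pdy_pdy_pdy_sub`).

Uniformity in the bounded parameters `(M₁, M₂)` is obtained by stating all asymptotics along a
filter on the pairs `(k, m)`; `CnBigO` is the corresponding notion of order with derivatives. -/

/-! ### Uniform `Cⁿ` bounds: algebra and composition. -/

section CnBounds

variable {E F G : Type*} [NormedAddCommGroup E] [NormedSpace ℝ E] [NormedAddCommGroup F]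
  [NormedSpace ℝ F] [NormedAddCommGroup G] [NormedSpace ℝ G]

/-- `f` is of class `C^n` on `s` and its derivatives up to order `n` are bounded there by `K`. -/
structure CnBound (n : ℕ) (s : Set E) (f : E → F) (K : ℝ) : Prop where
  contDiffOn : ContDiffOn ℝ n f s
  bound : ∀ j ≤ n, ∀ z ∈ s, ‖iteratedFDeriv ℝ j f z‖ ≤ K

namespace CnBound

variable {n m : ℕ} {s t : Set E} {f g : E → F} {K L : ℝ}

theorem mono (h : CnBound n s f K) (hKL : K ≤ L) : CnBound n s f L :=
  ⟨h.1, fun j hj z hz => (h.2 j hj z hz).trans hKL⟩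

theorem mono_order (h : CnBound n s f K) (hmn : m ≤ n) : CnBound m s f K :=
  ⟨h.1.of_le (mod_cast hmn), fun j hj z hz => h.2 j (hj.trans hmn) z hz⟩

theorem contDiffAt (h : CnBound n s f K) (hs : IsOpen s) {z : E} (hz : z ∈ s) :
    ContDiffAt ℝ n f z := h.1.contDiffAt (hs.mem_nhds hz)

theorem norm_le (h : CnBound n s f K) {z : E} (hz : z ∈ s) : ‖f z‖ ≤ K := by
  simpa using h.2 0 (Nat.zero_le _) z hz

theorem congr (h : CnBound n s f K) (hs : IsOpen s) (hfg : EqOn g f s) : CnBound n s g K :=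
  ⟨h.1.congr hfg, fun j hj z hz => by
    have : g =ᶠ[𝓝 z] f := hfg.eventuallyEq_of_mem (hs.mem_nhds hz)
    rw [(this.iteratedFDeriv ℝ j).eq_of_nhds]; exact h.2 j hj z hz⟩

theorem add (hf : CnBound n s f K) (hg : CnBound n s g L) (hs : IsOpen s) :
    CnBound n s (fun z => f z + g z) (K + L) :=
  ⟨hf.1.add hg.1, fun j hj z hz => by
    have h := iteratedFDeriv_add_apply (𝕜 := ℝ) (i := j) (x := z)
      ((hf.contDiffAt hs hz).of_le (mod_cast hj)) ((hg.contDiffAt hs hz).of_le (mod_cast hj))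
    change ‖iteratedFDeriv ℝ j (f + g) z‖ ≤ _
    rw [h]
    exact (norm_add_le _ _).trans (add_le_add (hf.2 j hj z hz) (hg.2 j hj z hz))⟩

theorem neg (hf : CnBound n s f K) : CnBound n s (fun z => -f z) K :=
  ⟨hf.1.neg, fun j hj z hz => by
    change ‖iteratedFDeriv ℝ j (-f) z‖ ≤ _
    rw [iteratedFDeriv_neg_apply, norm_neg]; exact hf.2 j hj z hz⟩

theorem sub (hf : CnBound n s f K) (hg : CnBound n s g L) (hs : IsOpen s) :
    CnBound n s (fun z => f z - g z) (K + L) := by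
  simpa [sub_eq_add_neg] using hf.add hg.neg hs

theorem const_smul (hf : CnBound n s f K) (hs : IsOpen s) (c : ℝ) :
    CnBound n s (fun z => c • f z) (|c| * K) :=
  ⟨hf.1.const_smul c, fun j hj z hz => by
    have h := iteratedFDeriv_const_smul_apply (𝕜 := ℝ) (i := j) (x := z) (a := c)
      ((hf.contDiffAt hs hz).of_le (mod_cast hj))
    change ‖iteratedFDeriv ℝ j (c • f) z‖ ≤ _
    rw [h, norm_smul, Real.norm_eq_abs]
    exact mul_le_mul_of_nonneg_left (hf.2 j hj z hz) (abs_nonneg _)⟩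

theorem clm_comp (hf : CnBound n s f K) (hs : IsOpen s) (A : F →L[ℝ] G) :
    CnBound n s (fun z => A (f z)) (‖A‖ * K) :=
  ⟨A.contDiff.comp_contDiffOn hf.1, fun j hj z hz => by
    change ‖iteratedFDeriv ℝ j (A ∘ f) z‖ ≤ _
    rw [A.iteratedFDeriv_comp_left (hf.contDiffAt hs hz) (mod_cast hj)]
    exact (ContinuousLinearMap.norm_compContinuousMultilinearMap_le _ _).trans
      (mul_le_mul_of_nonneg_left (hf.2 j hj z hz) (norm_nonneg _))⟩

theorem fst {f : E → F × G} (hf : CnBound n s f K) (hs : IsOpen s) (hK : 0 ≤ K) :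
    CnBound n s (fun z => (f z).1) K :=
  (hf.clm_comp hs (ContinuousLinearMap.fst ℝ F G)).mono
    (mul_le_of_le_one_left hK (ContinuousLinearMap.norm_fst_le ..))

theorem snd {f : E → F × G} (hf : CnBound n s f K) (hs : IsOpen s) (hK : 0 ≤ K) :
    CnBound n s (fun z => (f z).2) K :=
  (hf.clm_comp hs (ContinuousLinearMap.snd ℝ F G)).mono
    (mul_le_of_le_one_left hK (ContinuousLinearMap.norm_snd_le ..))

theorem prodMk {g : E → G} (hf : CnBound n s f K) (hg : CnBound n s g K) (hs : IsOpen s) :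
    CnBound n s (fun z => (f z, g z)) K :=
  ⟨hf.1.prodMk hg.1, fun j hj z hz => by
    rw [iteratedFDeriv_prodMk (hf.contDiffAt hs hz) (hg.contDiffAt hs hz) (mod_cast hj),
      ContinuousMultilinearMap.opNorm_prod]
    exact max_le (hf.2 j hj z hz) (hg.2 j hj z hz)⟩

theorem const {c : F} (hc : ‖c‖ ≤ K) : CnBound n s (fun _ : E => c) K :=
  ⟨contDiffOn_const, fun j _ z _ => by
    rcases Nat.eq_zero_or_pos j with rfl | hj
    · simpa using hc
    · rw [iteratedFDeriv_const_of_ne hj.ne']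
      simpa using (norm_nonneg c).trans hc⟩

theorem mul {f g : E → ℝ} (hf : CnBound n s f K) (hg : CnBound n s g L) (hs : IsOpen s)
    (hK : 0 ≤ K) (hL : 0 ≤ L) : CnBound n s (fun z => f z * g z) (2 ^ n * (K * L)) :=
  ⟨hf.1.mul hg.1, fun j hj z hz => by
    have h := norm_iteratedFDerivWithin_mul_le (hf.1.of_le (m := (j : ℕ∞ω)) (mod_cast hj))
      (hg.1.of_le (m := (j : ℕ∞ω)) (mod_cast hj)) hs.uniqueDiffOn hz le_rfl
    simp only [iteratedFDerivWithin_of_isOpen _ hs hz] at h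
    refine h.trans ?_
    calc _ ≤ ∑ i ∈ Finset.range (j + 1), (j.choose i : ℝ) * (K * L) := by
          refine Finset.sum_le_sum fun i hi => ?_
          have hij : i ≤ j := Nat.lt_succ_iff.1 (Finset.mem_range.1 hi)
          rw [mul_assoc]
          gcongr
          · exact hf.2 i (hij.trans hj) z hz
          · exact hg.2 (j - i) ((Nat.sub_le _ _).trans hj) z hz
      _ = 2 ^ j * (K * L) := by
          rw [← Finset.sum_mul, ← Nat.cast_sum, Nat.sum_range_choose]; push_cast; rfl
      _ ≤ _ := by gcongr; norm_num⟩

/-- Faà di Bruno estimate for an inner map whose `i`-th derivative is at most `D ^ i`. -/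
theorem norm_iteratedFDeriv_comp {g : F → G} {f : E → F} {t : Set F} (hg : CnBound n t g K)
    (hf : ContDiffOn ℝ n f s) (hs : IsOpen s) (ht : IsOpen t) (hst : MapsTo f s t) {D : ℝ}
    {z : E} (hz : z ∈ s) (hD : ∀ i, 1 ≤ i → i ≤ n → ‖iteratedFDeriv ℝ i f z‖ ≤ D ^ i)
    {j : ℕ} (hj : j ≤ n) :
    ‖iteratedFDeriv ℝ j (fun z => g (f z)) z‖ ≤ j.factorial * K * D ^ j := by
  have h := norm_iteratedFDerivWithin_comp_le (n := j) (C := K) (D := D) hg.1 hf (mod_cast hj)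
    ht.uniqueDiffOn hs.uniqueDiffOn hst hz
    (fun i hi => by
      rw [iteratedFDerivWithin_of_isOpen _ ht (hst hz)]; exact hg.2 i (hi.trans hj) _ (hst hz))
    (fun i h1 hi => by
      rw [iteratedFDerivWithin_of_isOpen _ hs hz]; exact hD i h1 (hi.trans hj))
  rwa [iteratedFDerivWithin_of_isOpen _ hs hz] at h

theorem comp {g : F → G} {f : E → F} {t : Set F} (hg : CnBound n t g K) (hf : CnBound n s f L)
    (hs : IsOpen s) (ht : IsOpen t) (hst : MapsTo f s t) (hK : 0 ≤ K) (hL : 1 ≤ L) :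
    CnBound n s (fun z => g (f z)) (n.factorial * K * L ^ n) :=
  ⟨hg.1.comp hf.1 hst, fun j hj z hz => by
    refine (hg.norm_iteratedFDeriv_comp hf.1 hs ht hst hz (D := L) (fun i h1 hi => ?_) hj).trans ?_
    · exact (hf.2 i hi z hz).trans (le_self_pow₀ hL (by omega))
    · have := Nat.factorial_le hj
      have := pow_le_pow_right₀ hL hj
      gcongr⟩

theorem norm_iteratedFDeriv_affine {f : E → F} {A : E →L[ℝ] F} {a : F}
    (hf : ∀ z, f z = a + A z) {j : ℕ} (hj : 1 ≤ j) (z : E) :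
    ‖iteratedFDeriv ℝ j f z‖ ≤ ‖A‖ ^ j := by
  obtain rfl : f = fun z => a + A z := funext hf
  obtain ⟨i, rfl⟩ := Nat.exists_eq_add_of_le' hj
  have hd : fderiv ℝ (fun z => a + A z) = fun _ => A := by
    funext z; simp
  rw [← norm_iteratedFDeriv_fderiv, hd]
  rcases Nat.eq_zero_or_pos i with rfl | hi
  · simp
  · rw [iteratedFDeriv_const_of_ne hi.ne']; simp

/-- Precomposition with a contracting affine map. -/
theorem comp_affine {g : F → G} {t : Set F} (hg : CnBound n t g K) (ht : IsOpen t) {f : E → F}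
    {A : E →L[ℝ] F} {a : F} (hf : ∀ z, f z = a + A z) (hs : IsOpen s) (hst : MapsTo f s t)
    {z : E} (hz : z ∈ s) {j : ℕ} (hj : j ≤ n) :
    ‖iteratedFDeriv ℝ j (fun z => g (f z)) z‖ ≤ j.factorial * K * ‖A‖ ^ j := by
  have hfc : ContDiff ℝ n f := by
    obtain rfl : f = fun z => a + A z := funext hf
    exact contDiff_const.add A.contDiff
  exact hg.norm_iteratedFDeriv_comp hfc.contDiffOn hs ht hst hz
    (fun i h1 _ => norm_iteratedFDeriv_affine hf h1 z) hj

theorem fderiv_apply (h : CnBound (n + 1) s f K) (hs : IsOpen s) {w : E} (hw : ‖w‖ ≤ 1)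
    (hK : 0 ≤ K) : CnBound n s (fun z => fderiv ℝ f z w) K := by
  have h1 : ContDiffOn ℝ n (fderiv ℝ f) s := h.1.fderiv_of_isOpen hs (by norm_cast)
  have h2 : CnBound n s (fderiv ℝ f) K := ⟨h1, fun j hj z hz => by
    rw [norm_iteratedFDeriv_fderiv]; exact h.2 _ (by omega) z hz⟩
  refine (h2.clm_comp hs (ContinuousLinearMap.apply ℝ F w)).mono (mul_le_of_le_one_left hK ?_)
  refine ContinuousLinearMap.opNorm_le_bound _ zero_le_one fun A => ?_
  rw [ContinuousLinearMap.apply_apply, one_mul]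
  exact (A.le_opNorm w).trans (mul_le_of_le_one_right (norm_nonneg _) hw)

theorem norm_fderiv_le (h : CnBound (n + 1) s f K) {z : E} (hz : z ∈ s) : ‖fderiv ℝ f z‖ ≤ K := by
  have := h.2 1 (by omega) z hz
  rwa [← norm_iteratedFDeriv_fderiv, norm_iteratedFDeriv_zero] at this

theorem differentiableAt (h : CnBound (n + 1) s f K) (hs : IsOpen s) {z : E} (hz : z ∈ s) :
    DifferentiableAt ℝ f z :=
  (h.contDiffAt hs hz).differentiableAt (by simp)

theorem norm_sub_le (h : CnBound (n + 1) s f K) (hs : IsOpen s) (hc : Convex ℝ s) {z w : E}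
    (hz : z ∈ s) (hw : w ∈ s) : ‖f w - f z‖ ≤ K * ‖w - z‖ :=
  hc.norm_image_sub_le_of_norm_fderiv_le (fun _ hx => h.differentiableAt hs hx)
    (fun _ hx => h.norm_fderiv_le hx) hz hw

end CnBound

end CnBounds

/-! ### Partial derivatives in the plane and diagonal scalings. -/

section PlanarPartials

/-- The partial derivative in the first variable. -/
noncomputable def pdx (φ : ℝ × ℝ → ℝ) (z : ℝ × ℝ) : ℝ := fderiv ℝ φ z (1, 0)

/-- The partial derivative in the second variable. -/
noncomputable def pdy (φ : ℝ × ℝ → ℝ) (z : ℝ × ℝ) : ℝ := fderiv ℝ φ z (0, 1)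

/-- The diagonal linear map `(x, y) ↦ (p x, q y)`. -/
noncomputable def diagScale (p q : ℝ) : ℝ × ℝ →L[ℝ] ℝ × ℝ :=
  (p • ContinuousLinearMap.fst ℝ ℝ ℝ).prod (q • ContinuousLinearMap.snd ℝ ℝ ℝ)

@[simp] theorem diagScale_apply (p q : ℝ) (z : ℝ × ℝ) :
    diagScale p q z = (p * z.1, q * z.2) := rfl

theorem isOpen_rect (a b : ℝ) : IsOpen (rect a b) :=
  (isOpen_lt (continuous_fst.abs) continuous_const).inter
    (isOpen_lt (continuous_snd.abs) continuous_const)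

theorem fderiv_eq_pd (φ : ℝ × ℝ → ℝ) (z w : ℝ × ℝ) :
    fderiv ℝ φ z w = w.1 * pdx φ z + w.2 * pdy φ z := by
  have hw : w = w.1 • ((1 : ℝ), (0 : ℝ)) + w.2 • ((0 : ℝ), (1 : ℝ)) := by ext <;> simp
  conv_lhs => rw [hw]
  rw [map_add, map_smul, map_smul]; rfl

theorem norm_fderiv_le_pd (φ : ℝ × ℝ → ℝ) (z : ℝ × ℝ) :
    ‖fderiv ℝ φ z‖ ≤ |pdx φ z| + |pdy φ z| := by
  refine ContinuousLinearMap.opNorm_le_bound _ (by positivity) fun w => ?_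
  rw [fderiv_eq_pd, add_mul]
  have h1 : |w.1| ≤ ‖w‖ := norm_fst_le w
  have h2 : |w.2| ≤ ‖w‖ := norm_snd_le w
  calc ‖w.1 * pdx φ z + w.2 * pdy φ z‖ ≤ |w.1| * |pdx φ z| + |w.2| * |pdy φ z| := by
        rw [Real.norm_eq_abs, ← abs_mul, ← abs_mul]; exact abs_add_le _ _
    _ ≤ ‖w‖ * |pdx φ z| + ‖w‖ * |pdy φ z| := by gcongr
    _ = _ := by ring

theorem ContDiffAt.pdx {φ : ℝ × ℝ → ℝ} {z : ℝ × ℝ} {j : ℕ} (h : ContDiffAt ℝ (j + 1 : ℕ) φ z) :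
    ContDiffAt ℝ j (pdx φ) z :=
  (h.fderiv_right (m := j) (by norm_cast)).clm_apply contDiffAt_const

theorem ContDiffAt.pdy {φ : ℝ × ℝ → ℝ} {z : ℝ × ℝ} {j : ℕ} (h : ContDiffAt ℝ (j + 1 : ℕ) φ z) :
    ContDiffAt ℝ j (pdy φ) z :=
  (h.fderiv_right (m := j) (by norm_cast)).clm_apply contDiffAt_const

/-- The differential is `φ_x dx + φ_y dy`, and multiplication by `dx` or `dy` has norm at most one.
This is what allows inductions on the order of differentiation to stay within scalar functions. -/
theorem norm_iteratedFDeriv_succ_le_pd {φ : ℝ × ℝ → ℝ} {z : ℝ × ℝ} {j : ℕ}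
    (h : ContDiffAt ℝ (j + 1 : ℕ) φ z) :
    ‖iteratedFDeriv ℝ (j + 1) φ z‖ ≤
      ‖iteratedFDeriv ℝ j (pdx φ) z‖ + ‖iteratedFDeriv ℝ j (pdy φ) z‖ := by
  let A₁ : ℝ →L[ℝ] (ℝ × ℝ →L[ℝ] ℝ) :=
    (ContinuousLinearMap.id ℝ ℝ).smulRight (ContinuousLinearMap.fst ℝ ℝ ℝ)
  let A₂ : ℝ →L[ℝ] (ℝ × ℝ →L[ℝ] ℝ) :=
    (ContinuousLinearMap.id ℝ ℝ).smulRight (ContinuousLinearMap.snd ℝ ℝ ℝ)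
  have hA₁ : ‖A₁‖ ≤ 1 := by
    refine ContinuousLinearMap.opNorm_le_bound _ zero_le_one fun t => ?_
    simp only [A₁, ContinuousLinearMap.smulRight_apply, ContinuousLinearMap.id_apply, norm_smul]
    rw [one_mul]
    exact mul_le_of_le_one_right (norm_nonneg _) (ContinuousLinearMap.norm_fst_le ..)
  have hA₂ : ‖A₂‖ ≤ 1 := by
    refine ContinuousLinearMap.opNorm_le_bound _ zero_le_one fun t => ?_
    simp only [A₂, ContinuousLinearMap.smulRight_apply, ContinuousLinearMap.id_apply, norm_smul]
    rw [one_mul]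
    exact mul_le_of_le_one_right (norm_nonneg _) (ContinuousLinearMap.norm_snd_le ..)
  have he : fderiv ℝ φ = A₁ ∘ pdx φ + A₂ ∘ pdy φ := by
    funext w
    refine ContinuousLinearMap.ext fun v => ?_
    rw [fderiv_eq_pd]
    simp [A₁, A₂, mul_comm]
  have h1 := h.pdx
  have h2 := h.pdy
  rw [← norm_iteratedFDeriv_fderiv, he, iteratedFDeriv_add_apply
    (A₁.contDiff.contDiffAt.comp z h1) (A₂.contDiff.contDiffAt.comp z h2),
    A₁.iteratedFDeriv_comp_left h1 le_rfl, A₂.iteratedFDeriv_comp_left h2 le_rfl]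
  refine (norm_add_le _ _).trans (add_le_add ?_ ?_)
  · exact (ContinuousLinearMap.norm_compContinuousMultilinearMap_le _ _).trans
      (mul_le_of_le_one_left (norm_nonneg _) hA₁)
  · exact (ContinuousLinearMap.norm_compContinuousMultilinearMap_le _ _).trans
      (mul_le_of_le_one_left (norm_nonneg _) hA₂)

theorem CnBound.pdx {n : ℕ} {s : Set (ℝ × ℝ)} {φ : ℝ × ℝ → ℝ} {K : ℝ}
    (h : CnBound (n + 1) s φ K) (hs : IsOpen s) (hK : 0 ≤ K) : CnBound n s (pdx φ) K :=
  h.fderiv_apply hs (by simp) hK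

theorem CnBound.pdy {n : ℕ} {s : Set (ℝ × ℝ)} {φ : ℝ × ℝ → ℝ} {K : ℝ}
    (h : CnBound (n + 1) s φ K) (hs : IsOpen s) (hK : 0 ≤ K) : CnBound n s (pdy φ) K :=
  h.fderiv_apply hs (by simp) hK

theorem hasDerivAt_pdx {φ : ℝ × ℝ → ℝ} {x y : ℝ} (h : DifferentiableAt ℝ φ (x, y)) :
    HasDerivAt (fun x => φ (x, y)) (pdx φ (x, y)) x :=
  h.hasFDerivAt.comp_hasDerivAt x ((hasDerivAt_id x).prodMk (hasDerivAt_const x y))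

theorem hasDerivAt_pdy {φ : ℝ × ℝ → ℝ} {x y : ℝ} (h : DifferentiableAt ℝ φ (x, y)) :
    HasDerivAt (fun y => φ (x, y)) (pdy φ (x, y)) y :=
  h.hasFDerivAt.comp_hasDerivAt y ((hasDerivAt_const y x).prodMk (hasDerivAt_id y))

theorem pdx_comp_diagScale {φ : ℝ × ℝ → ℝ} {p q : ℝ} {z : ℝ × ℝ}
    (h : DifferentiableAt ℝ φ (diagScale p q z)) :
    pdx (fun w => φ (diagScale p q w)) z = p * pdx φ (diagScale p q z) := by
  have h1 := h.hasFDerivAt.comp z (diagScale p q).hasFDerivAt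
  have h2 : fderiv ℝ (fun w => φ (diagScale p q w)) z
    = (fderiv ℝ φ (diagScale p q z)).comp (diagScale p q) := h1.fderiv
  rw [pdx, h2, ContinuousLinearMap.comp_apply, fderiv_eq_pd]
  simp

theorem pdy_comp_diagScale {φ : ℝ × ℝ → ℝ} {p q : ℝ} {z : ℝ × ℝ}
    (h : DifferentiableAt ℝ φ (diagScale p q z)) :
    pdy (fun w => φ (diagScale p q w)) z = q * pdy φ (diagScale p q z) := by
  have h1 := h.hasFDerivAt.comp z (diagScale p q).hasFDerivAt
  have h2 : fderiv ℝ (fun w => φ (diagScale p q w)) z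
    = (fderiv ℝ φ (diagScale p q z)).comp (diagScale p q) := h1.fderiv
  rw [pdy, h2, ContinuousLinearMap.comp_apply, fderiv_eq_pd]
  simp

theorem pdx_pdy_comm {φ : ℝ × ℝ → ℝ} {z : ℝ × ℝ} (h : ContDiffAt ℝ 2 φ z) :
    pdx (pdy φ) z = pdy (pdx φ) z := by
  have hs : IsSymmSndFDerivAt ℝ φ z := h.isSymmSndFDerivAt (by simp)
  have hd : DifferentiableAt ℝ (fderiv ℝ φ) z :=
    (h.fderiv_right (m := 1) (by norm_num)).differentiableAt (by simp)
  have h1 : ∀ v w : ℝ × ℝ, fderiv ℝ (fun z => fderiv ℝ φ z v) z w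
      = fderiv ℝ (fderiv ℝ φ) z w v := by
    intro v w
    rw [fderiv_clm_apply hd (differentiableAt_const v)]
    simp
  change fderiv ℝ (fun z => fderiv ℝ φ z (0, 1)) z (1, 0)
    = fderiv ℝ (fun z => fderiv ℝ φ z (1, 0)) z (0, 1)
  rw [h1, h1]
  exact hs _ _

theorem Filter.EventuallyEq.pdx {φ ψ : ℝ × ℝ → ℝ} {z : ℝ × ℝ} (h : φ =ᶠ[𝓝 z] ψ) :
    pdx φ =ᶠ[𝓝 z] pdx ψ := by
  filter_upwards [h.fderiv (𝕜 := ℝ)] with w hw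
  simp only [_root_.pdx, hw]

theorem Filter.EventuallyEq.pdy {φ ψ : ℝ × ℝ → ℝ} {z : ℝ × ℝ} (h : φ =ᶠ[𝓝 z] ψ) :
    pdy φ =ᶠ[𝓝 z] pdy ψ := by
  filter_upwards [h.fderiv (𝕜 := ℝ)] with w hw
  simp only [_root_.pdy, hw]

end PlanarPartials

/-! ### Functions that vanish to given orders on the coordinate axes. -/

section AxisFlat

/-- On the part of the axis `x = 0` in `U`, `φ` vanishes with its first `α - 1` partial
derivatives in `x`. -/
def FlatX (U : Set (ℝ × ℝ)) : ℕ → (ℝ × ℝ → ℝ) → Prop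
  | 0, _ => True
  | α + 1, φ => (∀ z ∈ U, z.1 = 0 → φ z = 0) ∧ FlatX U α (pdx φ)

/-- On the part of the axis `y = 0` in `U`, `φ` vanishes with its first `β - 1` partial
derivatives in `y`. -/
def FlatY (U : Set (ℝ × ℝ)) : ℕ → (ℝ × ℝ → ℝ) → Prop
  | 0, _ => True
  | β + 1, φ => (∀ z ∈ U, z.2 = 0 → φ z = 0) ∧ FlatY U β (pdy φ)

variable {U : Set (ℝ × ℝ)} {φ ψ : ℝ × ℝ → ℝ}

theorem FlatX.congr (hU : IsOpen U) {α : ℕ} (h : FlatX U α φ) (e : EqOn φ ψ U) :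
    FlatX U α ψ := by
  induction α generalizing φ ψ with
  | zero => trivial
  | succ α ih =>
    refine ⟨fun z hz h0 => (e hz) ▸ h.1 z hz h0, ih h.2 fun z hz => ?_⟩
    exact (e.eventuallyEq_of_mem (hU.mem_nhds hz)).pdx.eq_of_nhds

theorem FlatY.congr (hU : IsOpen U) {β : ℕ} (h : FlatY U β φ) (e : EqOn φ ψ U) :
    FlatY U β ψ := by
  induction β generalizing φ ψ with
  | zero => trivial
  | succ β ih =>
    refine ⟨fun z hz h0 => (e hz) ▸ h.1 z hz h0, ih h.2 fun z hz => ?_⟩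
    exact (e.eventuallyEq_of_mem (hU.mem_nhds hz)).pdy.eq_of_nhds

theorem FlatX.pdx {α : ℕ} (h : FlatX U α φ) : FlatX U (α - 1) (pdx φ) := by
  cases α with
  | zero => trivial
  | succ α => exact h.2

theorem FlatY.pdy {β : ℕ} (h : FlatY U β φ) : FlatY U (β - 1) (pdy φ) := by
  cases β with
  | zero => trivial
  | succ β => exact h.2

/-- Differentiation along the axis preserves vanishing on it, and the transversal derivatives
commute with it; each commutation uses up one derivative of smoothness. -/
theorem FlatX.pdy (hU : IsOpen U) {α : ℕ} (h : FlatX U α φ)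
    (hφ : ∀ z ∈ U, ContDiffAt ℝ (α + 1 : ℕ) φ z) : FlatX U α (pdy φ) := by
  induction α generalizing φ with
  | zero => trivial
  | succ α ih =>
    refine ⟨fun z hz h0 => ?_, ?_⟩
    · have hd : DifferentiableAt ℝ φ (z.1, z.2) := (hφ z hz).differentiableAt (by simp)
      have h1 := hasDerivAt_pdy hd
      have h2 : (fun y => φ (z.1, y)) =ᶠ[𝓝 z.2] fun _ => 0 := by
        have hc : Tendsto (fun y => (z.1, y)) (𝓝 z.2) (𝓝 z) :=
          (Continuous.prodMk_right z.1).tendsto z.2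
        filter_upwards [hc (hU.mem_nhds hz)] with y hy
        exact h.1 _ hy h0
      exact h1.unique ((hasDerivAt_const z.2 (0 : ℝ)).congr_of_eventuallyEq h2)
    · refine (ih h.2 fun z hz => (hφ z hz).pdx).congr hU fun z hz => ?_
      exact (pdx_pdy_comm ((hφ z hz).of_le (by norm_cast; omega))).symm

theorem FlatY.pdx (hU : IsOpen U) {β : ℕ} (h : FlatY U β φ)
    (hφ : ∀ z ∈ U, ContDiffAt ℝ (β + 1 : ℕ) φ z) : FlatY U β (pdx φ) := by
  induction β generalizing φ with
  | zero => trivial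
  | succ β ih =>
    refine ⟨fun z hz h0 => ?_, ?_⟩
    · have hd : DifferentiableAt ℝ φ (z.1, z.2) := (hφ z hz).differentiableAt (by simp)
      have h1 := hasDerivAt_pdx hd
      have h2 : (fun x => φ (x, z.2)) =ᶠ[𝓝 z.1] fun _ => 0 := by
        have hc : Tendsto (fun x => (x, z.2)) (𝓝 z.1) (𝓝 z) :=
          (Continuous.prodMk_left z.2).tendsto z.1
        filter_upwards [hc (hU.mem_nhds hz)] with y hy
        exact h.1 _ hy h0
      exact h1.unique ((hasDerivAt_const z.1 (0 : ℝ)).congr_of_eventuallyEq h2)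
    · refine (ih h.2 fun z hz => (hφ z hz).pdy).congr hU fun z hz => ?_
      exact pdx_pdy_comm ((hφ z hz).of_le (by norm_cast; omega))

/-- A function on the line that vanishes at zero, with derivative bounded by `M` between `0` and
`x`, is at most `M |x|`. -/
theorem abs_le_of_hasDerivAt_of_abs_le {g g' : ℝ → ℝ} {x M : ℝ} (h0 : g 0 = 0)
    (hg : ∀ t, |t| ≤ |x| → HasDerivAt g (g' t) t) (hM : ∀ t, |t| ≤ |x| → |g' t| ≤ M) :
    |g x| ≤ M * |x| := by
  have hc : Convex ℝ (Metric.closedBall (0 : ℝ) |x|) := convex_closedBall _ _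
  have hmem : ∀ t, t ∈ Metric.closedBall (0 : ℝ) |x| ↔ |t| ≤ |x| := fun t => by
    rw [mem_closedBall_zero_iff, Real.norm_eq_abs]
  have := hc.norm_image_sub_le_of_norm_hasDerivWithin_le (f := g) (f' := g') (C := M)
    (fun t ht => (hg t ((hmem t).1 ht)).hasDerivWithinAt) (fun t ht => hM t ((hmem t).1 ht))
    ((hmem 0).2 (by simp)) ((hmem x).2 le_rfl)
  simpa [h0] using this

/-- Repeated use of the mean value inequality starting on the axis: each order of flatness in a
variable produces one factor of that variable, first in `x`, then in `y`. -/
theorem abs_le_of_flat {a b K : ℝ} (hK : 0 ≤ K) {α β : ℕ} (hφ : CnBound (α + β) (rect a b) φ K)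
    (hX : FlatX (rect a b) α φ) (hY : FlatY (rect a b) β φ) {z : ℝ × ℝ} (hz : z ∈ rect a b) :
    |φ z| ≤ K * |z.1| ^ α * |z.2| ^ β := by
  have hU := isOpen_rect a b
  induction α generalizing φ z with
  | zero =>
    induction β generalizing φ z with
    | zero => simpa using hφ.norm_le hz
    | succ β ih =>
      have hφ' : CnBound (0 + β + 1) (rect a b) φ K := hφ
      have key := abs_le_of_hasDerivAt_of_abs_le (g := fun y => φ (z.1, y))
        (g' := fun y => pdy φ (z.1, y)) (x := z.2) (M := K * |z.1| ^ 0 * |z.2| ^ β)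
        (hY.1 _ ⟨hz.1, by simpa using (abs_nonneg _).trans_lt hz.2⟩ rfl)
        (fun t ht => hasDerivAt_pdy (hφ'.differentiableAt hU ⟨hz.1, ht.trans_lt hz.2⟩))
        (fun t ht => (ih (hφ'.pdy hU hK) trivial hY.2
          (show (z.1, t) ∈ rect a b from ⟨hz.1, ht.trans_lt hz.2⟩)).trans (by
            dsimp only; gcongr))
      simpa [pow_succ, mul_assoc] using key
  | succ α ih =>
    have hφ' : CnBound (α + β + 1) (rect a b) φ K := hφ.mono_order (by omega)
    have hYx : FlatY (rect a b) β (pdx φ) := hY.pdx hU fun z hz =>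
      (hφ.contDiffAt hU hz).of_le (by norm_cast; omega)
    have key := abs_le_of_hasDerivAt_of_abs_le (g := fun x => φ (x, z.2))
      (g' := fun x => pdx φ (x, z.2)) (x := z.1) (M := K * |z.1| ^ α * |z.2| ^ β)
      (hX.1 _ ⟨by simpa using (abs_nonneg _).trans_lt hz.1, hz.2⟩ rfl)
      (fun t ht => hasDerivAt_pdx (hφ'.differentiableAt hU ⟨ht.trans_lt hz.1, hz.2⟩))
      (fun t ht => (ih (hφ'.pdx hU hK) hX.2 hYx
        (show (t, z.2) ∈ rect a b from ⟨ht.trans_lt hz.1, hz.2⟩)).trans (by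
          dsimp only; gcongr))
    calc _ ≤ _ := key
      _ = _ := by ring

theorem norm_iteratedFDeriv_pdx_scale {U : Set (ℝ × ℝ)} (hU : IsOpen U) {φ : ℝ × ℝ → ℝ} {p q : ℝ}
    {j : ℕ} (h : ContDiffOn ℝ (j + 1 : ℕ) φ U) {z : ℝ × ℝ} (hz : diagScale p q z ∈ U) :
    ‖iteratedFDeriv ℝ j (pdx fun w => φ (diagScale p q w)) z‖
      = |p| * ‖iteratedFDeriv ℝ j (fun w => pdx φ (diagScale p q w)) z‖ := by
  have he : (pdx fun w => φ (diagScale p q w)) =ᶠ[𝓝 z]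
      p • fun w => pdx φ (diagScale p q w) := by
    filter_upwards [(diagScale p q).continuous.continuousAt (hU.mem_nhds hz)] with w hw
    exact pdx_comp_diagScale ((h.contDiffAt (hU.mem_nhds hw)).differentiableAt (by simp))
  rw [(he.iteratedFDeriv ℝ j).eq_of_nhds, iteratedFDeriv_const_smul_apply, norm_smul,
    Real.norm_eq_abs]
  exact ((h.contDiffAt (hU.mem_nhds hz)).pdx).comp z (diagScale p q).contDiff.contDiffAt

theorem norm_iteratedFDeriv_pdy_scale {U : Set (ℝ × ℝ)} (hU : IsOpen U) {φ : ℝ × ℝ → ℝ} {p q : ℝ}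
    {j : ℕ} (h : ContDiffOn ℝ (j + 1 : ℕ) φ U) {z : ℝ × ℝ} (hz : diagScale p q z ∈ U) :
    ‖iteratedFDeriv ℝ j (pdy fun w => φ (diagScale p q w)) z‖
      = |q| * ‖iteratedFDeriv ℝ j (fun w => pdy φ (diagScale p q w)) z‖ := by
  have he : (pdy fun w => φ (diagScale p q w)) =ᶠ[𝓝 z]
      q • fun w => pdy φ (diagScale p q w) := by
    filter_upwards [(diagScale p q).continuous.continuousAt (hU.mem_nhds hz)] with w hw
    exact pdy_comp_diagScale ((h.contDiffAt (hU.mem_nhds hw)).differentiableAt (by simp))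
  rw [(he.iteratedFDeriv ℝ j).eq_of_nhds, iteratedFDeriv_const_smul_apply, norm_smul,
    Real.norm_eq_abs]
  exact ((h.contDiffAt (hU.mem_nhds hz)).pdy).comp z (diagScale p q).contDiff.contDiffAt

theorem mul_pow_pred_le {p : ℝ} (hp : p ≤ 1) (α : ℕ) : p * p ^ (α - 1) ≤ p ^ α := by
  cases α with
  | zero => simpa using hp
  | succ α => simp [pow_succ, mul_comm]

/-- The derivatives of a function which is flat on the axes, after a contraction of the axes. -/
theorem norm_iteratedFDeriv_comp_diagScale_of_flat {a b K A p q : ℝ} (hK : 0 ≤ K) (hA : 1 ≤ A)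
    (hp : |p| ≤ 1) (hq : |q| ≤ 1) {j m α β : ℕ} (hφ : CnBound m (rect a b) φ K)
    (hX : FlatX (rect a b) α φ) (hY : FlatY (rect a b) β φ) (hm₁ : j + max α β ≤ m)
    (hm₂ : α + β ≤ m) {z : ℝ × ℝ} (hz : diagScale p q z ∈ rect a b) (hz₁ : |z.1| ≤ A)
    (hz₂ : |z.2| ≤ A) :
    ‖iteratedFDeriv ℝ j (fun w => φ (diagScale p q w)) z‖
      ≤ 2 ^ j * K * A ^ (α + β) * (|p| ^ α * |q| ^ β) := by
  have hU := isOpen_rect a b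
  have hA0 : 0 ≤ A := zero_le_one.trans hA
  induction j generalizing φ m α β with
  | zero =>
    rw [norm_iteratedFDeriv_zero]
    refine (abs_le_of_flat hK (hφ.mono_order hm₂) hX hY hz).trans ?_
    simp only [diagScale_apply, abs_mul, mul_pow, pow_zero, one_mul]
    calc _ ≤ K * (|p| ^ α * A ^ α) * (|q| ^ β * A ^ β) := by gcongr
      _ = _ := by rw [pow_add]; ring
  | succ j ih =>
    obtain ⟨m, rfl⟩ : ∃ m', m = m' + 1 := ⟨m - 1, by omega⟩
    have hc : ContDiffOn ℝ (j + 1 : ℕ) φ (rect a b) :=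
      hφ.1.of_le (by norm_cast; omega)
    refine (norm_iteratedFDeriv_succ_le_pd ?_).trans ?_
    · exact (hc.contDiffAt (hU.mem_nhds hz)).comp z (diagScale p q).contDiff.contDiffAt
    · rw [norm_iteratedFDeriv_pdx_scale hU hc hz, norm_iteratedFDeriv_pdy_scale hU hc hz]
      have hYx : FlatY (rect a b) β (pdx φ) := hY.pdx hU fun z hz =>
        (hφ.contDiffAt hU hz).of_le (by norm_cast; omega)
      have hXy : FlatX (rect a b) α (pdy φ) := hX.pdy hU fun z hz =>
        (hφ.contDiffAt hU hz).of_le (by norm_cast; omega)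
      have h1 := ih (hφ.pdx hU hK) hX.pdx hYx (by omega) (by omega)
      have h2 := ih (hφ.pdy hU hK) hXy hY.pdy (by omega) (by omega)
      have e1 : A ^ (α - 1 + β) ≤ A ^ (α + β) := pow_le_pow_right₀ hA (by omega)
      have e2 : A ^ (α + (β - 1)) ≤ A ^ (α + β) := pow_le_pow_right₀ hA (by omega)
      -- A derivative in `x` loses one order of flatness but brings out the factor `p` of the chain
      -- rule, so the total power of `p` is not reduced; the same for `y` and `q`.
      have f1 := mul_pow_pred_le hp α
      have f2 := mul_pow_pred_le hq β
      calc _ ≤ |p| * (2 ^ j * K * A ^ (α - 1 + β) * (|p| ^ (α - 1) * |q| ^ β))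
            + |q| * (2 ^ j * K * A ^ (α + (β - 1)) * (|p| ^ α * |q| ^ (β - 1))) := by gcongr
        _ = 2 ^ j * K * A ^ (α - 1 + β) * ((|p| * |p| ^ (α - 1)) * |q| ^ β)
            + 2 ^ j * K * A ^ (α + (β - 1)) * (|p| ^ α * (|q| * |q| ^ (β - 1))) := by ring
        _ ≤ 2 ^ j * K * A ^ (α + β) * (|p| ^ α * |q| ^ β)
            + 2 ^ j * K * A ^ (α + β) * (|p| ^ α * |q| ^ β) := by gcongr
        _ = _ := by ring

end AxisFlat

/-! ### Taylor remainders for the weights two of `x` and one of `y`. -/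

section WeightedFlat

/-- The Taylor polynomial of `φ` at the origin has no monomial of weight less than `w`, where `x`
has weight two and `y` has weight one. -/
def WeightedFlat : ℕ → (ℝ × ℝ → ℝ) → Prop
  | 0, _ => True
  | 1, φ => φ 0 = 0
  | w + 2, φ => φ 0 = 0 ∧ WeightedFlat w (pdx φ) ∧ WeightedFlat (w + 1) (pdy φ)

variable {φ : ℝ × ℝ → ℝ}

theorem WeightedFlat.pdx {w : ℕ} (h : WeightedFlat w φ) : WeightedFlat (w - 2) (pdx φ) := by
  rcases w with _ | _ | w
  · trivial
  · trivial
  · exact h.2.1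

theorem WeightedFlat.pdy {w : ℕ} (h : WeightedFlat w φ) : WeightedFlat (w - 1) (pdy φ) := by
  rcases w with _ | _ | w
  · trivial
  · trivial
  · exact h.2.2

theorem WeightedFlat.zero {w : ℕ} (h : WeightedFlat (w + 1) φ) : φ 0 = 0 := by
  rcases w with _ | w
  · exact h
  · exact h.1

/-- In the scaled variables the chain rule gives `s²` for `∂ₓ`, which lowers the weight by two, and
`s` for `∂ᵧ`, which lowers it by one. Either way the gradient is `O(s^w)` by strong induction, and
the mean value inequality from the origin concludes. -/
theorem abs_le_of_weightedFlat {U : Set (ℝ × ℝ)} (hU : IsOpen U) {K R s : ℝ} (hK : 0 ≤ K)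
    (hR : 1 ≤ R) (hs₀ : 0 ≤ s) (hs : s ≤ 1) {w : ℕ} (hφ : CnBound w U φ K)
    (hw : WeightedFlat w φ) (hSU : ∀ z ∈ Metric.ball (0 : ℝ × ℝ) R, diagScale (s ^ 2) s z ∈ U)
    {z : ℝ × ℝ} (hz : z ∈ Metric.ball (0 : ℝ × ℝ) R) :
    |φ (diagScale (s ^ 2) s z)| ≤ K * (2 * R) ^ w * s ^ w := by
  induction w using Nat.strong_induction_on generalizing φ z with
  | _ w ih =>
    rcases w with _ | w
    · simpa using hφ.norm_le (hSU z hz)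
    · have hd : ∀ y ∈ Metric.ball (0 : ℝ × ℝ) R,
          DifferentiableAt ℝ (fun z => φ (diagScale (s ^ 2) s z)) y := fun y hy =>
        (hφ.differentiableAt hU (hSU y hy)).comp y (diagScale (s ^ 2) s).differentiableAt
      have hb : ∀ y ∈ Metric.ball (0 : ℝ × ℝ) R,
          ‖fderiv ℝ (fun z => φ (diagScale (s ^ 2) s z)) y‖
            ≤ 2 * (K * (2 * R) ^ w * s ^ (w + 1)) := by
        intro y hy
        refine (norm_fderiv_le_pd _ _).trans ?_
        have hdy := hφ.differentiableAt hU (hSU y hy)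
        rw [pdx_comp_diagScale hdy, pdy_comp_diagScale hdy, abs_mul, abs_mul,
          abs_of_nonneg hs₀, abs_of_nonneg (sq_nonneg s)]
        have h1 := ih (w + 1 - 2) (by omega)
          ((hφ.pdx hU hK).mono_order (by omega)) hw.pdx hy
        have h2 := ih w (by omega) (hφ.pdy hU hK) hw.pdy hy
        have h3 : (2 * R) ^ (w + 1 - 2) ≤ (2 * R) ^ w :=
          pow_le_pow_right₀ (by linarith) (by omega)
        -- When `w = 0` the subtraction is truncated and the claim is `s² ≤ s`, which is why `s ≤ 1`
        -- is used.
        have h4 : s ^ 2 * s ^ (w + 1 - 2) ≤ s ^ (w + 1) := by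
          rw [← pow_add]; exact pow_le_pow_of_le_one hs₀ hs (by omega)
        calc _ ≤ s ^ 2 * (K * (2 * R) ^ (w + 1 - 2) * s ^ (w + 1 - 2))
              + s * (K * (2 * R) ^ w * s ^ w) := by gcongr
          _ = K * (2 * R) ^ (w + 1 - 2) * (s ^ 2 * s ^ (w + 1 - 2))
              + K * (2 * R) ^ w * s ^ (w + 1) := by ring
          _ ≤ K * (2 * R) ^ w * s ^ (w + 1) + K * (2 * R) ^ w * s ^ (w + 1) := by gcongr
          _ = _ := by ring
      have h0 : (0 : ℝ × ℝ) ∈ Metric.ball (0 : ℝ × ℝ) R := Metric.mem_ball_self (by linarith)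
      have := (convex_ball (0 : ℝ × ℝ) R).norm_image_sub_le_of_norm_fderiv_le hd hb h0 hz
      rw [map_zero, hw.zero, sub_zero, sub_zero, Real.norm_eq_abs] at this
      have hzR : ‖z‖ ≤ R := (mem_ball_zero_iff.1 hz).le
      calc _ ≤ _ := this
        _ ≤ 2 * (K * (2 * R) ^ w * s ^ (w + 1)) * R := by gcongr
        _ = _ := by ring

/-- Weighted Taylor estimate, with all derivatives, in the scaled variables. -/
theorem norm_iteratedFDeriv_comp_diagScale_of_weightedFlat {U : Set (ℝ × ℝ)} (hU : IsOpen U)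
    {K R s : ℝ} (hK : 0 ≤ K) (hR : 1 ≤ R) (hs₀ : 0 ≤ s) (hs : s ≤ 1) {j w m : ℕ}
    (hφ : CnBound m U φ K) (hw : WeightedFlat w φ)
    (hSU : ∀ z ∈ Metric.ball (0 : ℝ × ℝ) R, diagScale (s ^ 2) s z ∈ U) (hj : j ≤ m) (hwm : w ≤ m)
    {z : ℝ × ℝ} (hz : z ∈ Metric.ball (0 : ℝ × ℝ) R) :
    ‖iteratedFDeriv ℝ j (fun z => φ (diagScale (s ^ 2) s z)) z‖
      ≤ 2 ^ j * K * (2 * R) ^ w * s ^ w := by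
  induction j generalizing φ w m with
  | zero =>
    rw [norm_iteratedFDeriv_zero, Real.norm_eq_abs, pow_zero, one_mul]
    exact abs_le_of_weightedFlat hU hK hR hs₀ hs (hφ.mono_order hwm) hw hSU hz
  | succ j ih =>
    obtain ⟨m, rfl⟩ : ∃ m', m = m' + 1 := ⟨m - 1, by omega⟩
    have hc : ContDiffOn ℝ (j + 1 : ℕ) φ U := hφ.1.of_le (by norm_cast)
    refine (norm_iteratedFDeriv_succ_le_pd ?_).trans ?_
    · exact (hc.contDiffAt (hU.mem_nhds (hSU z hz))).comp z (diagScale _ _).contDiff.contDiffAt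
    · rw [norm_iteratedFDeriv_pdx_scale hU hc (hSU z hz),
        norm_iteratedFDeriv_pdy_scale hU hc (hSU z hz), abs_of_nonneg hs₀,
        abs_of_nonneg (sq_nonneg s)]
      have h1 := ih (hφ.pdx hU hK) hw.pdx (by omega) (by omega)
      have h2 := ih (hφ.pdy hU hK) hw.pdy (by omega) (by omega)
      have hR0 : 0 ≤ R := by linarith
      have e1 : (2 * R) ^ (w - 2) ≤ (2 * R) ^ w := pow_le_pow_right₀ (by linarith) (by omega)
      have e2 : (2 * R) ^ (w - 1) ≤ (2 * R) ^ w := pow_le_pow_right₀ (by linarith) (by omega)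
      have f1 : s ^ 2 * s ^ (w - 2) ≤ s ^ w := by
        rw [← pow_add]; exact pow_le_pow_of_le_one hs₀ hs (by omega)
      have f2 : s * s ^ (w - 1) ≤ s ^ w := by
        rw [← pow_succ']; exact pow_le_pow_of_le_one hs₀ hs (by omega)
      calc _ ≤ s ^ 2 * (2 ^ j * K * (2 * R) ^ (w - 2) * s ^ (w - 2))
            + s * (2 ^ j * K * (2 * R) ^ (w - 1) * s ^ (w - 1)) := by gcongr
        _ = 2 ^ j * K * (2 * R) ^ (w - 2) * (s ^ 2 * s ^ (w - 2))
            + 2 ^ j * K * (2 * R) ^ (w - 1) * (s * s ^ (w - 1)) := by ring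
        _ ≤ 2 ^ j * K * (2 * R) ^ w * s ^ w + 2 ^ j * K * (2 * R) ^ w * s ^ w := by gcongr
        _ = _ := by ring

end WeightedFlat

/-! ### Iterates near a symplectic saddle in normal form. -/

section SaddlePassage

/-- A planar map with a saddle in normal form on a rectangle, with explicit bounds. -/
structure IsNormalSaddle (m : ℕ) (a b K θ : ℝ) (T : ℝ × ℝ → ℝ × ℝ) (lam beta : ℝ) : Prop where
  lam_ne : lam ≠ 0
  abs_lam_le : |lam| ≤ θ
  abs_inv_le : |lam|⁻¹ ≤ K
  abs_beta_le : |beta| ≤ K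
  bound_fst : CnBound m (rect a b) (fun z => (T z).1 - lam * z.1) K
  bound_snd : CnBound m (rect a b) (fun z => (T z).2 - lam⁻¹ * z.2) K
  normal_fst : ∀ z ∈ rect a b, |(T z).1 - lam * z.1 * (1 + beta * (z.1 * z.2))|
    ≤ K * (|z.1| * |z.1 * z.2| * (|z.1| + |z.2|))
  normal_snd : ∀ z ∈ rect a b, |(T z).2 - lam⁻¹ * z.2 * (1 + beta * (z.1 * z.2))⁻¹|
    ≤ K * (|z.2| * |z.1 * z.2| * (|z.1| + |z.2|))

theorem abs_inv_one_add_sub_one_le {t : ℝ} (ht : |t| ≤ 1 / 2) : |(1 + t)⁻¹ - 1| ≤ 2 * |t| := by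
  have h := abs_le.1 ht
  have h1 : 0 < 1 + t := by linarith
  have : (1 + t)⁻¹ - 1 = -t / (1 + t) := by field_simp; ring
  rw [this, abs_div, abs_neg, abs_of_pos h1, div_le_iff₀ h1]
  nlinarith [abs_nonneg t]

theorem abs_inv_one_add_sub_le {t : ℝ} (ht : |t| ≤ 1 / 2) :
    |(1 + t)⁻¹ - 1 + t| ≤ 2 * t ^ 2 := by
  have h := abs_le.1 ht
  have h1 : 0 < 1 + t := by linarith
  have : (1 + t)⁻¹ - 1 + t = t ^ 2 / (1 + t) := by field_simp; ring
  rw [this, abs_div, abs_of_pos h1, div_le_iff₀ h1, abs_of_nonneg (sq_nonneg t)]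
  nlinarith [sq_nonneg t]

namespace IsNormalSaddle

variable {m : ℕ} {a b K θ : ℝ} {T : ℝ × ℝ → ℝ × ℝ} {lam beta : ℝ}

theorem one_le (h : IsNormalSaddle m a b K θ T lam beta) (hθ : θ < 1) : 1 ≤ K :=
  (one_le_inv₀ (abs_pos.2 h.lam_ne)).2 (h.abs_lam_le.trans hθ.le) |>.trans h.abs_inv_le

theorem abs_fst_le (h : IsNormalSaddle m a b K θ T lam beta) {z : ℝ × ℝ} (hz : z ∈ rect a b) :
    |(T z).1 - lam * z.1| ≤ (|lam * beta| * |z.2| + K * |z.2| * (|z.1| + |z.2|)) * |z.1| ^ 2 := by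
  have h1 := h.normal_fst z hz
  have e : (T z).1 - lam * z.1 = ((T z).1 - lam * z.1 * (1 + beta * (z.1 * z.2)))
    + lam * beta * (z.1 ^ 2 * z.2) := by ring
  rw [e]
  refine (abs_add_le _ _).trans ((add_le_add_left h1 _).trans (le_of_eq ?_))
  simp only [abs_mul, abs_pow]; ring

theorem abs_snd_le (h : IsNormalSaddle m a b K θ T lam beta) {z : ℝ × ℝ} (hz : z ∈ rect a b)
    (ht : |beta * (z.1 * z.2)| ≤ 1 / 2) :
    |(T z).2 - lam⁻¹ * z.2|
      ≤ (2 * |lam⁻¹ * beta| * |z.1| + K * |z.1| * (|z.1| + |z.2|)) * |z.2| ^ 2 := by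
  have h1 := h.normal_snd z hz
  have h2 := abs_inv_one_add_sub_one_le ht
  have e : (T z).2 - lam⁻¹ * z.2 = ((T z).2 - lam⁻¹ * z.2 * (1 + beta * (z.1 * z.2))⁻¹)
    + lam⁻¹ * z.2 * ((1 + beta * (z.1 * z.2))⁻¹ - 1) := by ring
  rw [e]
  refine (abs_add_le _ _).trans ?_
  rw [abs_mul (lam⁻¹ * z.2)]
  calc _ ≤ K * (|z.2| * |z.1 * z.2| * (|z.1| + |z.2|))
        + |lam⁻¹ * z.2| * (2 * |beta * (z.1 * z.2)|) := by gcongr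
    _ = _ := by simp only [abs_mul]; ring

/-- The nonlinear part is the resonant term `λβx²y` plus a remainder divisible, in absolute value,
by `x²|y|`; these are the orders of vanishing that balance the growth `λ⁻ⁱ` of the rescaling. -/
theorem flat_fst (h : IsNormalSaddle (m + 1) a b K θ T lam beta) :
    FlatX (rect a b) 2 (fun z => (T z).1 - lam * z.1) ∧
      FlatY (rect a b) 1 (fun z => (T z).1 - lam * z.1) := by
  refine ⟨⟨fun z hz h0 => ?_, fun z hz h0 => ?_, trivial⟩, fun z hz h0 => ?_, trivial⟩
  · have := h.abs_fst_le hz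
    rw [h0] at this
    simpa [h0] using this
  · obtain ⟨x, y⟩ := z
    obtain rfl : x = 0 := h0
    have hd := hasDerivAt_pdx (h.bound_fst.differentiableAt (isOpen_rect a b) hz)
    refine hd.unique ?_
    -- Only the size of the remainder is known, not its derivatives. A bound by a multiple of `x²`
    -- is enough: it forces the `x`-derivative on the axis to vanish.
    have hO : (fun x => (T (x, y)).1 - lam * x) =O[𝓝 0] fun x : ℝ => ‖x - 0‖ ^ 2 := by
      refine Asymptotics.IsBigO.of_bound (|lam * beta| * |y| + K * |y| * (a + |y|)) ?_
      have hc : Tendsto (fun x => (x, y)) (𝓝 0) (𝓝 ((0 : ℝ), y)) :=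
        (Continuous.prodMk_left y).tendsto 0
      filter_upwards [hc ((isOpen_rect a b).mem_nhds hz)] with x hx
      have h2 := h.abs_fst_le hx
      have hK : 0 ≤ K := (norm_nonneg _).trans (h.bound_fst.norm_le hz)
      have h3 : |x| ≤ a := hx.1.le
      simp only [Real.norm_eq_abs, sub_zero, abs_pow, abs_abs] at h2 ⊢
      exact h2.trans (by gcongr)
    have := (hO.hasFDerivAt (by norm_num)).hasDerivAt
    simpa using this
  · have := h.abs_fst_le hz
    rw [h0] at this
    simpa using this

theorem flat_snd (h : IsNormalSaddle (m + 1) a b K θ T lam beta) :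
    FlatX (rect a b) 1 (fun z => (T z).2 - lam⁻¹ * z.2) ∧
      FlatY (rect a b) 2 (fun z => (T z).2 - lam⁻¹ * z.2) := by
  refine ⟨⟨fun z hz h0 => ?_, trivial⟩, fun z hz h0 => ?_, fun z hz h0 => ?_, trivial⟩
  · have := h.abs_snd_le hz (by simp [h0])
    rw [h0] at this
    simpa using this
  · have := h.abs_snd_le hz (by simp [h0])
    rw [h0] at this
    simpa [h0] using this
  · obtain ⟨x, y⟩ := z
    obtain rfl : y = 0 := h0
    have hd := hasDerivAt_pdy (h.bound_snd.differentiableAt (isOpen_rect a b) hz)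
    refine hd.unique ?_
    have hO : (fun y => (T (x, y)).2 - lam⁻¹ * y) =O[𝓝 0] fun y : ℝ => ‖y - 0‖ ^ 2 := by
      refine Asymptotics.IsBigO.of_bound
        (2 * |lam⁻¹ * beta| * |x| + K * |x| * (|x| + b)) ?_
      have hc : Tendsto (fun y => (x, y)) (𝓝 0) (𝓝 (x, (0 : ℝ))) :=
        (Continuous.prodMk_right x).tendsto 0
      -- The factor `(1 + βxy)⁻¹` is controlled for `|βxy| ≤ 1/2`, which holds close to the axis `y
      -- = 0`.
      have hc2 : Tendsto (fun y : ℝ => |beta * (x * y)|) (𝓝 0) (𝓝 0) := by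
        have : Continuous fun y : ℝ => |beta * (x * y)| := by fun_prop
        simpa using this.tendsto 0
      filter_upwards [hc ((isOpen_rect a b).mem_nhds hz),
        hc2.eventually (eventually_le_nhds (show (0 : ℝ) < 1 / 2 by norm_num))] with y hy hy2
      have h2 := h.abs_snd_le hy hy2
      have hK : 0 ≤ K := (norm_nonneg _).trans (h.bound_fst.norm_le hz)
      have h3 : |y| ≤ b := hy.2.le
      simp only [Real.norm_eq_abs, sub_zero, abs_pow, abs_abs] at h2 ⊢
      exact h2.trans (by gcongr)
    have := (hO.hasFDerivAt (by norm_num)).hasDerivAt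
    simpa using this

end IsNormalSaddle

/-- The increment of the rescaled orbit `(λ⁻ⁱ xᵢ, λⁱ⁻ᵏ yᵢ)` at the `i`-th step. -/
noncomputable def saddleIncr (T : ℝ × ℝ → ℝ × ℝ) (lam : ℝ) (k i : ℕ) (z : ℝ × ℝ) : ℝ × ℝ :=
  let w := diagScale (lam ^ i) (lam ^ (k - i)) z
  ((lam ^ (i + 1))⁻¹ * ((T w).1 - lam * w.1),
    (lam ^ (i + 1) * (lam ^ k)⁻¹) * ((T w).2 - lam⁻¹ * w.2))

/-- The rescaled orbit `(λ⁻ⁱ xᵢ, λⁱ⁻ᵏ yᵢ)`, as a function of its initial point. -/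
noncomputable def saddleOrbit (T : ℝ × ℝ → ℝ × ℝ) (lam : ℝ) (k : ℕ) : ℕ → ℝ × ℝ → ℝ × ℝ
  | 0, z => z
  | i + 1, z => saddleOrbit T lam k i z + saddleIncr T lam k i (saddleOrbit T lam k i z)

/-- The increments are defined so that undoing the scaling at step `i` returns the true orbit; the
scaling at step zero is `(1, λᵏ)` and at step `k` it is `(λᵏ, 1)`. -/
theorem iterate_diagScale {T : ℝ × ℝ → ℝ × ℝ} {lam : ℝ} (hlam : lam ≠ 0) (k : ℕ) (z : ℝ × ℝ)
    {i : ℕ} (hi : i ≤ k) : T^[i] (diagScale 1 (lam ^ k) z)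
      = diagScale (lam ^ i) (lam ^ (k - i)) (saddleOrbit T lam k i z) := by
  induction i with
  | zero => simp [saddleOrbit]
  | succ i ih =>
    rw [Function.iterate_succ_apply', ih (by omega)]
    obtain ⟨l, rfl⟩ := Nat.exists_eq_add_of_le hi
    have e1 : i + 1 + l - i = l + 1 := by omega
    have e2 : i + 1 + l - (i + 1) = l := by omega
    rw [e1, e2]
    simp only [saddleOrbit, saddleIncr, e1]
    set Z := saddleOrbit T lam (i + 1 + l) i z
    set w := diagScale (lam ^ i) (lam ^ (l + 1)) Z with hw
    have hw1 : w.1 = lam ^ i * Z.1 := rfl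
    have hw2 : w.2 = lam ^ (l + 1) * Z.2 := rfl
    ext
    · simp only [diagScale_apply, Prod.fst_add]
      rw [hw1]; field_simp; ring
    · simp only [diagScale_apply, Prod.snd_add]
      rw [hw2, pow_add lam (i + 1) l]; field_simp; ring

theorem diagScale_mem_rect {a b p q : ℝ} (hp : |p| ≤ 1) (hq : |q| ≤ 1) {z : ℝ × ℝ}
    (hz : z ∈ rect a b) : diagScale p q z ∈ rect a b := by
  refine ⟨?_, ?_⟩
  · simp only [diagScale_apply, abs_mul]
    exact (mul_le_of_le_one_left (abs_nonneg _) hp).trans_lt hz.1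
  · simp only [diagScale_apply, abs_mul]
    exact (mul_le_of_le_one_left (abs_nonneg _) hq).trans_lt hz.2

variable {m n : ℕ} {a b A K θ ρ : ℝ} {T : ℝ × ℝ → ℝ × ℝ} {lam beta : ℝ}

/-- The factors are `λ²ⁱ λᵏ⁻ⁱ` from flatness of orders `(2, 1)` against the prefactor `λ⁻ⁱ⁻¹`, and
`λⁱ λ²⁽ᵏ⁻ⁱ⁾` from orders `(1, 2)` against `λⁱ⁺¹⁻ᵏ`. In both products `i` cancels. Two derivatives
are lost because the flatness reaches order two. -/
theorem cnBound_saddleIncr (h : IsNormalSaddle m a b K θ T lam beta) (hθ : θ < 1) (hn : 1 ≤ n)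
    (hnm : n + 2 ≤ m) (hA : 1 ≤ A) (ha : a ≤ A) (hb : b ≤ A) {k i : ℕ} (hi : i < k) :
    CnBound n (rect a b) (saddleIncr T lam k i) (2 ^ n * K ^ 2 * A ^ 3 * |lam| ^ k) := by
  obtain ⟨m, rfl⟩ : ∃ m', m = m' + 1 := ⟨m - 1, by omega⟩
  have hK := h.one_le hθ
  have hl1 : |lam| ≤ 1 := h.abs_lam_le.trans hθ.le
  have hl0 : 0 < |lam| := abs_pos.2 h.lam_ne
  have hp : |lam ^ i| ≤ 1 := by rw [abs_pow]; exact pow_le_one₀ (abs_nonneg _) hl1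
  have hq : |lam ^ (k - i)| ≤ 1 := by rw [abs_pow]; exact pow_le_one₀ (abs_nonneg _) hl1
  have hst : MapsTo (diagScale (lam ^ i) (lam ^ (k - i))) (rect a b) (rect a b) :=
    fun z hz => diagScale_mem_rect hp hq hz
  obtain ⟨l, rfl⟩ : ∃ l, k = i + 1 + l := Nat.exists_eq_add_of_le hi
  have e1 : i + 1 + l - i = l + 1 := by omega
  rw [e1] at hq hst
  have hA0 : 0 < A := by linarith
  have bnd : ∀ j ≤ n, (2 : ℝ) ^ j ≤ 2 ^ n := fun j hj => pow_le_pow_right₀ (by norm_num) hj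
  -- The common estimate for both components; the last hypothesis on `c` records the cancellation of
  -- `i`.
  have main : ∀ (φ : ℝ × ℝ → ℝ) (α β : ℕ) (c : ℝ), CnBound (m + 1) (rect a b) φ K →
      FlatX (rect a b) α φ → FlatY (rect a b) β φ → α + β = 3 → 1 ≤ α → 1 ≤ β →
      |c| * (|lam ^ i| ^ α * |lam ^ (l + 1)| ^ β) ≤ K * |lam| ^ (i + 1 + l) →
      CnBound n (rect a b) (fun z => c • φ (diagScale (lam ^ i) (lam ^ (l + 1)) z))
        (2 ^ n * K ^ 2 * A ^ 3 * |lam| ^ (i + 1 + l)) := by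
    intro φ α β c hφ hX hY hαβ hα hβ hc
    have h1 : CnBound n (rect a b) (fun z => φ (diagScale (lam ^ i) (lam ^ (l + 1)) z))
        (2 ^ n * K * A ^ 3 * (|lam ^ i| ^ α * |lam ^ (l + 1)| ^ β)) := by
      refine ⟨(hφ.1.of_le (by norm_cast; omega)).comp (diagScale _ _).contDiff.contDiffOn hst,
        fun j hj z hz => ?_⟩
      have := norm_iteratedFDeriv_comp_diagScale_of_flat (by linarith) hA hp hq (j := j) hφ hX hY
        (by omega) (by omega) (hst hz) (hz.1.le.trans ha) (hz.2.le.trans hb)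
      rw [hαβ] at this
      have := bnd j hj
      exact ‹‖_‖ ≤ _›.trans (by gcongr)
    refine (h1.const_smul (isOpen_rect a b) c).mono ?_
    calc _ = 2 ^ n * K * A ^ 3 * (|c| * (|lam ^ i| ^ α * |lam ^ (l + 1)| ^ β)) := by ring
      _ ≤ 2 ^ n * K * A ^ 3 * (K * |lam| ^ (i + 1 + l)) := by gcongr
      _ = _ := by ring
  obtain ⟨fX, fY⟩ := h.flat_fst
  obtain ⟨gX, gY⟩ := h.flat_snd
  have c1 := main _ 2 1 ((lam ^ (i + 1))⁻¹) h.bound_fst fX fY rfl (by norm_num) le_rfl (by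
    rw [abs_inv, abs_pow, abs_pow, abs_pow]
    calc _ = |lam|⁻¹ * |lam| ^ (i + 1 + l) := by field_simp; ring
      _ ≤ _ := by gcongr; exact h.abs_inv_le)
  have c2 := main _ 1 2 (lam ^ (i + 1) * (lam ^ (i + 1 + l))⁻¹) h.bound_snd gX gY rfl le_rfl
    (by norm_num) (by
    rw [abs_mul, abs_inv, abs_pow, abs_pow, abs_pow, abs_pow]
    calc _ = |lam| * |lam| ^ (i + 1 + l) := by field_simp; ring
      _ ≤ _ := by gcongr; exact hl1.trans hK)
  refine (c1.prodMk c2 (isOpen_rect a b)).congr (isOpen_rect a b) fun z _ => ?_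
  simp [saddleIncr, e1]

/-- The rescaled passage near the saddle is `C^n`-close to the identity. -/
theorem cnBound_saddleOrbit (h : IsNormalSaddle m a b K θ T lam beta) (hθ : θ < 1) (hn : 1 ≤ n)
    (hnm : n + 2 ≤ m) (hA : 1 ≤ A) (ha : a ≤ A) (hb : b ≤ A) {s : Set (ℝ × ℝ)} (hs : IsOpen s)
    (hsρ : ∀ z ∈ s, ∀ w, ‖w - z‖ ≤ ρ → w ∈ rect a b) {C : ℝ}
    (hC : n.factorial * (2 ^ n * K ^ 2 * A ^ 3) * 2 ^ n ≤ C) {k : ℕ}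
    (hk₁ : C * k * |lam| ^ k ≤ 1) (hkρ : C * k * |lam| ^ k ≤ ρ) {i : ℕ} (hi : i ≤ k) :
    CnBound n s (fun z => saddleOrbit T lam k i z - z) (C * i * |lam| ^ k) ∧
      MapsTo (saddleOrbit T lam k i) s (rect a b) := by
  have hK := h.one_le hθ
  have hC0 : 0 ≤ C := le_trans (by positivity) hC
  have key : ∀ i ≤ k, C * i * |lam| ^ k ≤ C * k * |lam| ^ k := fun i hi => by gcongr
  have hmaps : ∀ i ≤ k, CnBound n s (fun z => saddleOrbit T lam k i z - z) (C * i * |lam| ^ k) →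
      MapsTo (saddleOrbit T lam k i) s (rect a b) := fun i hi hc z hz =>
    hsρ z hz _ ((hc.norm_le hz).trans ((key i hi).trans hkρ))
  suffices hmain : CnBound n s (fun z => saddleOrbit T lam k i z - z) (C * i * |lam| ^ k) from
    ⟨hmain, hmaps i hi hmain⟩
  induction i with
  | zero =>
    refine (CnBound.const (c := (0 : ℝ × ℝ)) (by simp)).congr hs fun z _ => ?_
    simp [saddleOrbit]
  | succ i ih =>
    have hci := ih (by omega)
    have hinc := cnBound_saddleIncr h hθ hn hnm hA ha hb (show i < k by omega)
    have hcd : ContDiffOn ℝ n (saddleOrbit T lam k i) s := by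
      have : ContDiffOn ℝ n (fun z => (saddleOrbit T lam k i z - z) + z) s :=
        hci.1.add contDiffOn_id
      simpa using this
    -- The displacement is at most one in `Cⁿ` at every step, so the orbit has derivatives of norm
    -- at most `2 ≤ 2 ^ j`. Hence the Faà di Bruno constant does not grow with `i`, and the
    -- increments simply add up.
    have hD : ∀ z ∈ s, ∀ j, 1 ≤ j → j ≤ n →
        ‖iteratedFDeriv ℝ j (saddleOrbit T lam k i) z‖ ≤ 2 ^ j := by
      intro z hz j h1 hj
      have e : saddleOrbit T lam k i = (fun z => saddleOrbit T lam k i z - z) + id := by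
        funext z; simp
      rw [e, iteratedFDeriv_add_apply ((hci.contDiffAt hs hz).of_le (mod_cast hj))
        contDiffAt_id]
      have hid : ‖iteratedFDeriv ℝ j (id : ℝ × ℝ → ℝ × ℝ) z‖ ≤ 1 := by
        have := CnBound.norm_iteratedFDeriv_affine (f := (id : ℝ × ℝ → ℝ × ℝ))
          (A := ContinuousLinearMap.id ℝ (ℝ × ℝ)) (a := 0) (fun z => by simp) h1 z
        exact this.trans (pow_le_one₀ (norm_nonneg _) ContinuousLinearMap.norm_id_le)
      have h3 := (hci.2 j hj z hz).trans ((key i (by omega)).trans hk₁)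
      refine (norm_add_le _ _).trans ((add_le_add h3 hid).trans ?_)
      calc (1 : ℝ) + 1 = 2 ^ 1 := by norm_num
        _ ≤ 2 ^ j := pow_le_pow_right₀ (by norm_num) h1
    have hcomp : CnBound n s (fun z => saddleIncr T lam k i (saddleOrbit T lam k i z))
        (C * |lam| ^ k) := by
      refine ⟨hinc.1.comp hcd (hmaps i (by omega) hci), fun j hj z hz => ?_⟩
      refine (hinc.norm_iteratedFDeriv_comp hcd hs (isOpen_rect a b) (hmaps i (by omega) hci) hz
        (hD z hz) hj).trans ?_
      have e1 : (j.factorial : ℝ) ≤ n.factorial := by exact_mod_cast Nat.factorial_le hj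
      have e2 : (2 : ℝ) ^ j ≤ 2 ^ n := pow_le_pow_right₀ (by norm_num) hj
      calc _ ≤ n.factorial * (2 ^ n * K ^ 2 * A ^ 3 * |lam| ^ k) * 2 ^ n := by gcongr
        _ = n.factorial * (2 ^ n * K ^ 2 * A ^ 3) * 2 ^ n * |lam| ^ k := by ring
        _ ≤ _ := by gcongr
    refine ((hci.add hcomp hs).congr hs fun z _ => ?_).mono (le_of_eq (by push_cast; ring))
    simp only [saddleOrbit]; abel

theorem sum_pow_le {x : ℝ} (hx₀ : 0 ≤ x) (hxθ : x ≤ θ) (hθ : θ < 1) (k : ℕ) :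
    ∑ i ∈ Finset.range k, x ^ i ≤ (1 - θ)⁻¹ := by
  have hx1 : x < 1 := hxθ.trans_lt hθ
  calc _ ≤ ∑' i, x ^ i := (summable_geometric_of_lt_one hx₀ hx1).sum_le_tsum _
        (fun i _ => pow_nonneg hx₀ i)
    _ = (1 - x)⁻¹ := tsum_geometric_of_lt_one hx₀ hx1
    _ ≤ _ := by gcongr

theorem abs_sq_mul_sub_le {A δ u v x y : ℝ} (hA : 1 ≤ A) (hu : |u| ≤ A) (hx : |x| ≤ A)
    (hy : |y| ≤ A) (h1 : |u - x| ≤ δ) (h2 : |v - y| ≤ δ) :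
    |u ^ 2 * v - x ^ 2 * y| ≤ 3 * A ^ 2 * δ := by
  have e : u ^ 2 * v - x ^ 2 * y = u * u * (v - y) + u * y * (u - x) + x * y * (u - x) := by ring
  have hA0 : 0 ≤ A := by linarith
  rw [e]
  refine (abs_add_three _ _ _).trans ?_
  simp only [abs_mul]
  calc _ ≤ A * A * δ + A * A * δ + A * A * δ := by gcongr
    _ = _ := by ring

/-- One step of the rescaled orbit, to the first order in `λᵏ`. -/
theorem abs_saddleIncr_sub_le (h : IsNormalSaddle m a b K θ T lam beta) (hθ : θ < 1)
    (hA : 1 ≤ A) (ha : a ≤ A) (hb : b ≤ A) {k i : ℕ} (hi : i < k) {z : ℝ × ℝ}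
    (hz : z ∈ rect a b) (hk : K * A ^ 2 * |lam| ^ k ≤ 1 / 2) :
    |(saddleIncr T lam k i z).1 - beta * lam ^ k * (z.1 ^ 2 * z.2)|
        ≤ K ^ 2 * A ^ 4 * |lam| ^ k * (|lam| ^ i + |lam| ^ (k - i)) ∧
    |(saddleIncr T lam k i z).2 + beta * lam ^ k * (z.2 ^ 2 * z.1)|
        ≤ K ^ 2 * A ^ 4 * |lam| ^ k * (|lam| ^ i + |lam| ^ (k - i))
          + 2 * K ^ 2 * A ^ 5 * |lam| ^ k * |lam| ^ k := by
  have hK := h.one_le hθ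
  have hl := h.lam_ne
  have hl1 : |lam| ≤ 1 := h.abs_lam_le.trans hθ.le
  have hl0 : 0 < |lam| := abs_pos.2 hl
  obtain ⟨l, rfl⟩ : ∃ l, k = i + 1 + l := Nat.exists_eq_add_of_le hi
  have e1 : i + 1 + l - i = l + 1 := by omega
  have hA0 : 0 < A := by linarith
  have hz1 : |z.1| ≤ A := hz.1.le.trans ha
  have hz2 : |z.2| ≤ A := hz.2.le.trans hb
  rw [e1]
  simp only [saddleIncr, e1]
  set w := diagScale (lam ^ i) (lam ^ (l + 1)) z with hw
  have hwm : w ∈ rect a b := diagScale_mem_rect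
    (by rw [abs_pow]; exact pow_le_one₀ (abs_nonneg _) hl1)
    (by rw [abs_pow]; exact pow_le_one₀ (abs_nonneg _) hl1) hz
  have hw1 : w.1 = lam ^ i * z.1 := rfl
  have hw2 : w.2 = lam ^ (l + 1) * z.2 := rfl
  have n1 := h.normal_fst w hwm
  have n2 := h.normal_snd w hwm
  have a1 : |w.1| ≤ |lam| ^ i * A := by rw [hw1, abs_mul, abs_pow]; gcongr
  have a2 : |w.2| ≤ |lam| ^ (l + 1) * A := by rw [hw2, abs_mul, abs_pow]; gcongr
  have pw : w.1 * w.2 = lam ^ (i + 1 + l) * (z.1 * z.2) := by rw [hw1, hw2]; ring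
  have g12 : |w.1 * w.2| ≤ |lam| ^ (i + 1 + l) * A ^ 2 := by
    rw [pw, abs_mul, abs_mul, abs_pow, sq]; gcongr
  constructor
  · have e2 : (lam ^ (i + 1))⁻¹ * ((T w).1 - lam * w.1) -
        beta * lam ^ (i + 1 + l) * (z.1 ^ 2 * z.2)
        = (lam ^ (i + 1))⁻¹ * ((T w).1 - lam * w.1 * (1 + beta * (w.1 * w.2))) := by
      rw [pw, hw1]; field_simp; ring
    rw [e2, abs_mul, abs_inv, abs_pow]
    calc _ ≤ (|lam| ^ (i + 1))⁻¹ * (K * (|lam| ^ i * A * (|lam| ^ (i + 1 + l) * A ^ 2)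
          * (|lam| ^ i * A + |lam| ^ (l + 1) * A))) := by
          gcongr; exact n1.trans (by gcongr)
      _ = |lam|⁻¹ * (K * A ^ 4 * |lam| ^ (i + 1 + l) * (|lam| ^ i + |lam| ^ (l + 1))) := by
          field_simp; ring
      _ ≤ K * (K * A ^ 4 * |lam| ^ (i + 1 + l) * (|lam| ^ i + |lam| ^ (l + 1))) := by
          gcongr; exact h.abs_inv_le
      _ = _ := by ring
  · set t := beta * (w.1 * w.2) with ht
    have ht1 : |t| ≤ K * A ^ 2 * |lam| ^ (i + 1 + l) := by
      rw [ht, abs_mul]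
      calc _ ≤ K * (|lam| ^ (i + 1 + l) * A ^ 2) := by gcongr; exact h.abs_beta_le
        _ = _ := by ring
    -- With `t = βxy` at the current point, the term `-t` of `(1 + t)⁻¹ - 1` is exactly the resonant
    -- term; there remain the error of the normal form and the quadratic error of the inverse.
    have e2 : lam ^ (i + 1) * (lam ^ (i + 1 + l))⁻¹ * ((T w).2 - lam⁻¹ * w.2)
        + beta * lam ^ (i + 1 + l) * (z.2 ^ 2 * z.1)
        = lam ^ (i + 1) * (lam ^ (i + 1 + l))⁻¹ * ((T w).2 - lam⁻¹ * w.2 * (1 + t)⁻¹)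
          + z.2 * ((1 + t)⁻¹ - 1 + t) := by
      have e3 : beta * lam ^ (i + 1 + l) * (z.2 ^ 2 * z.1) = z.2 * t := by
        rw [ht, pw]; ring
      have e4 : lam ^ (i + 1) * (lam ^ (i + 1 + l))⁻¹ * (lam⁻¹ * w.2) = z.2 := by
        rw [hw2, pow_add lam (i + 1) l]; field_simp; ring
      rw [e3]
      linear_combination ((1 + t)⁻¹ - 1) * e4
    rw [e2]
    refine (abs_add_le _ _).trans (add_le_add ?_ ?_)
    · rw [abs_mul, abs_mul, abs_inv, abs_pow, abs_pow]
      calc _ ≤ |lam| ^ (i + 1) * (|lam| ^ (i + 1 + l))⁻¹ * (K * (|lam| ^ (l + 1) * A *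
            (|lam| ^ (i + 1 + l) * A ^ 2) * (|lam| ^ i * A + |lam| ^ (l + 1) * A))) := by
            gcongr; exact n2.trans (by gcongr)
        _ = |lam| * (K * A ^ 4 * |lam| ^ (i + 1 + l) * (|lam| ^ i + |lam| ^ (l + 1))) := by
            field_simp; ring
        _ ≤ K * (K * A ^ 4 * |lam| ^ (i + 1 + l) * (|lam| ^ i + |lam| ^ (l + 1))) := by
            gcongr; exact hl1.trans hK
        _ = _ := by ring
    · rw [abs_mul]
      have h5 := abs_inv_one_add_sub_le (ht1.trans hk)
      have h6 : t ^ 2 ≤ (K * A ^ 2 * |lam| ^ (i + 1 + l)) ^ 2 := sq_le_sq' (by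
        linarith [(abs_le.1 ht1).1]) (abs_le.1 ht1).2
      calc _ ≤ A * (2 * (K * A ^ 2 * |lam| ^ (i + 1 + l)) ^ 2) := by
            gcongr; exact h5.trans (by linarith)
        _ = _ := by ring

/-- The rescaled passage near the saddle, to the first order in `λᵏ`. -/
theorem abs_saddleOrbit_sub_le (h : IsNormalSaddle m a b K θ T lam beta) (hθ : θ < 1)
    (hA : 1 ≤ A) (ha : a ≤ A) (hb : b ≤ A) {k : ℕ} {z : ℝ × ℝ} {C : ℝ} (hC : 0 ≤ C)
    (hzr : ∀ i ≤ k, saddleOrbit T lam k i z ∈ rect a b)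
    (hzC : ∀ i ≤ k, ‖saddleOrbit T lam k i z - z‖ ≤ C * k * |lam| ^ k)
    (hk : K * A ^ 2 * |lam| ^ k ≤ 1 / 2) (hk2 : (k : ℝ) ^ 2 * |lam| ^ k ≤ 1) :
    |(saddleOrbit T lam k k z).1 - z.1 - k * (beta * lam ^ k * (z.1 ^ 2 * z.2))|
        ≤ (2 * K ^ 2 * A ^ 4 * (1 - θ)⁻¹ + 2 * K ^ 2 * A ^ 5 + 3 * K * A ^ 2 * C) * |lam| ^ k ∧
    |(saddleOrbit T lam k k z).2 - z.2 + k * (beta * lam ^ k * (z.2 ^ 2 * z.1))|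
        ≤ (2 * K ^ 2 * A ^ 4 * (1 - θ)⁻¹ + 2 * K ^ 2 * A ^ 5 + 3 * K * A ^ 2 * C) * |lam| ^ k := by
  have hK := h.one_le hθ
  have hl1 : |lam| ≤ 1 := h.abs_lam_le.trans hθ.le
  have hA0 : 0 < A := by linarith
  have hzm : z ∈ rect a b := by simpa [saddleOrbit] using hzr 0 (Nat.zero_le _)
  -- Three errors per step: the remainder of the normal form, summable geometrically; the quadratic
  -- part of the inverse, of order `λ²ᵏ`; and the replacement of the current point by the initial
  -- one, of order `kλ²ᵏ`. Over `k` steps the last gives `k²λ²ᵏ`, which is `O(λᵏ)`.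
  set e : ℕ → ℝ := fun i => K ^ 2 * A ^ 4 * |lam| ^ k * (|lam| ^ i + |lam| ^ (k - i))
    + 2 * K ^ 2 * A ^ 5 * |lam| ^ k * |lam| ^ k
    + K * |lam| ^ k * (3 * A ^ 2 * (C * k * |lam| ^ k)) with he
  have step : ∀ i < k,
      |(saddleIncr T lam k i (saddleOrbit T lam k i z)).1 - beta * lam ^ k * (z.1 ^ 2 * z.2)| ≤ e i
      ∧ |(saddleIncr T lam k i (saddleOrbit T lam k i z)).2 + beta * lam ^ k * (z.2 ^ 2 * z.1)|
        ≤ e i := by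
    intro i hi
    obtain ⟨h1, h2⟩ := abs_saddleIncr_sub_le h hθ hA ha hb hi (hzr i hi.le) hk
    set Z := saddleOrbit T lam k i z
    have d := hzC i hi.le
    have d1 : |Z.1 - z.1| ≤ C * k * |lam| ^ k := (norm_fst_le (Z - z)).trans d
    have d2 : |Z.2 - z.2| ≤ C * k * |lam| ^ k := (norm_snd_le (Z - z)).trans d
    have b1 := (hzr i hi.le).1.le.trans ha
    have b2 := (hzr i hi.le).2.le.trans hb
    have b3 := hzm.1.le.trans ha
    have b4 := hzm.2.le.trans hb
    have q1 := abs_sq_mul_sub_le hA b1 b3 b4 d1 d2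
    have q2 := abs_sq_mul_sub_le hA b2 b4 b3 d2 d1
    have bb : |beta * lam ^ k| ≤ K * |lam| ^ k := by
      rw [abs_mul, abs_pow]; gcongr; exact h.abs_beta_le
    have p0 : 0 ≤ 2 * K ^ 2 * A ^ 5 * |lam| ^ k * |lam| ^ k := by positivity
    constructor
    · have e2 : (saddleIncr T lam k i Z).1 - beta * lam ^ k * (z.1 ^ 2 * z.2)
          = ((saddleIncr T lam k i Z).1 - beta * lam ^ k * (Z.1 ^ 2 * Z.2))
            + beta * lam ^ k * (Z.1 ^ 2 * Z.2 - z.1 ^ 2 * z.2) := by ring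
      rw [e2]
      refine (abs_add_le _ _).trans ?_
      have : |beta * lam ^ k * (Z.1 ^ 2 * Z.2 - z.1 ^ 2 * z.2)|
          ≤ K * |lam| ^ k * (3 * A ^ 2 * (C * k * |lam| ^ k)) := by
        rw [abs_mul]; gcongr
      rw [he]; dsimp only; linarith
    · have e2 : (saddleIncr T lam k i Z).2 + beta * lam ^ k * (z.2 ^ 2 * z.1)
          = ((saddleIncr T lam k i Z).2 + beta * lam ^ k * (Z.2 ^ 2 * Z.1))
            - beta * lam ^ k * (Z.2 ^ 2 * Z.1 - z.2 ^ 2 * z.1) := by ring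
      rw [e2]
      refine (abs_sub _ _).trans ?_
      have : |beta * lam ^ k * (Z.2 ^ 2 * Z.1 - z.2 ^ 2 * z.1)|
          ≤ K * |lam| ^ k * (3 * A ^ 2 * (C * k * |lam| ^ k)) := by
        rw [abs_mul]; gcongr
      rw [he]; dsimp only; linarith
  have acc : ∀ i ≤ k,
      |(saddleOrbit T lam k i z).1 - z.1 - i * (beta * lam ^ k * (z.1 ^ 2 * z.2))|
        ≤ ∑ l ∈ Finset.range i, e l ∧
      |(saddleOrbit T lam k i z).2 - z.2 + i * (beta * lam ^ k * (z.2 ^ 2 * z.1))|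
        ≤ ∑ l ∈ Finset.range i, e l := by
    intro i hi
    induction i with
    | zero => simp [saddleOrbit]
    | succ i ih =>
      obtain ⟨i1, i2⟩ := ih (by omega)
      obtain ⟨s1, s2⟩ := step i (by omega)
      rw [Finset.sum_range_succ]
      simp only [saddleOrbit, Prod.fst_add, Prod.snd_add]
      push_cast
      constructor
      · refine le_trans (le_of_eq (congrArg _ ?_)) ((abs_add_le _ _).trans (add_le_add i1 s1))
        ring
      · refine le_trans (le_of_eq (congrArg _ ?_)) ((abs_add_le _ _).trans (add_le_add i2 s2))
        ring
  have hsum : ∑ l ∈ Finset.range k, e l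
      ≤ (2 * K ^ 2 * A ^ 4 * (1 - θ)⁻¹ + 2 * K ^ 2 * A ^ 5 + 3 * K * A ^ 2 * C) * |lam| ^ k := by
    have g1 := sum_pow_le (abs_nonneg lam) h.abs_lam_le hθ k
    have g2 : ∑ l ∈ Finset.range k, |lam| ^ (k - l) ≤ (1 - θ)⁻¹ := by
      refine le_trans ?_ g1
      rw [← Finset.sum_range_reflect (fun i => |lam| ^ i) k]
      -- Reflection produces the exponents `k - 1 - l`, one less than `k - l`, which only enlarges
      -- the sum.
      refine Finset.sum_le_sum fun l hl => ?_
      exact pow_le_pow_of_le_one (abs_nonneg _) hl1 (by omega)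
    have hkk : (k : ℝ) ≤ (k : ℝ) ^ 2 := by exact_mod_cast Nat.le_self_pow (by norm_num) k
    have hk1 : (k : ℝ) * |lam| ^ k ≤ 1 := le_trans (by gcongr) hk2
    simp only [he, Finset.sum_add_distrib, ← Finset.mul_sum, Finset.sum_const, Finset.card_range,
      nsmul_eq_mul]
    calc _ ≤ K ^ 2 * A ^ 4 * |lam| ^ k * ((1 - θ)⁻¹ + (1 - θ)⁻¹)
          + 2 * K ^ 2 * A ^ 5 * |lam| ^ k * (k * |lam| ^ k)
          + 3 * K * A ^ 2 * C * |lam| ^ k * (k ^ 2 * |lam| ^ k) := by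
          have : ∀ x y z w : ℝ, x ≤ y → z = w → x + z ≤ y + w := fun _ _ _ _ h1 h2 => by
            rw [h2]; gcongr
          refine this _ _ _ _ (this _ _ _ _ (by gcongr) (by ring)) (by ring)
      _ ≤ K ^ 2 * A ^ 4 * |lam| ^ k * ((1 - θ)⁻¹ + (1 - θ)⁻¹)
          + 2 * K ^ 2 * A ^ 5 * |lam| ^ k * 1
          + 3 * K * A ^ 2 * C * |lam| ^ k * 1 := by gcongr
      _ = _ := by ring
  exact ⟨(acc k le_rfl).1.trans hsum, (acc k le_rfl).2.trans hsum⟩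

end SaddlePassage

/-! ### Quadratic remainder of the first-order Taylor formula. -/

section SecondOrder

variable {E F : Type*} [NormedAddCommGroup E] [NormedSpace ℝ E] [NormedAddCommGroup F]
  [NormedSpace ℝ F]

/-- Taylor's formula of the first order for a map of class `C^2`. -/
theorem ContDiffAt.isBigO_sub_sub_fderiv {f : E → F} {x₀ : E} (hf : ContDiffAt ℝ 2 f x₀) :
    (fun x => f x - f x₀ - fderiv ℝ f x₀ (x - x₀)) =O[𝓝 x₀] fun x => ‖x - x₀‖ ^ 2 := by
  have h1 : ContDiffAt ℝ 1 (fderiv ℝ f) x₀ := hf.fderiv_right (by norm_num)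
  have hO := (h1.differentiableAt (by simp)).isBigO_sub
  obtain ⟨C, hC⟩ := hO.bound
  have hd : ∀ᶠ x in 𝓝 x₀, DifferentiableAt ℝ f x :=
    (hf.eventually (by simp)).mono fun x hx => hx.differentiableAt (by simp)
  obtain ⟨δ, hδ, hball⟩ := Metric.eventually_nhds_iff_ball.1 (hC.and hd)
  refine Asymptotics.IsBigO.of_bound C ?_
  filter_upwards [Metric.ball_mem_nhds x₀ hδ] with x hx
  rcases eq_or_ne x x₀ with rfl | hne
  · simp
  have hpos : 0 < ‖x - x₀‖ := norm_pos_iff.2 (sub_ne_zero.2 hne)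
  have hC0 : 0 ≤ C := by
    have := (hball x hx).1
    by_contra hneg
    exact absurd ((norm_nonneg _).trans this) (not_le.2 (mul_neg_of_neg_of_pos (not_le.1 hneg) hpos))
  have hsub : ∀ y ∈ Metric.closedBall x₀ ‖x - x₀‖, y ∈ Metric.ball x₀ δ := fun y hy =>
    (Metric.mem_closedBall.1 hy).trans_lt (by rw [← dist_eq_norm]; exact hx)
  have key := (convex_closedBall x₀ ‖x - x₀‖).norm_image_sub_le_of_norm_hasFDerivWithin_le'
    (f := f) (f' := fun y => fderiv ℝ f y) (φ := fderiv ℝ f x₀) (C := C * ‖x - x₀‖)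
    (fun y hy => (hball y (hsub y hy)).2.hasFDerivAt.hasFDerivWithinAt)
    (fun y hy => ((hball y (hsub y hy)).1).trans (by
      gcongr; simpa [dist_eq_norm] using hy))
    (Metric.mem_closedBall_self (norm_nonneg _))
    (show x ∈ Metric.closedBall x₀ ‖x - x₀‖ by simp [dist_eq_norm])
  rw [norm_pow, norm_norm, sq, ← mul_assoc]
  exact key

end SecondOrder

/-! ### The inflection point and the splitting parameters as local coordinates. -/

section Splitting

variable {P : Type*} [NormedAddCommGroup P] [NormedSpace ℝ P]

/-- The partial derivative in the last, real variable. -/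
noncomputable def dsnd (h : P × ℝ → ℝ) (p : P × ℝ) : ℝ := fderiv ℝ h p (0, 1)

theorem ContDiffOn.dsnd {h : P × ℝ → ℝ} {W : Set (P × ℝ)} (hW : IsOpen W) {n : ℕ}
    (hh : ContDiffOn ℝ (n + 1 : ℕ) h W) : ContDiffOn ℝ n (dsnd h) W :=
  (hh.fderiv_of_isOpen hW (by norm_cast)).clm_apply contDiffOn_const

theorem DifferentiableAt.hasDerivAt_dsnd {h : P × ℝ → ℝ} {ε : P} {y : ℝ}
    (hd : DifferentiableAt ℝ h (ε, y)) : HasDerivAt (fun y => h (ε, y)) (dsnd h (ε, y)) y :=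
  hd.hasFDerivAt.comp_hasDerivAt y ((hasDerivAt_const y ε).prodMk (hasDerivAt_id y))

theorem iteratedDeriv_slice_eq_dsnd {h : P × ℝ → ℝ} {W : Set (P × ℝ)} (hW : IsOpen W) {n : ℕ}
    (hh : ContDiffOn ℝ n h W) {ε : P} {y : ℝ} (hy : (ε, y) ∈ W) :
    iteratedDeriv n (fun y => h (ε, y)) y = dsnd^[n] h (ε, y) := by
  induction n generalizing h y with
  | zero => simp
  | succ n ih =>
    rw [iteratedDeriv_succ', Function.iterate_succ_apply, ← ih (hh.dsnd hW) hy]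
    refine Filter.EventuallyEq.iteratedDeriv_eq n ?_
    have hc : Tendsto (fun y => (ε, y)) (𝓝 y) (𝓝 (ε, y)) := (Continuous.prodMk_right ε).tendsto y
    filter_upwards [hc (hW.mem_nhds hy)] with t ht
    exact ((hh.contDiffAt (hW.mem_nhds ht)).differentiableAt (by simp)).hasDerivAt_dsnd.deriv

/-- The value and the slope of `y ↦ h (ε, y)` at its inflection point are local coordinates in the
parameter plane, if the value and the slope at the given point are split independently. -/
theorem exists_splitting_coordinates [FiniteDimensional ℝ P] {h : P × ℝ → ℝ} {W : Set (P × ℝ)}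
    (hW : IsOpen W) (hh : ContDiffOn ℝ 3 h W) {y₀ : ℝ} (hW₀ : ((0 : P), y₀) ∈ W)
    (h₀ : h (0, y₀) = 0) (h₁ : dsnd h (0, y₀) = 0) (h₂ : dsnd (dsnd h) (0, y₀) = 0)
    (h₃ : dsnd (dsnd (dsnd h)) (0, y₀) ≠ 0) {D : P ≃L[ℝ] ℝ × ℝ}
    (hD : HasFDerivAt (fun ε => (h (ε, y₀), dsnd h (ε, y₀))) (D : P →L[ℝ] ℝ × ℝ) 0) :
    ∃ (e : OpenPartialHomeomorph P (ℝ × ℝ)) (yI : P → ℝ),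
      (0 : P) ∈ e.source ∧ ContDiffOn ℝ 1 e e.source ∧ ContDiffOn ℝ 1 e.symm e.target ∧
      ContinuousOn yI e.source ∧ yI 0 = y₀ ∧
      (∀ ε ∈ e.source, (ε, yI ε) ∈ W ∧ dsnd (dsnd h) (ε, yI ε) = 0 ∧
        e ε = (h (ε, yI ε), dsnd h (ε, yI ε))) ∧
      ((fun ε => yI ε - y₀) =O[𝓝 0] fun ε => ‖ε‖) ∧ (e.symm =O[𝓝 0] fun μ => ‖μ‖) ∧
      (fun μ => e.symm μ - D.symm μ) =O[𝓝 0] fun μ => ‖μ‖ ^ 2 := by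
  have : CompleteSpace P := FiniteDimensional.complete ℝ P
  have c0 : ContDiffOn ℝ (2 + 1 : ℕ) h W := hh
  have c1 : ContDiffOn ℝ (1 + 1 : ℕ) (dsnd h) W := c0.dsnd hW
  have c2 : ContDiffOn ℝ (1 : ℕ) (dsnd (dsnd h)) W := c1.dsnd hW
  have hWn := hW.mem_nhds hW₀
  have a0 : ContDiffAt ℝ 2 h (0, y₀) := (c0.contDiffAt hWn).of_le (by norm_num)
  have a1 : ContDiffAt ℝ 2 (dsnd h) (0, y₀) := c1.contDiffAt hWn
  have a2 : ContDiffAt ℝ 1 (dsnd (dsnd h)) (0, y₀) := c2.contDiffAt hWn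
  -- The contact is exactly cubic, so `h_yyy ≠ 0` and the implicit function theorem solves `h_yy =
  -- 0` for `y`.
  have hinv : (fderiv ℝ (dsnd (dsnd h)) (0, y₀) ∘L .inr ℝ P ℝ).IsInvertible := by
    refine ⟨ContinuousLinearEquiv.unitsEquivAut ℝ (Units.mk0 _ h₃), ?_⟩
    ext
    simp [dsnd]
  have hn1 : (1 : ℕ∞ω) ≠ 0 := one_ne_zero
  set yI := a2.implicitFunction hn1 hinv with hyI
  have hy0 : yI 0 = y₀ := a2.implicitFunction_apply_self hn1 hinv
  have hyc : ContDiffAt ℝ 1 yI 0 := a2.contDiffAt_implicitFunction hn1 hinv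
  have hyd : DifferentiableAt ℝ yI 0 := hyc.differentiableAt hn1
  have hyO : (fun ε => yI ε - y₀) =O[𝓝 0] fun ε => ‖ε‖ := by
    have := hyd.isBigO_sub
    simp only [hy0, sub_zero] at this
    exact this.norm_right
  have hyz : ∀ᶠ ε in 𝓝 (0 : P), dsnd (dsnd h) (ε, yI ε) = 0 := by
    have := a2.eventually_apply_implicitFunction hn1 hinv
    rwa [h₂] at this
  -- the splitting map
  set Φ : P → ℝ × ℝ := fun ε => (h (ε, yI ε), dsnd h (ε, yI ε)) with hΦ
  have hp : ContDiffAt ℝ 1 (fun ε => (ε, yI ε)) (0 : P) := contDiffAt_id.prodMk hyc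
  have hΦ0 : Φ 0 = 0 := by simp [hΦ, hy0, h₀, h₁]
  have b0 : ContDiffAt ℝ 1 h (0, yI 0) := by rw [hy0]; exact a0.of_le (by norm_num)
  have b1 : ContDiffAt ℝ 1 (dsnd h) (0, yI 0) := by rw [hy0]; exact a1.of_le (by norm_num)
  have hΦc : ContDiffAt ℝ 1 Φ 0 :=
    (ContDiffAt.comp (g := h) (0 : P) b0 hp).prodMk (ContDiffAt.comp (g := dsnd h) (0 : P) b1 hp)
  have hpO : (fun ε : P => (ε, yI ε) - (0, y₀)) =O[𝓝 0] fun ε => ‖ε‖ := by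
    simp only [Prod.mk_sub_mk, sub_zero]
    exact (Asymptotics.isBigO_refl _ _).norm_right.prod_left hyO
  have hpt : Tendsto (fun ε : P => (ε, yI ε)) (𝓝 0) (𝓝 (0, y₀)) := by
    have := hp.continuousAt.tendsto
    rwa [hy0] at this
  -- For `g = h` and `g = h_y` the `y`-derivative vanishes at the base point. So the motion of the
  -- inflection point enters only at second order, and the linear part is that for frozen `y`.
  have comp : ∀ g : P × ℝ → ℝ, ContDiffAt ℝ 2 g (0, y₀) → g (0, y₀) = 0 →
      dsnd g (0, y₀) = 0 → (fun ε => g (ε, yI ε) - fderiv ℝ g (0, y₀) (ε, 0)) =O[𝓝 0]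
        fun ε => ‖ε‖ ^ 2 := by
    intro g hg hg0 hg1
    have := (hg.isBigO_sub_sub_fderiv.comp_tendsto hpt).trans
      ((hpO.norm_left.pow 2).congr_left fun _ => rfl)
    refine this.congr_left fun ε => ?_
    have e : ((ε, yI ε) - (0, y₀) : P × ℝ) = (ε, 0) + (yI ε - y₀) • ((0 : P), (1 : ℝ)) := by
      ext <;> simp
    simp only [Function.comp_apply, hg0, sub_zero]
    rw [e, map_add, map_smul, show fderiv ℝ g (0, y₀) (0, 1) = 0 from hg1, smul_zero, add_zero]
  have hDv : ∀ ε, D ε = (fderiv ℝ h (0, y₀) (ε, 0), fderiv ℝ (dsnd h) (0, y₀) (ε, 0)) := by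
    intro ε
    have hl : HasFDerivAt (fun ε : P => (ε, y₀)) (ContinuousLinearMap.inl ℝ P ℝ) 0 :=
      hasFDerivAt_prodMk_left 0 y₀
    have g0 := (a0.differentiableAt (by simp)).hasFDerivAt.comp (0 : P) hl
    have g1 := (a1.differentiableAt (by simp)).hasFDerivAt.comp (0 : P) hl
    have := hD.unique (g0.prodMk g1)
    have h5 := congrArg (fun A : P →L[ℝ] ℝ × ℝ => A ε) this
    simpa using h5
  have hΦO : (fun ε => Φ ε - D ε) =O[𝓝 0] fun ε => ‖ε‖ ^ 2 := by
    simp only [hDv, hΦ, Prod.mk_sub_mk]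
    exact (comp h a0 h₀ h₁).prod_left (comp (dsnd h) a1 h₁ h₂)
  have hΦD : HasFDerivAt Φ (D : P →L[ℝ] ℝ × ℝ) 0 := by
    have h6 : HasFDerivAt (fun ε => Φ ε - D ε) (0 : P →L[ℝ] ℝ × ℝ) 0 :=
      Asymptotics.IsBigO.hasFDerivAt (n := 2) (by simpa using hΦO) (by norm_num)
    have h7 := h6.add (D : P →L[ℝ] ℝ × ℝ).hasFDerivAt
    rw [zero_add] at h7
    exact h7.congr_of_eventuallyEq (Eventually.of_forall fun ε => by simp)
  set e₀ := hΦc.toOpenPartialHomeomorph Φ hΦD hn1 with he₀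
  have he₀c : (e₀ : P → ℝ × ℝ) = Φ := rfl
  have m0 : (0 : P) ∈ e₀.source := hΦc.mem_toOpenPartialHomeomorph_source hΦD hn1
  have m0t : (0 : ℝ × ℝ) ∈ e₀.target := by
    have := e₀.map_source m0
    rwa [he₀c, hΦ0] at this
  have s0 : e₀.symm 0 = 0 := by
    have := e₀.left_inv m0
    rwa [he₀c, hΦ0] at this
  have sc : ContDiffAt ℝ 1 e₀.symm 0 := by
    refine e₀.contDiffAt_symm m0t (f₀' := D) ?_ ?_
    · rw [s0]; exact hΦD
    · rw [s0]; exact hΦc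
  have hsO : (e₀.symm : ℝ × ℝ → P) =O[𝓝 0] fun μ => ‖μ‖ := by
    have := (sc.differentiableAt hn1).isBigO_sub
    simp only [s0, sub_zero] at this
    exact this.norm_right
  have hst : Tendsto e₀.symm (𝓝 0) (𝓝 0) := by
    have := sc.continuousAt.tendsto
    rwa [s0] at this
  -- Substituting `ε = e⁻¹(μ)` in the quadratic estimate for `Φ - D` and applying `D⁻¹` transfers it
  -- to the inverse map.
  have hsD : (fun μ => e₀.symm μ - D.symm μ) =O[𝓝 0] fun μ => ‖μ‖ ^ 2 := by
    have h8 : (fun μ => Φ (e₀.symm μ) - D (e₀.symm μ)) =O[𝓝 0] fun μ => ‖μ‖ ^ 2 :=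
      (hΦO.comp_tendsto hst).trans ((hsO.norm_left.pow 2))
    have h9 : (fun μ => μ - D (e₀.symm μ)) =O[𝓝 0] fun μ => ‖μ‖ ^ 2 := by
      refine h8.congr' ?_ EventuallyEq.rfl
      filter_upwards [e₀.open_target.mem_nhds m0t] with μ hμ
      rw [← he₀c, e₀.right_inv hμ]
    have h10 := ((D.symm : ℝ × ℝ →L[ℝ] P).isBigO_comp _ _).trans h9
    refine h10.neg_left.congr_left fun μ => ?_
    simp
  -- shrink the domain
  obtain ⟨N, hNsub, hNo, hN0⟩ := eventually_nhds_iff.1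
    ((hyc.eventually (by simp)).and ((hpt.eventually hWn).and hyz))
  set e := (e₀.restrContDiff ℝ 1 (by simp)).restr N with he
  have hsrc : e.source = (e₀.source ∩ {x | ContDiffAt ℝ 1 e₀ x ∧ ContDiffAt ℝ 1 e₀.symm (e₀ x)})
      ∩ N := by
    rw [he, OpenPartialHomeomorph.restr_source, hNo.interior_eq]; rfl
  have hcoe : (e : P → ℝ × ℝ) = Φ := rfl
  have hsym : (e.symm : ℝ × ℝ → P) = e₀.symm := rfl
  refine ⟨e, yI, ?_, ?_, ?_, ?_, hy0, ?_, hyO, hsO, hsD⟩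
  · rw [hsrc]
    refine ⟨⟨m0, hΦc, ?_⟩, hN0⟩
    rw [he₀c, hΦ0]; exact sc
  · intro x hx
    rw [hsrc] at hx
    exact hx.1.2.1.contDiffWithinAt
  · intro μ hμ
    have h1 := e.map_target hμ
    rw [hsrc] at h1
    have h2 : e₀ (e.symm μ) = μ := e.right_inv hμ
    have h3 := h1.1.2.2
    rw [h2] at h3
    exact h3.contDiffWithinAt
  · intro x hx
    rw [hsrc] at hx
    exact (hNsub x hx.2).1.continuousAt.continuousWithinAt
  · intro x hx
    rw [hsrc] at hx
    exact ⟨(hNsub x hx.2).2.1, (hNsub x hx.2).2.2, rfl⟩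

end Splitting

/-! ### Symplectic maps in canonical coordinates. -/

section Symplectic

variable {r : ℕ∞} {M : Type*} [TopologicalSpace M] [ChartedSpace (ℝ × ℝ) M]

namespace SymplecticForm

variable {Ω : SymplecticForm r M}

theorem IsPreservedBy.comp {g f : M → M} (hg : Ω.IsPreservedBy g) (hf : Ω.IsPreservedBy f)
    (hgd : MDifferentiable 𝓘(ℝ, ℝ × ℝ) 𝓘(ℝ, ℝ × ℝ) g)
    (hfd : MDifferentiable 𝓘(ℝ, ℝ × ℝ) 𝓘(ℝ, ℝ × ℝ) f) : Ω.IsPreservedBy (g ∘ f) := by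
  intro p u v
  rw [mfderiv_comp p (hgd (f p)) (hfd p)]
  exact (hg (f p) _ _).trans (hf p u v)

theorem IsPreservedBy.id : Ω.IsPreservedBy (id : M → M) := by
  intro p u v
  rw [mfderiv_id]
  rfl

theorem IsPreservedBy.iterate {f : M → M} (hf : Ω.IsPreservedBy f)
    (hfd : MDifferentiable 𝓘(ℝ, ℝ × ℝ) 𝓘(ℝ, ℝ × ℝ) f) (q : ℕ) :
    Ω.IsPreservedBy f^[q] ∧ MDifferentiable 𝓘(ℝ, ℝ × ℝ) 𝓘(ℝ, ℝ × ℝ) f^[q] := by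
  induction q with
  | zero => exact ⟨IsPreservedBy.id, mdifferentiable_id⟩
  | succ q ih =>
    rw [Function.iterate_succ]
    exact ⟨ih.1.comp hf ih.2 hfd, ih.2.comp hfd⟩

variable [IsManifold 𝓘(ℝ, ℝ × ℝ) (r : WithTop ℕ∞) M]

/-- A symplectic map preserves the standard area in canonical coordinates. -/
theorem stdArea_fderiv_inCoords (hr : 1 ≤ r) {φ : OpenPartialHomeomorph M (ℝ × ℝ)}
    (hφ : Ω.IsCanonical φ) {g : M → M} (hg : Ω.IsPreservedBy g)
    (hgd : MDifferentiable 𝓘(ℝ, ℝ × ℝ) 𝓘(ℝ, ℝ × ℝ) g) {z : ℝ × ℝ} (hz : z ∈ φ.target)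
    (hgz : g (φ.symm z) ∈ φ.source) (u v : ℝ × ℝ) :
    stdArea (fderiv ℝ (inCoords φ g) z u) (fderiv ℝ (inCoords φ g) z v) = stdArea u v := by
  have hr0 : (r : WithTop ℕ∞) ≠ 0 := by
    have : r ≠ 0 := by rintro rfl; simp at hr
    exact_mod_cast this
  have hp : φ.symm z ∈ φ.source := φ.map_target hz
  have d1 : MDifferentiableAt 𝓘(ℝ, ℝ × ℝ) 𝓘(ℝ, ℝ × ℝ) φ.symm z :=
    (contMDiffAt_symm_of_mem_maximalAtlas hφ.1 hz).mdifferentiableAt hr0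
  have d2 : MDifferentiableAt 𝓘(ℝ, ℝ × ℝ) 𝓘(ℝ, ℝ × ℝ) φ (φ.symm z) :=
    (contMDiffAt_of_mem_maximalAtlas hφ.1 hp).mdifferentiableAt hr0
  have d3 : MDifferentiableAt 𝓘(ℝ, ℝ × ℝ) 𝓘(ℝ, ℝ × ℝ) φ (g (φ.symm z)) :=
    (contMDiffAt_of_mem_maximalAtlas hφ.1 hgz).mdifferentiableAt hr0
  have e1 : mfderiv 𝓘(ℝ, ℝ × ℝ) 𝓘(ℝ, ℝ × ℝ) (φ ∘ g ∘ φ.symm) z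
      = (mfderiv 𝓘(ℝ, ℝ × ℝ) 𝓘(ℝ, ℝ × ℝ) φ (g (φ.symm z))).comp
        ((mfderiv 𝓘(ℝ, ℝ × ℝ) 𝓘(ℝ, ℝ × ℝ) g (φ.symm z)).comp
          (mfderiv 𝓘(ℝ, ℝ × ℝ) 𝓘(ℝ, ℝ × ℝ) φ.symm z)) := by
    rw [mfderiv_comp z (g := φ) (f := g ∘ φ.symm) d3 ((hgd _).comp z d1),
      mfderiv_comp z (hgd _) d1]
    rfl
  have e2 : (mfderiv 𝓘(ℝ, ℝ × ℝ) 𝓘(ℝ, ℝ × ℝ) φ (φ.symm z)).comp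
      (mfderiv 𝓘(ℝ, ℝ × ℝ) 𝓘(ℝ, ℝ × ℝ) φ.symm z)
      = ContinuousLinearMap.id ℝ (ℝ × ℝ) := by
    have h1 := mfderiv_comp z (g := φ) (f := φ.symm) d2 d1
    have h2 : (φ ∘ φ.symm) =ᶠ[𝓝 z] id := by
      filter_upwards [φ.open_target.mem_nhds hz] with w hw
      exact φ.right_inv hw
    rw [h2.mfderiv_eq, mfderiv_id] at h1
    exact h1.symm
  have e3 : ∀ w : ℝ × ℝ, mfderiv 𝓘(ℝ, ℝ × ℝ) 𝓘(ℝ, ℝ × ℝ) φ (φ.symm z)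
      (mfderiv 𝓘(ℝ, ℝ × ℝ) 𝓘(ℝ, ℝ × ℝ) φ.symm z w) = w := fun w =>
    congrArg (fun A : ℝ × ℝ →L[ℝ] ℝ × ℝ => A w) e2
  rw [mfderiv_eq_fderiv] at e1
  have e4 : fderiv ℝ (inCoords φ g) z = _ := e1
  rw [e4]
  have s1 := hφ.2 _ hgz
    (mfderiv 𝓘(ℝ, ℝ × ℝ) 𝓘(ℝ, ℝ × ℝ) g (φ.symm z)
      (mfderiv 𝓘(ℝ, ℝ × ℝ) 𝓘(ℝ, ℝ × ℝ) φ.symm z u))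
    (mfderiv 𝓘(ℝ, ℝ × ℝ) 𝓘(ℝ, ℝ × ℝ) g (φ.symm z)
      (mfderiv 𝓘(ℝ, ℝ × ℝ) 𝓘(ℝ, ℝ × ℝ) φ.symm z v))
  have s2 := hg (φ.symm z) (mfderiv 𝓘(ℝ, ℝ × ℝ) 𝓘(ℝ, ℝ × ℝ) φ.symm z u)
      (mfderiv 𝓘(ℝ, ℝ × ℝ) 𝓘(ℝ, ℝ × ℝ) φ.symm z v)
  have s3 := hφ.2 _ hp (mfderiv 𝓘(ℝ, ℝ × ℝ) 𝓘(ℝ, ℝ × ℝ) φ.symm z u)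
      (mfderiv 𝓘(ℝ, ℝ × ℝ) 𝓘(ℝ, ℝ × ℝ) φ.symm z v)
  have s4 : stdArea (mfderiv 𝓘(ℝ, ℝ × ℝ) 𝓘(ℝ, ℝ × ℝ) φ (φ.symm z)
      (mfderiv 𝓘(ℝ, ℝ × ℝ) 𝓘(ℝ, ℝ × ℝ) φ.symm z u))
      (mfderiv 𝓘(ℝ, ℝ × ℝ) 𝓘(ℝ, ℝ × ℝ) φ (φ.symm z)
      (mfderiv 𝓘(ℝ, ℝ × ℝ) 𝓘(ℝ, ℝ × ℝ) φ.symm z v)) = stdArea u v :=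
    congrArg₂ stdArea (e3 u) (e3 v)
  exact s1.symm.trans (s2.trans (s3.trans s4))

end SymplecticForm

end Symplectic

/-! ### Area preservation of the global map at the tangency. -/

namespace CubicTangencyFamily

variable {r : ℕ∞} {M : Type*} [TopologicalSpace M] [ChartedSpace (ℝ × ℝ) M]
  [IsManifold 𝓘(ℝ, ℝ × ℝ) (r : WithTop ℕ∞) M] {Ω : SymplecticForm r M}
  (F : CubicTangencyFamily r M Ω)

theorem yMinus_lt : F.yMinus < F.δ₂ :=
  (le_abs_self _).trans_lt (F.PiMinus_subset F.mem_PiMinus).2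

theorem contDiffOn_globalMap {ε : ℝ × ℝ} (hε : ε ∈ F.V) :
    ContDiffOn ℝ (r : WithTop ℕ∞) (F.globalMap ε) F.PiMinus := F.global_smooth.1 ε hε

theorem contDiffOn_localMap {ε : ℝ × ℝ} (hε : ε ∈ F.V) :
    ContDiffOn ℝ (r : WithTop ℕ∞) (F.localMap ε) (rect F.δ₁ F.δ₂) := F.local_smooth.1 ε hε

theorem differentiableAt_globalMap (hr : 5 ≤ r) {ε z : ℝ × ℝ} (hε : ε ∈ F.V)
    (hz : z ∈ F.PiMinus) : DifferentiableAt ℝ (F.globalMap ε) z :=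
  ((F.contDiffOn_globalMap hε).contDiffAt (F.isOpen_PiMinus.mem_nhds hz)).differentiableAt (by
    have : r ≠ 0 := by rintro rfl; simp at hr
    exact_mod_cast this)

theorem fderiv_globalMap_apply (hr : 5 ≤ r) {ε z : ℝ × ℝ} (hε : ε ∈ F.V)
    (hz : z ∈ F.PiMinus) (w : ℝ × ℝ) : fderiv ℝ (F.globalMap ε) z w
      = (fderiv ℝ (fun z => (F.globalMap ε z).1) z w,
        fderiv ℝ (fun z => (F.globalMap ε z).2) z w) := by
  have hd := F.differentiableAt_globalMap hr hε hz
  rw [(hd.hasFDerivAt.fst).fderiv, (hd.hasFDerivAt.snd).fderiv]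
  rfl

/-- Area preservation at the tangency point: `F_y G_x = -1`. -/
theorem pdy_mul_pdx_globalMap (hr : 5 ≤ r)
    (h0 : pdy (fun z => (F.globalMap 0 z).2) (0, F.yMinus) = 0) :
    pdy (fun z => (F.globalMap 0 z).1) (0, F.yMinus) *
      pdx (fun z => (F.globalMap 0 z).2) (0, F.yMinus) = -1 := by
  have hz := F.mem_PiMinus
  have hr0 : (r : WithTop ℕ∞) ≠ 0 := by
    have : r ≠ 0 := by rintro rfl; simp at hr
    exact_mod_cast this
  obtain ⟨h1, h2⟩ := (F.symplectic 0 F.zero_mem_V).iterate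
    ((F.f 0).contMDiff.mdifferentiable hr0) F.q
  have := SymplecticForm.stdArea_fderiv_inCoords (le_trans (by norm_num) hr)
    (F.canonical 0 F.zero_mem_V) h1 h2
    (F.rect_subset 0 F.zero_mem_V (F.PiMinus_subset hz))
    (F.global_mapsTo 0 F.zero_mem_V _ hz) (1, 0) (0, 1)
  change stdArea (fderiv ℝ (F.globalMap 0) _ _) (fderiv ℝ (F.globalMap 0) _ _) = _ at this
  rw [F.fderiv_globalMap_apply hr F.zero_mem_V hz, F.fderiv_globalMap_apply hr F.zero_mem_V hz]
    at this
  simp only [stdArea] at this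
  unfold pdx pdy at *
  rw [h0] at this
  linarith

end CubicTangencyFamily

/-! ### Orders of magnitude in `Cⁿ` along a filter. -/

section CnBigO

open Asymptotics

variable {ι E F G : Type*} [NormedAddCommGroup E] [NormedSpace ℝ E] [NormedAddCommGroup F]
  [NormedSpace ℝ F] [NormedAddCommGroup G] [NormedSpace ℝ G]

/-- The maps `f i` are, along the filter `l`, of order `g i` in `C^n(s)`. -/
def CnBigO (n : ℕ) (s : Set E) (l : Filter ι) (f : ι → E → F) (g : ι → ℝ) : Prop :=
  ∃ C, 0 ≤ C ∧ ∀ᶠ i in l, CnBound n s (f i) (C * |g i|)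

namespace CnBigO

variable {n : ℕ} {s : Set E} {l : Filter ι} {f f₁ f₂ : ι → E → F} {g g₁ g₂ : ι → ℝ}

theorem trans (h : CnBigO n s l f g₁) (hg : g₁ =O[l] g₂) : CnBigO n s l f g₂ := by
  obtain ⟨C, hC, h⟩ := h
  obtain ⟨D, hD, hg⟩ := hg.exists_nonneg
  refine ⟨C * D, by positivity, ?_⟩
  filter_upwards [h, hg.bound] with i h1 h2
  refine h1.mono ?_
  rw [mul_assoc]
  exact mul_le_mul_of_nonneg_left h2 hC

theorem congr (h : CnBigO n s l f₁ g) (hs : IsOpen s) (he : ∀ᶠ i in l, EqOn (f₂ i) (f₁ i) s) :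
    CnBigO n s l f₂ g := by
  obtain ⟨C, hC, h⟩ := h
  refine ⟨C, hC, ?_⟩
  filter_upwards [h, he] with i h1 h2
  exact h1.congr hs h2

theorem add (h₁ : CnBigO n s l f₁ g) (h₂ : CnBigO n s l f₂ g) (hs : IsOpen s) :
    CnBigO n s l (fun i z => f₁ i z + f₂ i z) g := by
  obtain ⟨C, hC, h₁⟩ := h₁
  obtain ⟨D, hD, h₂⟩ := h₂
  refine ⟨C + D, by positivity, ?_⟩
  filter_upwards [h₁, h₂] with i a b
  exact (a.add b hs).mono (by rw [add_mul])

theorem neg (h : CnBigO n s l f g) : CnBigO n s l (fun i z => -f i z) g := by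
  obtain ⟨C, hC, h⟩ := h
  exact ⟨C, hC, h.mono fun i a => a.neg⟩

theorem sub (h₁ : CnBigO n s l f₁ g) (h₂ : CnBigO n s l f₂ g) (hs : IsOpen s) :
    CnBigO n s l (fun i z => f₁ i z - f₂ i z) g := by
  simpa only [sub_eq_add_neg] using h₁.add h₂.neg hs

theorem mul {f₁ f₂ : ι → E → ℝ} (h₁ : CnBigO n s l f₁ g₁) (h₂ : CnBigO n s l f₂ g₂)
    (hs : IsOpen s) : CnBigO n s l (fun i z => f₁ i z * f₂ i z) (fun i => g₁ i * g₂ i) := by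
  obtain ⟨C, hC, h₁⟩ := h₁
  obtain ⟨D, hD, h₂⟩ := h₂
  refine ⟨2 ^ n * (C * D), by positivity, ?_⟩
  filter_upwards [h₁, h₂] with i a b
  refine (a.mul b hs (by positivity) (by positivity)).mono (le_of_eq ?_)
  rw [abs_mul]; ring

theorem const {c : ι → F} (hc : c =O[l] g) : CnBigO n s l (fun i _ => c i) g := by
  obtain ⟨D, hD, hc⟩ := hc.exists_nonneg
  exact ⟨D, hD, hc.bound.mono fun i a => CnBound.const a⟩

theorem prodMk {f₂ : ι → E → G} (h₁ : CnBigO n s l f₁ g) (h₂ : CnBigO n s l f₂ g)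
    (hs : IsOpen s) : CnBigO n s l (fun i z => (f₁ i z, f₂ i z)) g := by
  obtain ⟨C, hC, h₁⟩ := h₁
  obtain ⟨D, hD, h₂⟩ := h₂
  refine ⟨max C D, le_max_of_le_left hC, ?_⟩
  filter_upwards [h₁, h₂] with i a b
  exact (a.mono (by gcongr; exact le_max_left _ _)).prodMk
    (b.mono (by gcongr; exact le_max_right _ _)) hs

theorem fst {f : ι → E → F × G} (h : CnBigO n s l f g) (hs : IsOpen s) :
    CnBigO n s l (fun i z => (f i z).1) g := by
  obtain ⟨C, hC, h⟩ := h
  exact ⟨C, hC, h.mono fun i a => a.fst hs (by positivity)⟩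

theorem snd {f : ι → E → F × G} (h : CnBigO n s l f g) (hs : IsOpen s) :
    CnBigO n s l (fun i z => (f i z).2) g := by
  obtain ⟨C, hC, h⟩ := h
  exact ⟨C, hC, h.mono fun i a => a.snd hs (by positivity)⟩

theorem comp {H : ι → F → G} {t : Set F} (hH : CnBigO n t l H g)
    (hf : CnBigO n s l f fun _ => 1) (hs : IsOpen s) (ht : IsOpen t)
    (hst : ∀ᶠ i in l, MapsTo (f i) s t) : CnBigO n s l (fun i z => H i (f i z)) g := by
  obtain ⟨C, hC, hH⟩ := hH
  obtain ⟨D, hD, hf⟩ := hf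
  refine ⟨n.factorial * C * (1 + D) ^ n, by positivity, ?_⟩
  filter_upwards [hH, hf, hst] with i a b c
  refine (a.comp (b.mono ?_) hs ht c (by positivity) (show (1 : ℝ) ≤ 1 + D by linarith)).mono
    (le_of_eq (by ring))
  rw [abs_one, mul_one]; linarith

theorem mono_order {m : ℕ} (h : CnBigO n s l f g) (hm : m ≤ n) : CnBigO m s l f g := by
  obtain ⟨C, hC, h⟩ := h
  exact ⟨C, hC, h.mono fun i a => a.mono_order hm⟩

theorem exists_norm_le (h : CnBigO n s l f fun _ => 1) :
    ∃ C, 0 ≤ C ∧ ∀ᶠ i in l, ∀ z ∈ s, ‖f i z‖ ≤ C := by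
  obtain ⟨C, hC, h⟩ := h
  exact ⟨C, hC, h.mono fun i a z hz => by simpa using a.norm_le hz⟩

end CnBigO

theorem cnBound_id {n : ℕ} {s : Set E} {R : ℝ} (hR : 0 ≤ R) (hsR : ∀ z ∈ s, ‖z‖ ≤ R) :
    CnBound n s (fun z : E => z) (1 + R) :=
  ⟨contDiffOn_id, fun j _ z hz => by
    rcases Nat.eq_zero_or_pos j with rfl | hj
    · simpa using (hsR z hz).trans (by linarith)
    · have := CnBound.norm_iteratedFDeriv_affine (f := fun z : E => z)
          (A := ContinuousLinearMap.id ℝ E) (a := 0) (fun z => by simp) hj z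
      refine this.trans ((pow_le_one₀ (norm_nonneg _) ContinuousLinearMap.norm_id_le).trans ?_)
      linarith⟩

theorem cnBigO_id {n : ℕ} {R : ℝ} {l : Filter ι} :
    CnBigO n (Metric.ball (0 : E) R) l (fun _ z => z) fun _ => 1 := by
  rcases le_or_gt R 0 with hR | hR
  · refine ⟨0, le_rfl, Eventually.of_forall fun i => ⟨contDiffOn_id, fun j _ z hz => ?_⟩⟩
    rw [Metric.ball_eq_empty.2 hR] at hz
    exact hz.elim
  · refine ⟨1 + R, by linarith, Eventually.of_forall fun i => ?_⟩
    simpa using cnBound_id (E := E) (n := n) hR.le fun z hz => (mem_ball_zero_iff.1 hz).le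

/-- The increments of a `C^n`-small map, read in a small affine chart. -/
theorem CnBigO.comp_affine_sub {n : ℕ} {l : Filter ι} {f : ι → E → F} {g σ : ι → ℝ} {x₀ : E}
    {ρ R : ℝ} (hR : 0 < R) (hn : 1 ≤ n) (hf : CnBigO n (Metric.ball x₀ ρ) l f g) {A : ι → E →L[ℝ] E}
    {a : ι → E} (hA : A =O[l] σ) (ha : (fun i => a i - x₀) =O[l] σ) (hσ : Tendsto σ l (𝓝 0))
    (hσ₀ : ∀ᶠ i in l, 0 < σ i) (hρ : 0 < ρ) :
    CnBigO n (Metric.ball 0 R) l (fun i z => (σ i)⁻¹ • (f i (a i + A i z) - f i x₀)) g := by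
  obtain ⟨C, hC, hf⟩ := hf
  obtain ⟨D, hD, hA⟩ := hA.exists_nonneg
  obtain ⟨D', hD', ha⟩ := ha.exists_nonneg
  have h1 : Tendsto (fun i => (D' + D * R) * σ i) l (𝓝 0) := by simpa using hσ.const_mul (D' + D * R)
  have h2 : Tendsto (fun i => (1 + D) * σ i) l (𝓝 0) := by simpa using hσ.const_mul (1 + D)
  refine ⟨(n.factorial * (1 + D) + (D' + D * R)) * C, by positivity, ?_⟩
  filter_upwards [hf, hA.bound, ha.bound, hσ₀, h1.eventually (gt_mem_nhds hρ),
    h2.eventually (gt_mem_nhds (zero_lt_one' ℝ))] with i hf hA ha hσ₀ h1 h2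
  rw [Real.norm_of_nonneg hσ₀.le] at hA ha
  have hd : ∀ z ∈ Metric.ball (0 : E) R, ‖a i + A i z - x₀‖ ≤ (D' + D * R) * σ i := by
    intro z hz
    have e : a i + A i z - x₀ = (a i - x₀) + A i z := by abel
    rw [e]
    refine (norm_add_le _ _).trans ?_
    have hz' : ‖z‖ ≤ R := (mem_ball_zero_iff.1 hz).le
    calc _ ≤ D' * σ i + D * σ i * R := by
          gcongr; exact ((A i).le_opNorm z).trans (by gcongr)
      _ = _ := by ring
  have hm : MapsTo (fun z => a i + A i z) (Metric.ball 0 R) (Metric.ball x₀ ρ) := fun z hz => by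
    rw [mem_ball_iff_norm]; exact (hd z hz).trans_lt h1
  have hx₀ : x₀ ∈ Metric.ball x₀ ρ := Metric.mem_ball_self hρ
  have hcd : ContDiff ℝ n fun z => a i + A i z := contDiff_const.add (A i).contDiff
  have hcomp : ContDiffOn ℝ n (fun z => f i (a i + A i z)) (Metric.ball 0 R) :=
    hf.1.comp hcd.contDiffOn hm
  have hK : 0 ≤ C * |g i| := by positivity
  refine ⟨(hcomp.sub contDiffOn_const).const_smul _, fun j hj z hz => ?_⟩
  have hz' := Metric.isOpen_ball.mem_nhds hz
  have hjc : ContDiffAt ℝ j (fun z => f i (a i + A i z)) z :=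
    (hcomp.contDiffAt hz').of_le (mod_cast hj)
  change ‖iteratedFDeriv ℝ j ((σ i)⁻¹ • fun z => (f i (a i + A i z) - f i x₀)) z‖ ≤ _
  rw [iteratedFDeriv_const_smul_apply (hjc.sub contDiffAt_const), norm_smul, norm_inv,
    Real.norm_of_nonneg hσ₀.le, inv_mul_le_iff₀ hσ₀]
  -- The division by `σ` is compensated in two ways: for `j = 0` by the mean value inequality, for
  -- `j ≥ 1` by the factor `‖A‖ ^ j ≤ ‖A‖` of the chain rule, once `‖A‖` is below one.
  rcases Nat.eq_zero_or_pos j with rfl | hj0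
  · rw [norm_iteratedFDeriv_zero]
    have h3 := (hf.mono_order (m := 0 + 1) hn).norm_sub_le Metric.isOpen_ball (convex_ball _ _) hx₀ (hm hz)
    calc _ ≤ C * |g i| * ((D' + D * R) * σ i) := h3.trans (by gcongr; exact hd z hz)
      _ = σ i * ((0 + (D' + D * R)) * C * |g i|) := by ring
      _ ≤ _ := by gcongr; positivity
  · have e : (fun z => f i (a i + A i z) - f i x₀)
        = (fun z => f i (a i + A i z)) - fun _ => f i x₀ := rfl
    rw [e, iteratedFDeriv_sub_apply hjc contDiffAt_const, iteratedFDeriv_const_of_ne hj0.ne']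
    simp only [Pi.zero_apply, sub_zero]
    refine (hf.comp_affine Metric.isOpen_ball (fun z => rfl) Metric.isOpen_ball hm hz hj).trans ?_
    have h4 : ‖A i‖ ^ j ≤ (1 + D) * σ i := by
      have h5 : ‖A i‖ ≤ (1 + D) * σ i := hA.trans (by gcongr; linarith)
      exact (pow_le_of_le_one (norm_nonneg _) (h5.trans h2.le) hj0.ne').trans h5
    have h6 : (j.factorial : ℝ) ≤ n.factorial := by exact_mod_cast Nat.factorial_le hj
    calc _ ≤ n.factorial * (C * |g i|) * ((1 + D) * σ i) := by gcongr
      _ = σ i * ((n.factorial * (1 + D) + 0) * C * |g i|) := by ring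
      _ ≤ _ := by gcongr; positivity

theorem CnBigO.comp_diagScale_of_weightedFlat {n w : ℕ} {l : Filter ι} {H : ι → ℝ × ℝ → ℝ}
    {δ R : ℝ} {σ : ι → ℝ} (hδ : 0 < δ) (hwn : w ≤ n)
    (hH : CnBigO n (Metric.ball 0 δ) l H fun _ => 1) (hw : ∀ᶠ i in l, WeightedFlat w (H i))
    (hσ : Tendsto σ l (𝓝 0)) (hσ₀ : ∀ᶠ i in l, 0 < σ i) (hR : 1 ≤ R) :
    CnBigO n (Metric.ball 0 R) l (fun i z => H i (diagScale (σ i ^ 2) (σ i) z))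
      (fun i => σ i ^ w) := by
  obtain ⟨C, hC, hH⟩ := hH
  have h1 : Tendsto (fun i => σ i * R) l (𝓝 0) := by simpa using hσ.mul_const R
  refine ⟨2 ^ n * C * (2 * R) ^ w, by positivity, ?_⟩
  filter_upwards [hH, hw, hσ₀, h1.eventually (gt_mem_nhds hδ),
    hσ.eventually (gt_mem_nhds (zero_lt_one' ℝ))] with i hH hw hσ₀ h1 h2
  have hm : ∀ z ∈ Metric.ball (0 : ℝ × ℝ) R, diagScale (σ i ^ 2) (σ i) z
      ∈ Metric.ball (0 : ℝ × ℝ) δ := by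
    intro z hz
    rw [mem_ball_zero_iff] at hz ⊢
    refine lt_of_le_of_lt ?_ h1
    have a1 : |z.1| ≤ R := (norm_fst_le z).trans hz.le
    have a2 : |z.2| ≤ R := (norm_snd_le z).trans hz.le
    rw [diagScale_apply, Prod.norm_mk]
    refine max_le ?_ ?_
    · rw [norm_mul, Real.norm_of_nonneg (sq_nonneg _)]
      have : σ i ^ 2 ≤ σ i := pow_le_of_le_one hσ₀.le h2.le two_ne_zero
      exact mul_le_mul this a1 (abs_nonneg _) hσ₀.le
    · rw [norm_mul, Real.norm_of_nonneg hσ₀.le]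
      exact mul_le_mul_of_nonneg_left a2 hσ₀.le
  refine ⟨hH.1.comp (diagScale _ _).contDiff.contDiffOn hm, fun j hj z hz => ?_⟩
  rw [abs_one, mul_one] at hH
  have := norm_iteratedFDeriv_comp_diagScale_of_weightedFlat Metric.isOpen_ball hC hR hσ₀.le h2.le
    hH hw hm hj hwn hz
  have e2 : (2 : ℝ) ^ j ≤ 2 ^ n := pow_le_pow_right₀ (by norm_num) hj
  rw [abs_of_nonneg (by positivity)]
  exact this.trans (by gcongr)

end CnBigO

/-! ### Uniform bounds and joint smoothness in parameter families. -/

section Families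

/-- Derivatives of order up to `r` in the coordinates are merely continuous in the parameter, but
continuity on a compact set of parameters and points already bounds them uniformly. -/
theorem IsSmoothFamilyOn.eventually_cnBound {r : ℕ∞} {T : ℝ × ℝ → ℝ × ℝ → ℝ × ℝ}
    {V U S Q : Set (ℝ × ℝ)} (h : IsSmoothFamilyOn r T V U) (hV : IsOpen V) {ε₀ : ℝ × ℝ}
    (h0 : ε₀ ∈ V) (hQ : IsCompact Q) (hQU : Q ⊆ U) (hSQ : S ⊆ Q) {m : ℕ} (hm : (m : ℕ∞) ≤ r) :
    ∃ C, 0 ≤ C ∧ ∀ᶠ ε in 𝓝 ε₀, CnBound m S (T ε) C := by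
  obtain ⟨δ, hδ, hδV⟩ := Metric.nhds_basis_closedBall.mem_iff.1 (hV.mem_nhds h0)
  have hc : IsCompact (Metric.closedBall ε₀ δ ×ˢ Q) := (isCompact_closedBall _ _).prod hQ
  have hb : ∀ j : ℕ, j ≤ m → ∃ C, ∀ p ∈ Metric.closedBall ε₀ δ ×ˢ Q,
      ‖iteratedFDeriv ℝ j (T p.1) p.2‖ ≤ C := fun j hj =>
    hc.exists_bound_of_continuousOn
      ((h.2.1 j (le_trans (by exact_mod_cast hj) hm)).mono (prod_mono hδV hQU))
  choose! C hC using hb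
  refine ⟨∑ j ∈ Finset.range (m + 1), |C j|, by positivity, ?_⟩
  filter_upwards [Metric.closedBall_mem_nhds ε₀ hδ] with ε hε
  refine ⟨((h.1 ε (hδV hε)).of_le (by exact_mod_cast hm)).mono (hSQ.trans hQU),
    fun j hj z hz => ?_⟩
  refine (hC j hj (ε, z) ⟨hε, hSQ hz⟩).trans ((le_abs_self _).trans ?_)
  exact Finset.single_le_sum (f := fun j => |C j|) (fun _ _ => abs_nonneg _)
    (Finset.mem_range.2 (by omega))

theorem contDiffOn_joint_pdx {g : ℝ × ℝ → ℝ × ℝ → ℝ} {V U : Set (ℝ × ℝ)} (hV : IsOpen V)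
    (hU : IsOpen U) {n : ℕ} (h : ContDiffOn ℝ (n + 1 : ℕ) (fun p : (ℝ × ℝ) × (ℝ × ℝ) => g p.1 p.2)
      (V ×ˢ U)) :
    ContDiffOn ℝ n (fun p : (ℝ × ℝ) × (ℝ × ℝ) => pdx (g p.1) p.2) (V ×ˢ U) := by
  have hVU := hV.prod hU
  have h1 : ContDiffOn ℝ n (fun p => fderiv ℝ (fun p : (ℝ × ℝ) × (ℝ × ℝ) => g p.1 p.2) p
      ((0, 0), (1, 0))) (V ×ˢ U) :=
    (h.fderiv_of_isOpen hVU (by norm_cast)).clm_apply contDiffOn_const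
  refine h1.congr fun p hp => ?_
  have hd : DifferentiableAt ℝ (fun p : (ℝ × ℝ) × (ℝ × ℝ) => g p.1 p.2) (p.1, p.2) :=
    (h.contDiffAt (hVU.mem_nhds hp)).differentiableAt (by simp)
  have := hd.hasFDerivAt.comp p.2 (hasFDerivAt_prodMk_right p.1 p.2)
  have e : fderiv ℝ (g p.1) p.2 = _ := this.fderiv
  rw [pdx, e]
  simp; rfl

theorem contDiffOn_joint_pdy {g : ℝ × ℝ → ℝ × ℝ → ℝ} {V U : Set (ℝ × ℝ)} (hV : IsOpen V)
    (hU : IsOpen U) {n : ℕ} (h : ContDiffOn ℝ (n + 1 : ℕ) (fun p : (ℝ × ℝ) × (ℝ × ℝ) => g p.1 p.2)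
      (V ×ˢ U)) :
    ContDiffOn ℝ n (fun p : (ℝ × ℝ) × (ℝ × ℝ) => pdy (g p.1) p.2) (V ×ˢ U) := by
  have hVU := hV.prod hU
  have h1 : ContDiffOn ℝ n (fun p => fderiv ℝ (fun p : (ℝ × ℝ) × (ℝ × ℝ) => g p.1 p.2) p
      ((0, 0), (0, 1))) (V ×ˢ U) :=
    (h.fderiv_of_isOpen hVU (by norm_cast)).clm_apply contDiffOn_const
  refine h1.congr fun p hp => ?_
  have hd : DifferentiableAt ℝ (fun p : (ℝ × ℝ) × (ℝ × ℝ) => g p.1 p.2) (p.1, p.2) :=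
    (h.contDiffAt (hVU.mem_nhds hp)).differentiableAt (by simp)
  have := hd.hasFDerivAt.comp p.2 (hasFDerivAt_prodMk_right p.1 p.2)
  have e : fderiv ℝ (g p.1) p.2 = _ := this.fderiv
  rw [pdy, e]
  simp; rfl

end Families

/-! ### Weighted Taylor polynomials with the cusp monomials. -/

section WeightedPolynomials

variable {φ ψ : ℝ × ℝ → ℝ}

theorem WeightedFlat.congr {w : ℕ} (h : WeightedFlat w φ) (e : φ =ᶠ[𝓝 0] ψ) :
    WeightedFlat w ψ := by
  induction w using Nat.strong_induction_on generalizing φ ψ with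
  | _ w ih =>
    rcases w with _ | _ | w
    · trivial
    · exact e.eq_of_nhds.symm.trans h
    · exact ⟨e.eq_of_nhds ▸ h.1, ih w (by omega) h.2.1 e.pdx, ih (w + 1) (by omega) h.2.2 e.pdy⟩

theorem pdx_sub_eventuallyEq {n : ℕ} (hφ : ContDiffAt ℝ (n + 1 : ℕ) φ 0)
    (hψ : ContDiffAt ℝ (n + 1 : ℕ) ψ 0) :
    (fun z => pdx φ z - pdx ψ z) =ᶠ[𝓝 0] pdx (fun z => φ z - ψ z) := by
  filter_upwards [hφ.eventually (by simp), hψ.eventually (by simp)] with z h1 h2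
  have := ((h1.differentiableAt (by simp)).hasFDerivAt.sub
    (h2.differentiableAt (by simp)).hasFDerivAt).fderiv
  have e : fderiv ℝ (fun z => φ z - ψ z) z = _ := this
  simp [pdx, e]

theorem pdy_sub_eventuallyEq {n : ℕ} (hφ : ContDiffAt ℝ (n + 1 : ℕ) φ 0)
    (hψ : ContDiffAt ℝ (n + 1 : ℕ) ψ 0) :
    (fun z => pdy φ z - pdy ψ z) =ᶠ[𝓝 0] pdy (fun z => φ z - ψ z) := by
  filter_upwards [hφ.eventually (by simp), hψ.eventually (by simp)] with z h1 h2
  have := ((h1.differentiableAt (by simp)).hasFDerivAt.sub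
    (h2.differentiableAt (by simp)).hasFDerivAt).fderiv
  have e : fderiv ℝ (fun z => φ z - ψ z) z = _ := this
  simp [pdy, e]

theorem weightedFlat_sub_succ_succ {w n : ℕ} (hφ : ContDiffAt ℝ (n + 1 : ℕ) φ 0)
    (hψ : ContDiffAt ℝ (n + 1 : ℕ) ψ 0) (h0 : φ 0 = ψ 0)
    (hx : WeightedFlat w fun z => pdx φ z - pdx ψ z)
    (hy : WeightedFlat (w + 1) fun z => pdy φ z - pdy ψ z) :
    WeightedFlat (w + 2) fun z => φ z - ψ z :=
  ⟨sub_eq_zero.2 h0, hx.congr (pdx_sub_eventuallyEq hφ hψ), hy.congr (pdy_sub_eventuallyEq hφ hψ)⟩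

theorem pdx_eq_of_hasDerivAt {z : ℝ × ℝ} {d : ℝ} (hφ : DifferentiableAt ℝ φ z)
    (h : HasDerivAt (fun x => φ (x, z.2)) d z.1) : pdx φ z = d :=
  (hasDerivAt_pdx (x := z.1) (y := z.2) hφ).unique h

theorem pdy_eq_of_hasDerivAt {z : ℝ × ℝ} {d : ℝ} (hφ : DifferentiableAt ℝ φ z)
    (h : HasDerivAt (fun y => φ (z.1, y)) d z.2) : pdy φ z = d :=
  (hasDerivAt_pdy (x := z.1) (y := z.2) hφ).unique h

/-- A polynomial of weighted degree at most three, without the monomial `y²`. -/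
def cuspPoly (a₀ a₁ a₂ a₃ a₄ : ℝ) (z : ℝ × ℝ) : ℝ :=
  a₀ + a₁ * z.2 + a₂ * z.1 + a₃ * (z.1 * z.2) + a₄ * z.2 ^ 3

theorem contDiff_cuspPoly (a₀ a₁ a₂ a₃ a₄ : ℝ) {n : ℕ∞ω} :
    ContDiff ℝ n (cuspPoly a₀ a₁ a₂ a₃ a₄) := by
  unfold cuspPoly; fun_prop

theorem pdx_cuspPoly (a₀ a₁ a₂ a₃ a₄ : ℝ) :
    pdx (cuspPoly a₀ a₁ a₂ a₃ a₄) = cuspPoly a₂ a₃ 0 0 0 := by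
  funext z
  refine pdx_eq_of_hasDerivAt ((contDiff_cuspPoly (n := 1) ..).differentiable (by simp) z) ?_
  have := (((((hasDerivAt_id z.1).const_mul a₂).const_add (a₀ + a₁ * z.2)).add
    (((hasDerivAt_id z.1).mul_const z.2).const_mul a₃)).add_const (a₄ * z.2 ^ 3))
  refine this.congr_deriv ?_
  simp [cuspPoly]

theorem pdy_cuspPoly (a₀ a₁ a₂ a₃ a₄ : ℝ) :
    pdy (cuspPoly a₀ a₁ a₂ a₃ a₄) = fun z => a₁ + a₃ * z.1 + 3 * a₄ * z.2 ^ 2 := by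
  funext z
  refine pdy_eq_of_hasDerivAt ((contDiff_cuspPoly (n := 1) ..).differentiable (by simp) z) ?_
  have := (((((hasDerivAt_id z.2).const_mul a₁).const_add a₀).add_const (a₂ * z.1)).add
    (((hasDerivAt_id z.2).const_mul z.1).const_mul a₃)).add
    (((hasDerivAt_id z.2).pow 3).const_mul a₄)
  refine this.congr_deriv ?_
  simp; ring

theorem weightedFlat_one_of_eq (h : φ 0 = ψ 0) : WeightedFlat 1 fun z => φ z - ψ z :=
  sub_eq_zero.2 h

theorem weightedFlat_two_sub_cuspPoly (hφ : ContDiffAt ℝ 1 φ 0) :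
    WeightedFlat 2 fun z => φ z - cuspPoly (φ 0) (pdy φ 0) 0 0 0 z := by
  refine weightedFlat_sub_succ_succ (n := 0) (by simpa using hφ)
    (contDiff_cuspPoly ..).contDiffAt (by simp [cuspPoly]) trivial ?_
  rw [pdy_cuspPoly]
  exact weightedFlat_one_of_eq (by simp)

/-- The monomials of weight at most three are `1, y, y², x, xy, y³`. At an inflection point the
coefficient of `y²` is zero, and the polynomial matches all the others. -/
theorem weightedFlat_four_sub_cuspPoly (hφ : ContDiffAt ℝ 3 φ 0) (h2 : pdy (pdy φ) 0 = 0) :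
    WeightedFlat 4 fun z => φ z - cuspPoly (φ 0) (pdy φ 0) (pdx φ 0) (pdx (pdy φ) 0)
      (pdy (pdy (pdy φ)) 0 / 6) z := by
  have c0 : ContDiffAt ℝ (2 + 1 : ℕ) φ 0 := hφ
  have cx : ContDiffAt ℝ (1 + 1 : ℕ) (pdx φ) 0 := c0.pdx
  have cy : ContDiffAt ℝ (1 + 1 : ℕ) (pdy φ) 0 := c0.pdy
  have cyy : ContDiffAt ℝ (0 + 1 : ℕ) (pdy (pdy φ)) 0 := cy.pdy
  have hcomm : pdx (pdy φ) 0 = pdy (pdx φ) 0 := pdx_pdy_comm (hφ.of_le (by norm_num))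
  set P := cuspPoly (φ 0) (pdy φ 0) (pdx φ 0) (pdx (pdy φ) 0) (pdy (pdy (pdy φ)) 0 / 6) with hP
  have hPy : pdy P = fun z => pdy φ 0 + pdx (pdy φ) 0 * z.1
      + 3 * (pdy (pdy (pdy φ)) 0 / 6) * z.2 ^ 2 := pdy_cuspPoly ..
  have hPyx : pdx (pdy P) 0 = pdx (pdy φ) 0 := by
    rw [hPy]
    refine pdx_eq_of_hasDerivAt (by fun_prop) ?_
    have := (((hasDerivAt_id (0 : ℝ)).const_mul (pdx (pdy φ) 0)).const_add (pdy φ 0))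
    simpa using this
  have hPyy : pdy (pdy P) = fun z => pdy (pdy (pdy φ)) 0 * z.2 := by
    funext z
    rw [hPy]
    refine pdy_eq_of_hasDerivAt (by fun_prop) ?_
    have := (((hasDerivAt_id z.2).pow 2).const_mul (3 * (pdy (pdy (pdy φ)) 0 / 6))).const_add
      (pdy φ 0 + pdx (pdy φ) 0 * z.1)
    refine this.congr_deriv ?_
    simp; ring
  have hPyyy : pdy (pdy (pdy P)) 0 = pdy (pdy (pdy φ)) 0 := by
    rw [hPyy]
    refine pdy_eq_of_hasDerivAt (by fun_prop) ?_
    have := ((hasDerivAt_id (0 : ℝ)).const_mul (pdy (pdy (pdy φ)) 0))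
    simpa using this
  have sP : ContDiff ℝ 3 P := contDiff_cuspPoly ..
  have sPy : ContDiff ℝ 3 (pdy P) := by rw [hPy]; fun_prop
  have sPyy : ContDiff ℝ 3 (pdy (pdy P)) := by rw [hPyy]; fun_prop
  refine weightedFlat_sub_succ_succ c0 sP.contDiffAt (by simp [hP, cuspPoly]) ?_ ?_
  · refine weightedFlat_sub_succ_succ (w := 0) cx ?_ ?_ trivial ?_
    · rw [hP, pdx_cuspPoly]; exact (contDiff_cuspPoly ..).contDiffAt
    · rw [hP, pdx_cuspPoly]; simp [cuspPoly]
    · rw [hP, pdx_cuspPoly, pdy_cuspPoly]; exact weightedFlat_one_of_eq (by simp [hcomm])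
  · refine weightedFlat_sub_succ_succ (w := 1) cy ?_ ?_ ?_ ?_
    · exact sPy.contDiffAt.of_le (by norm_num)
    · rw [hPy]; simp
    · exact weightedFlat_one_of_eq hPyx.symm
    · refine weightedFlat_sub_succ_succ (w := 0) cyy ?_ ?_ trivial ?_
      · exact sPyy.contDiffAt.of_le (by norm_num)
      · rw [hPyy]; simp [h2]
      · exact weightedFlat_one_of_eq hPyyy.symm

end WeightedPolynomials

/-! ### Dependence of the multiplier and of the Birkhoff coefficient on the parameter. -/

namespace CubicTangencyFamily

variable {r : ℕ∞} {M : Type*} [TopologicalSpace M] [ChartedSpace (ℝ × ℝ) M]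
  [IsManifold 𝓘(ℝ, ℝ × ℝ) (r : WithTop ℕ∞) M] {Ω : SymplecticForm r M}
  (F : CubicTangencyFamily r M Ω)

theorem V_mem_nhds : F.V ∈ 𝓝 (0 : ℝ × ℝ) := F.isOpen_V.mem_nhds F.zero_mem_V

theorem three_le_sub_two {r : ℕ∞} (hr : 5 ≤ r) : (3 : ℕ∞ω) ≤ ((r - 2 : ℕ∞) : WithTop ℕ∞) := by
  have : ((3 : ℕ) : ℕ∞) ≤ r - 2 := by
    refine ENat.le_sub_of_add_le_right (by simp) ?_
    exact le_trans (by norm_num) hr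
  exact WithTop.coe_le_coe.2 this

theorem contDiffOn_joint_localMap (hr : 5 ≤ r) :
    ContDiffOn ℝ 3 (fun p : (ℝ × ℝ) × (ℝ × ℝ) => F.localMap p.1 p.2) (F.V ×ˢ rect F.δ₁ F.δ₂) :=
  F.local_smooth.2.2.of_le (three_le_sub_two hr)

theorem contDiffOn_joint_globalMap (hr : 5 ≤ r) :
    ContDiffOn ℝ 3 (fun p : (ℝ × ℝ) × (ℝ × ℝ) => F.globalMap p.1 p.2) (F.V ×ˢ F.PiMinus) :=
  F.global_smooth.2.2.of_le (three_le_sub_two hr)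

theorem exists_normalForm : ∃ C, 0 ≤ C ∧ ∀ ε ∈ F.V, ∀ z ∈ rect F.δ₁ F.δ₂,
    |(F.localMap ε z).1 - F.lam ε * z.1 * (1 + F.beta ε * (z.1 * z.2))|
        ≤ C * (|z.1| * |z.1 * z.2| * (|z.1| + |z.2|)) ∧
    |(F.localMap ε z).2 - (F.lam ε)⁻¹ * z.2 * (1 + F.beta ε * (z.1 * z.2))⁻¹|
        ≤ C * (|z.2| * |z.1 * z.2| * (|z.1| + |z.2|)) := by
  obtain ⟨C, hC⟩ := F.local_normalForm
  refine ⟨|C|, abs_nonneg _, fun ε hε z hz => ?_⟩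
  obtain ⟨h1, h2⟩ := hC ε hε z hz
  exact ⟨h1.trans (by gcongr; exact le_abs_self _), h2.trans (by gcongr; exact le_abs_self _)⟩

theorem half_mem_rect : (F.δ₁ / 2, (0 : ℝ)) ∈ rect F.δ₁ F.δ₂ := by
  have := F.δ₁_pos
  refine ⟨?_, by simpa using F.δ₂_pos⟩
  rw [abs_of_pos (by positivity)]; linarith

/-- On the axis `y = 0` the remainder of the normal form vanishes, so the multiplier is read off
exactly at one point; it thereby inherits the joint smoothness of the local map. -/
theorem lam_eq {ε : ℝ × ℝ} (hε : ε ∈ F.V) :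
    F.lam ε = (F.localMap ε (F.δ₁ / 2, 0)).1 / (F.δ₁ / 2) := by
  obtain ⟨C, _, hC⟩ := F.exists_normalForm
  have h1 := (hC ε hε _ F.half_mem_rect).1
  have h2 : (0 : ℝ) < F.δ₁ / 2 := half_pos F.δ₁_pos
  simp only [mul_zero, add_zero, mul_one, abs_zero, zero_mul] at h1
  rw [eq_div_iff h2.ne']
  exact (sub_eq_zero.1 (abs_nonpos_iff.1 h1)).symm

theorem contDiffAt_lam (hr : 5 ≤ r) : ContDiffAt ℝ 3 F.lam 0 := by
  have h1 := (F.contDiffOn_joint_localMap hr).contDiffAt (x := ((0, 0), (F.δ₁ / 2, 0)))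
    ((F.isOpen_V.prod (isOpen_rect _ _)).mem_nhds ⟨F.zero_mem_V, F.half_mem_rect⟩)
  have h2 : ContDiffAt ℝ 3 (fun ε : ℝ × ℝ => (ε, (F.δ₁ / 2, (0 : ℝ)))) 0 := by fun_prop
  have h3 : ContDiffAt ℝ 3 (fun ε : ℝ × ℝ => F.localMap ε (F.δ₁ / 2, 0)) 0 :=
    ContDiffAt.comp (g := fun p : (ℝ × ℝ) × (ℝ × ℝ) => F.localMap p.1 p.2) (0 : ℝ × ℝ) h1 h2
  refine (h3.fst.div_const (F.δ₁ / 2)).congr_of_eventuallyEq ?_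
  filter_upwards [F.V_mem_nhds] with ε hε using F.lam_eq hε

theorem lam0_ne_zero : F.lam0 ≠ 0 := F.lam_ne_zero 0 F.zero_mem_V

theorem abs_lam0_lt_one : |F.lam0| < 1 := F.abs_lam_lt_one 0 F.zero_mem_V

-- No regularity of `β` is given. At a point `(t, t)` the normal form determines `λβt³` up to
-- `O(t⁴)`, hence `λβ` up to `O(t)`. The choice `t = τ/k` makes this error `O(1/k)`, while the
-- variation of the map and of `λ`, of order `λᵏ`, survives division by `t³`.
open Asymptotics in
theorem isBigO_beta_sub (hr : 5 ≤ r) {ι : Type*} {l : Filter ι} {k : ι → ℕ} {ε : ι → ℝ × ℝ}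
    (hk : Tendsto k l atTop) (hε : ε =O[l] fun i => |F.lam0| ^ k i) :
    (fun i => (k i : ℝ) * (F.beta (ε i) - F.beta 0)) =O[l] fun _ => (1 : ℝ) := by
  obtain ⟨C, hC, hnf⟩ := F.exists_normalForm
  have hl1 : |(|F.lam0|)| < 1 := by rw [abs_abs]; exact F.abs_lam0_lt_one
  have hpow : ∀ j : ℕ, Tendsto (fun i => (k i : ℝ) ^ j * |F.lam0| ^ k i) l (𝓝 0) := fun j =>
    (tendsto_pow_const_mul_const_pow_of_abs_lt_one j hl1).comp hk
  have hε0 : Tendsto ε l (𝓝 0) := hε.trans_tendsto (by simpa using hpow 0)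
  have hV : ∀ᶠ i in l, ε i ∈ F.V := hε0.eventually F.V_mem_nhds
  set τ : ℝ := min F.δ₁ F.δ₂ / 2 with hτ
  have hτ0 : 0 < τ := half_pos (lt_min F.δ₁_pos F.δ₂_pos)
  have hτ1 : τ < F.δ₁ := by
    have := min_le_left F.δ₁ F.δ₂; have := F.δ₁_pos; linarith
  have hτ2 : τ < F.δ₂ := by
    have := min_le_right F.δ₁ F.δ₂; have := F.δ₂_pos; linarith
  -- The test point approaches the saddle like `1/k`: close enough for the quartic remainder, far
  -- enough for the terms `k⁴|λ|ᵏ` to stay bounded.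
  set t : ι → ℝ := fun i => τ / k i with ht
  have hk1 : ∀ᶠ i in l, 1 ≤ k i := hk.eventually_ge_atTop 1
  have ht0 : Tendsto t l (𝓝 0) :=
    (tendsto_const_nhds (x := τ)).div_atTop (tendsto_natCast_atTop_atTop.comp hk)
  have hmem0 : ((0 : ℝ × ℝ), ((0 : ℝ), (0 : ℝ))) ∈ F.V ×ˢ rect F.δ₁ F.δ₂ :=
    ⟨F.zero_mem_V, by simp [F.δ₁_pos], by simp [F.δ₂_pos]⟩
  have hstrict := ((F.contDiffOn_joint_localMap hr).contDiffAt
    ((F.isOpen_V.prod (isOpen_rect _ _)).mem_nhds hmem0)).hasStrictFDerivAt (by simp)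
  have hpair : Tendsto (fun i => ((ε i, (t i, t i)), ((0 : ℝ × ℝ), (t i, t i)))) l
      (𝓝 ((0, (0, 0)), (0, (0, 0)))) :=
    ((hε0.prodMk_nhds (ht0.prodMk_nhds ht0)).prodMk_nhds
      (tendsto_const_nhds.prodMk_nhds (ht0.prodMk_nhds ht0)))
  have hf : (fun i => (F.localMap (ε i) (t i, t i)).1 - (F.localMap 0 (t i, t i)).1) =O[l]
      fun i => |F.lam0| ^ k i := by
    have h1 := hstrict.isBigO_sub.comp_tendsto hpair
    have h2 : (fun i => ((ε i, (t i, t i)) : (ℝ × ℝ) × (ℝ × ℝ)) - (0, (t i, t i))) =O[l]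
        fun i => |F.lam0| ^ k i := by
      simpa using hε.prod_left (isBigO_zero _ _)
    exact (isBigO_of_le _ fun i => norm_fst_le
      (F.localMap (ε i) (t i, t i) - F.localMap 0 (t i, t i))).trans (h1.trans h2)
  have hlam : (fun i => F.lam (ε i) - F.lam 0) =O[l] fun i => |F.lam0| ^ k i := by
    have h1 := (((F.contDiffAt_lam hr).differentiableAt (by simp)).isBigO_sub).comp_tendsto hε0
    simp only [Function.comp_def, sub_zero] at h1
    exact h1.trans hε
  obtain ⟨Cf, hCf, hf⟩ := hf.exists_nonneg
  obtain ⟨Cl, hCl, hlam'⟩ := hlam.exists_nonneg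
  have hlam0 : Tendsto (fun i => F.lam (ε i)) l (𝓝 F.lam0) :=
    ((F.contDiffAt_lam hr).continuousAt.tendsto.comp hε0)
  have hlne : ∀ᶠ i in l, |F.lam0| / 2 < |F.lam (ε i)| :=
    hlam0.abs.eventually (lt_mem_nhds (half_lt_self (abs_pos.2 F.lam0_ne_zero)))
  have main : (fun i => (k i : ℝ) * (F.lam (ε i) * F.beta (ε i) - F.lam 0 * F.beta 0)) =O[l]
      fun _ => (1 : ℝ) := by
    refine IsBigO.of_bound (Cf / τ ^ 3 + Cl / τ ^ 2 + 4 * C * τ) ?_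
    filter_upwards [hf.bound, hlam'.bound, hV, hk1,
      (hpow 4).eventually (ge_mem_nhds (zero_lt_one' ℝ))] with i b1 b2 hV hk1 b4
    have hk0 : (0 : ℝ) < k i := by exact_mod_cast hk1
    have hk1' : (1 : ℝ) ≤ k i := by exact_mod_cast hk1
    have hti : 0 < t i := div_pos hτ0 hk0
    have htτ : t i ≤ τ := div_le_self hτ0.le hk1'
    have hmem : (t i, t i) ∈ rect F.δ₁ F.δ₂ := by
      refine ⟨?_, ?_⟩ <;> rw [abs_of_pos hti] <;> linarith
    have n1 := (hnf _ hV _ hmem).1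
    have n2 := (hnf _ F.zero_mem_V _ hmem).1
    simp only [abs_mul, abs_of_pos hti] at n1 n2
    simp only [norm_one, mul_one]
    simp only [Real.norm_eq_abs, abs_pow, abs_abs] at b1 b2
    set L := |F.lam0| ^ k i with hL
    have hL0 : 0 ≤ L := by positivity
    have key : |(F.lam (ε i) * F.beta (ε i) - F.lam 0 * F.beta 0) * t i ^ 3|
        ≤ Cf * L + Cl * L * t i + 4 * C * t i ^ 4 := by
      have e : (F.lam (ε i) * F.beta (ε i) - F.lam 0 * F.beta 0) * t i ^ 3
          = ((F.localMap (ε i) (t i, t i)).1 - (F.localMap 0 (t i, t i)).1)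
            - (F.lam (ε i) - F.lam 0) * t i
            - ((F.localMap (ε i) (t i, t i)).1
                - F.lam (ε i) * t i * (1 + F.beta (ε i) * (t i * t i)))
            + ((F.localMap 0 (t i, t i)).1 - F.lam 0 * t i * (1 + F.beta 0 * (t i * t i))) := by
        ring
      rw [e]
      have b3 : |(F.lam (ε i) - F.lam 0) * t i| ≤ Cl * L * t i := by
        rw [abs_mul, abs_of_pos hti]; gcongr
      have q : C * (t i * (t i * t i) * (t i + t i)) = 2 * C * t i ^ 4 := by ring
      rw [q] at n1 n2
      rw [abs_le] at *
      constructor <;> linarith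
    rw [abs_mul, abs_of_pos (by positivity : (0 : ℝ) < t i ^ 3)] at key
    rw [Real.norm_eq_abs, abs_mul, abs_of_pos hk0]
    have hkt : (k i : ℝ) = τ / t i := by rw [ht]; field_simp
    calc _ = k i / t i ^ 3 * (|F.lam (ε i) * F.beta (ε i) - F.lam 0 * F.beta 0| * t i ^ 3) := by
          field_simp
      _ ≤ k i / t i ^ 3 * (Cf * L + Cl * L * t i + 4 * C * t i ^ 4) := by gcongr
      _ = Cf / τ ^ 3 * (k i ^ 4 * L) + Cl / τ ^ 2 * (k i ^ 3 * L) + 4 * C * τ := by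
          rw [ht]; field_simp
      _ ≤ Cf / τ ^ 3 * 1 + Cl / τ ^ 2 * 1 + 4 * C * τ := by
          have b5 : (k i : ℝ) ^ 3 * L ≤ 1 := le_trans (by gcongr; norm_num) b4
          gcongr
      _ = _ := by ring
  have hk_lam : (fun i => (k i : ℝ) * (F.lam (ε i) - F.lam 0)) =O[l] fun _ => (1 : ℝ) := by
    refine ((isBigO_refl (fun i => (k i : ℝ)) l).mul hlam).trans ?_
    have := (hpow 1).isBigO_one ℝ
    simpa using this
  have hinv : (fun i => (F.lam (ε i))⁻¹) =O[l] fun _ => (1 : ℝ) :=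
    (hlam0.inv₀ F.lam0_ne_zero).isBigO_one ℝ
  have hfin := hinv.mul (main.sub (hk_lam.const_mul_left (F.beta 0)))
  simp only [mul_one] at hfin
  refine hfin.congr' ?_ EventuallyEq.rfl
  filter_upwards [hlne] with i hi
  have : F.lam (ε i) ≠ 0 := by
    intro h0; rw [h0, abs_zero] at hi; exact absurd hi (not_lt.2 (by positivity))
  field_simp; ring

/-- Compactness bounds the derivatives and continuity of `λ` at zero keeps `|λ|` away from `0` and
`1`. The bound on `β` comes from the normal form at one fixed point `(t, t)`. -/
theorem eventually_isNormalSaddle (hr : 5 ≤ r) {a b : ℝ} (ha : 0 < a) (hb : 0 < b)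
    (ha₁ : a < F.δ₁) (hb₁ : b < F.δ₂) {m : ℕ} (hm : (m : ℕ∞) ≤ r) :
    ∃ K θ : ℝ, θ < 1 ∧ ∀ᶠ ε in 𝓝 (0 : ℝ × ℝ),
      IsNormalSaddle m a b K θ (F.localMap ε) (F.lam ε) (F.beta ε) := by
  obtain ⟨C, hC, hnf⟩ := F.exists_normalForm
  have hQ : IsCompact (Icc (-a) a ×ˢ Icc (-b) b) := isCompact_Icc.prod isCompact_Icc
  have hQU : Icc (-a) a ×ˢ Icc (-b) b ⊆ rect F.δ₁ F.δ₂ := fun z hz =>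
    ⟨(abs_le.2 hz.1).trans_lt ha₁, (abs_le.2 hz.2).trans_lt hb₁⟩
  have hSQ : rect a b ⊆ Icc (-a) a ×ˢ Icc (-b) b := fun z hz =>
    ⟨abs_le.1 hz.1.le, abs_le.1 hz.2.le⟩
  obtain ⟨K₁, hK₁, hb1⟩ := F.local_smooth.eventually_cnBound F.isOpen_V F.zero_mem_V hQ hQU hSQ hm
  have hl := (F.contDiffAt_lam hr).continuousAt.tendsto
  have hl0 : 0 < |F.lam0| := abs_pos.2 F.lam0_ne_zero
  have e1 : ∀ᶠ ε in 𝓝 (0 : ℝ × ℝ), |F.lam0| / 2 < |F.lam ε| :=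
    hl.abs.eventually (lt_mem_nhds (half_lt_self hl0))
  have e2 : ∀ᶠ ε in 𝓝 (0 : ℝ × ℝ), |F.lam ε| < (1 + |F.lam0|) / 2 :=
    hl.abs.eventually (gt_mem_nhds (show |F.lam 0| < (1 + |F.lam0|) / 2 by
      have := F.abs_lam0_lt_one; change |F.lam0| < _; linarith))
  set t := min a b / 2 with ht
  have ht0 : 0 < t := half_pos (lt_min ha hb)
  have hta : t < a := by have := min_le_left a b; linarith
  have htb : t < b := by have := min_le_right a b; linarith
  have htm : (t, t) ∈ rect a b := by refine ⟨?_, ?_⟩ <;> rwa [abs_of_pos ht0]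
  set A := 1 + (a + b) with hA
  set Kb := (K₁ + t + 2 * C * t ^ 4) / (|F.lam0| / 2 * t ^ 3) with hKb
  set Λ := (|F.lam0| / 2)⁻¹ with hΛ
  have hΛ0 : 0 ≤ Λ := by positivity
  have hKb0 : 0 ≤ Kb := by positivity
  refine ⟨K₁ + A + Λ * A + Kb + Λ + C, (1 + |F.lam0|) / 2, by
    have := F.abs_lam0_lt_one; linarith, ?_⟩
  filter_upwards [hb1, e1, e2, F.V_mem_nhds] with ε hb1 e1 e2 hV
  have hlp : 0 < |F.lam ε| := lt_trans (by positivity) e1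
  have hl1 : |F.lam ε| ≤ 1 := (F.abs_lam_lt_one ε hV).le
  have hinv : |F.lam ε|⁻¹ ≤ Λ := by rw [hΛ]; gcongr
  have hA0 : 0 ≤ A := by positivity
  have hid : CnBound m (rect a b) (fun z : ℝ × ℝ => z) A := by
    refine cnBound_id (by positivity) fun z hz => ?_
    rw [Prod.norm_def]
    exact max_le (hz.1.le.trans (by linarith)) (hz.2.le.trans (by linarith))
  have hU := isOpen_rect a b
  have hΛA : 0 ≤ Λ * A := by positivity
  refine ⟨abs_pos.1 hlp, e2.le, ?_, ?_, ?_, ?_, ?_, ?_⟩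
  · exact hinv.trans (by linarith)
  · have n1 := (hnf ε hV _ (hQU (hSQ htm))).1
    have n2 : |(F.localMap ε (t, t)).1| ≤ K₁ :=
      (norm_fst_le _).trans (hb1.norm_le htm)
    simp only [abs_mul, abs_of_pos ht0] at n1
    have n3 : |F.lam ε * F.beta ε * t ^ 3| ≤ K₁ + t + 2 * C * t ^ 4 := by
      have e : F.lam ε * F.beta ε * t ^ 3 = (F.localMap ε (t, t)).1 - F.lam ε * t
          - ((F.localMap ε (t, t)).1 - F.lam ε * t * (1 + F.beta ε * (t * t))) := by ring
      have q : C * (t * (t * t) * (t + t)) = 2 * C * t ^ 4 := by ring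
      have n4 : |F.lam ε * t| ≤ t := by
        rw [abs_mul, abs_of_pos ht0]; exact mul_le_of_le_one_left ht0.le hl1
      rw [e]; rw [q] at n1
      rw [abs_le] at *
      constructor <;> linarith
    have : |F.beta ε| ≤ Kb := by
      rw [hKb, le_div_iff₀ (by positivity)]
      rw [abs_mul, abs_mul, abs_of_pos (by positivity : (0 : ℝ) < t ^ 3)] at n3
      refine le_trans ?_ n3
      calc _ = |F.lam0| / 2 * (|F.beta ε| * t ^ 3) := by ring
        _ ≤ |F.lam ε| * (|F.beta ε| * t ^ 3) := by gcongr
        _ = _ := by ring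
    linarith
  · refine ((hb1.fst hU hK₁).sub ((hid.fst hU hA0).const_smul hU (F.lam ε)) hU).mono ?_
    have : |F.lam ε| * A ≤ A := mul_le_of_le_one_left hA0 hl1
    linarith
  · refine ((hb1.snd hU hK₁).sub ((hid.snd hU hA0).const_smul hU (F.lam ε)⁻¹) hU).mono ?_
    have : |(F.lam ε)⁻¹| * A ≤ Λ * A := by rw [abs_inv]; gcongr
    linarith
  · intro z hz
    exact (hnf ε hV z (hQU (hSQ hz))).1.trans (by gcongr; linarith)
  · intro z hz
    exact (hnf ε hV z (hQU (hSQ hz))).2.trans (by gcongr; linarith)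

end CubicTangencyFamily

/-! ### Powers of numbers close to one. -/

section Scalars

/-- All powers `|1 + t| ^ i` with `i ≤ k` are at most `exp (k|t|) ≤ e ≤ 3`; the estimates follow by
adding up the differences of consecutive powers. -/
theorem abs_one_add_pow_sub_le {t : ℝ} {k : ℕ} (h : k * |t| ≤ 1) :
    |(1 + t) ^ k - 1| ≤ 3 * (k * |t|) ∧ |(1 + t) ^ k - 1 - k * t| ≤ 3 * (k * |t|) ^ 2 := by
  have hpow : ∀ i ≤ k, |(1 + t)| ^ i ≤ 3 := by
    intro i hi
    have h1 : |1 + t| ≤ 1 + |t| := (abs_add_le _ _).trans (by simp)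
    have h2 : 1 + |t| ≤ Real.exp |t| := by linarith [Real.add_one_le_exp |t|]
    calc |1 + t| ^ i ≤ Real.exp |t| ^ i := by gcongr; exact h1.trans h2
      _ = Real.exp (i * |t|) := by rw [← Real.exp_nat_mul]
      _ ≤ Real.exp 1 := by
        gcongr
        exact le_trans (by gcongr) h
      _ ≤ 3 := by linarith [Real.exp_one_lt_d9]
  have first : ∀ i ≤ k, |(1 + t) ^ i - 1| ≤ 3 * (i * |t|) := by
    intro i hi
    induction i with
    | zero => simp
    | succ i ih =>
      have e : (1 + t) ^ (i + 1) - 1 = ((1 + t) ^ i - 1) + (1 + t) ^ i * t := by ring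
      rw [e]
      refine (abs_add_le _ _).trans ?_
      rw [abs_mul, abs_pow]
      have := hpow i (by omega)
      push_cast
      calc _ ≤ 3 * (i * |t|) + 3 * |t| := by gcongr; exact ih (by omega)
        _ = _ := by ring
  have second : ∀ i ≤ k, |(1 + t) ^ i - 1 - i * t| ≤ 3 * (i * (k * |t| ^ 2)) := by
    intro i hi
    induction i with
    | zero => simp
    | succ i ih =>
      have e : (1 + t) ^ (i + 1) - 1 - (i + 1 : ℕ) * t
          = ((1 + t) ^ i - 1 - i * t) + ((1 + t) ^ i - 1) * t := by push_cast; ring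
      rw [e]
      refine (abs_add_le _ _).trans ?_
      rw [abs_mul]
      have h1 := first i (by omega)
      have h2 : (i : ℝ) ≤ k := by exact_mod_cast (by omega : i ≤ k)
      push_cast
      calc _ ≤ 3 * (i * (k * |t| ^ 2)) + 3 * (k * |t|) * |t| := by
            gcongr
            · exact ih (by omega)
            · exact h1.trans (by gcongr)
        _ = _ := by ring
  exact ⟨first k le_rfl, (second k le_rfl).trans (le_of_eq (by ring))⟩

end Scalars

/-! ### Translations. -/

section Translate

theorem pdx_comp_add (φ : ℝ × ℝ → ℝ) (a : ℝ × ℝ) :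
    pdx (fun w => φ (w + a)) = fun w => pdx φ (w + a) := by
  funext w; simp only [pdx, fderiv_comp_add_right]

theorem pdy_comp_add (φ : ℝ × ℝ → ℝ) (a : ℝ × ℝ) :
    pdy (fun w => φ (w + a)) = fun w => pdy φ (w + a) := by
  funext w; simp only [pdy, fderiv_comp_add_right]

theorem CnBound.comp_add {E F : Type*} [NormedAddCommGroup E] [NormedSpace ℝ E]
    [NormedAddCommGroup F] [NormedSpace ℝ F] {n : ℕ} {s t : Set E} {f : E → F} {K : ℝ}
    (h : CnBound n t f K) {a : E} (hst : MapsTo (fun w => w + a) s t) :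
    CnBound n s (fun w => f (w + a)) K :=
  ⟨h.1.comp (contDiff_id.add contDiff_const).contDiffOn hst, fun j hj z hz => by
    rw [iteratedFDeriv_comp_add_right]; exact h.2 j hj _ (hst hz)⟩

end Translate

/-! ### The `k`-th power of the multiplier, and the passage near the saddle for the family. -/

namespace CubicTangencyFamily

open Asymptotics

variable {r : ℕ∞} {M : Type*} [TopologicalSpace M] [ChartedSpace (ℝ × ℝ) M]
  [IsManifold 𝓘(ℝ, ℝ × ℝ) (r : WithTop ℕ∞) M] {Ω : SymplecticForm r M}
  (F : CubicTangencyFamily r M Ω)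

theorem tendsto_pow_mul_abs_lam0_pow {ι : Type*} {l : Filter ι} {k : ι → ℕ}
    (hk : Tendsto k l atTop) (j : ℕ) :
    Tendsto (fun i => (k i : ℝ) ^ j * |F.lam0| ^ k i) l (𝓝 0) :=
  (tendsto_pow_const_mul_const_pow_of_abs_lt_one j
    (by rw [abs_abs]; exact F.abs_lam0_lt_one)).comp hk

theorem isBigO_pow_mul_one {ι : Type*} {l : Filter ι} {k : ι → ℕ}
    (hk : Tendsto k l atTop) (j : ℕ) :
    (fun i => (k i : ℝ) ^ j * |F.lam0| ^ k i) =O[l] fun _ => (1 : ℝ) :=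
  (F.tendsto_pow_mul_abs_lam0_pow hk j).isBigO_one ℝ

section Multiplier

variable {ι : Type*} {l : Filter ι} {k : ι → ℕ} {ε : ι → ℝ × ℝ}
  (hk : Tendsto k l atTop) (hε : ε =O[l] fun i => |F.lam0| ^ k i)

include hk hε

theorem tendsto_param : Tendsto ε l (𝓝 0) :=
  hε.trans_tendsto (by simpa using F.tendsto_pow_mul_abs_lam0_pow hk 0)

theorem isBigO_lam_div_sub (hr : 5 ≤ r) :
    (fun i => F.lam (ε i) / F.lam0 - 1) =O[l] fun i => |F.lam0| ^ k i := by
  have h1 := (((F.contDiffAt_lam hr).differentiableAt (by simp)).isBigO_sub).comp_tendsto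
    (F.tendsto_param hk hε)
  simp only [Function.comp_def, sub_zero] at h1
  refine ((h1.trans hε).const_mul_left (F.lam0)⁻¹).congr_left fun i => ?_
  have := F.lam0_ne_zero
  change F.lam0⁻¹ * (F.lam (ε i) - F.lam0) = _
  field_simp

theorem eventually_mul_abs_lam_div_sub_le (hr : 5 ≤ r) :
    ∀ᶠ i in l, (k i : ℝ) * |F.lam (ε i) / F.lam0 - 1| ≤ 1 := by
  have h := ((isBigO_refl (fun i => (k i : ℝ)) l).mul (F.isBigO_lam_div_sub hk hε hr)).trans_tendsto
    (by simpa using F.tendsto_pow_mul_abs_lam0_pow hk 1)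
  filter_upwards [h.abs.eventually (ge_mem_nhds (show |(0 : ℝ)| < 1 by simp))] with i hi
  rwa [abs_mul, Nat.abs_cast] at hi

theorem isBigO_lam_pow_div_sub (hr : 5 ≤ r) :
    (fun i => F.lam (ε i) ^ k i / F.lam0 ^ k i - 1) =O[l] fun i => (k i : ℝ) * |F.lam0| ^ k i := by
  refine IsBigO.trans (g := fun i => (k i : ℝ) * (F.lam (ε i) / F.lam0 - 1)) ?_
    ((isBigO_refl _ _).mul (F.isBigO_lam_div_sub hk hε hr))
  refine IsBigO.of_bound 3 ?_
  filter_upwards [F.eventually_mul_abs_lam_div_sub_le hk hε hr] with i hi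
  have := (abs_one_add_pow_sub_le hi).1
  rwa [add_sub_cancel, div_pow, ← Real.norm_eq_abs, ← Real.norm_eq_abs, ← Real.norm_natCast,
    ← norm_mul] at this

/-- For `ε = O(λᵏ)` the quadratic error is `O(k²λ²ᵏ)`, which is `O(λᵏ)`; the linear term, of order
`kλᵏ`, has to be retained in the constant term of the return map. -/
theorem isBigO_lam_pow_div_sub_sub (hr : 5 ≤ r) :
    (fun i => F.lam (ε i) ^ k i / F.lam0 ^ k i - 1 - k i * (F.lam (ε i) / F.lam0 - 1)) =O[l]
      fun i => |F.lam0| ^ k i := by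
  have h1 : (fun i => ((k i : ℝ) * |F.lam (ε i) / F.lam0 - 1|) ^ 2) =O[l]
      fun i => |F.lam0| ^ k i := by
    have := ((isBigO_refl (fun i => (k i : ℝ)) l).mul
      (F.isBigO_lam_div_sub hk hε hr).norm_left).pow 2
    refine this.trans ?_
    have h2 := (F.isBigO_pow_mul_one hk 2).mul (isBigO_refl (fun i => |F.lam0| ^ k i) l)
    simp only [one_mul] at h2
    exact h2.congr_left fun i => by ring
  refine IsBigO.trans (IsBigO.of_bound 3 ?_) h1
  filter_upwards [F.eventually_mul_abs_lam_div_sub_le hk hε hr] with i hi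
  have := (abs_one_add_pow_sub_le hi).2
  rw [add_sub_cancel, div_pow] at this
  rw [Real.norm_eq_abs, Real.norm_of_nonneg (by positivity)]
  exact this

theorem tendsto_lam_pow_div (hr : 5 ≤ r) :
    Tendsto (fun i => F.lam (ε i) ^ k i / F.lam0 ^ k i) l (𝓝 1) := by
  have h := (F.isBigO_lam_pow_div_sub hk hε hr).trans_tendsto
    (by simpa using F.tendsto_pow_mul_abs_lam0_pow hk 1)
  simpa using h.add_const 1

theorem isBigO_lam_pow (hr : 5 ≤ r) :
    (fun i => F.lam (ε i) ^ k i) =O[l] fun i => |F.lam0| ^ k i := by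
  have h := ((F.tendsto_lam_pow_div hk hε hr).isBigO_one ℝ).mul
    (isBigO_refl (fun i => F.lam0 ^ k i) l)
  have h2 : (fun i => F.lam0 ^ k i) =O[l] fun i => |F.lam0| ^ k i :=
    IsBigO.of_norm_le fun i => by simp
  simp only [one_mul] at h
  refine (h.congr_left fun i => ?_).trans h2
  exact div_mul_cancel₀ _ (pow_ne_zero _ F.lam0_ne_zero)

theorem isBigO_lam_pow_sub (hr : 5 ≤ r) :
    (fun i => F.lam (ε i) ^ k i - F.lam0 ^ k i) =O[l]
      fun i => (k i : ℝ) * |F.lam0| ^ k i * |F.lam0| ^ k i := by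
  have h := (F.isBigO_lam_pow_div_sub hk hε hr).mul (isBigO_refl (fun i => F.lam0 ^ k i) l)
  have h2 : (fun i => F.lam0 ^ k i) =O[l] fun i => |F.lam0| ^ k i :=
    IsBigO.of_norm_le fun i => by simp
  refine (h.congr_left fun i => ?_).trans ((isBigO_refl _ _).mul h2)
  rw [sub_mul, div_mul_cancel₀ _ (pow_ne_zero _ F.lam0_ne_zero), one_mul]

end Multiplier

/-- The rescaled passage near the saddle along the orbit of the homoclinic point. -/
theorem exists_passage (hr : 5 ≤ r) {n : ℕ} (hn : 1 ≤ n) (hnr : (n : ℕ∞) + 2 ≤ r) :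
    ∃ ρ a b : ℝ, 0 < ρ ∧ a < F.δ₁ ∧ b < F.δ₂ ∧
    ∀ {ι : Type} {l : Filter ι} {k : ι → ℕ} {ε : ι → ℝ × ℝ}, Tendsto k l atTop →
      (ε =O[l] fun i => |F.lam0| ^ k i) →
      CnBigO n (Metric.ball (F.xPlus, F.yMinus) ρ) l
        (fun i z => saddleOrbit (F.localMap (ε i)) (F.lam (ε i)) (k i) (k i) z - z)
        (fun i => (k i : ℝ) * |F.lam0| ^ k i) ∧
      (∀ᶠ i in l, ∀ j ≤ k i, MapsTo (saddleOrbit (F.localMap (ε i)) (F.lam (ε i)) (k i) j)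
        (Metric.ball (F.xPlus, F.yMinus) ρ) (rect a b)) ∧
      ((fun i => (saddleOrbit (F.localMap (ε i)) (F.lam (ε i)) (k i) (k i)
          (F.xPlus, F.yMinus)).1 - F.xPlus
          - k i * (F.beta 0 * F.lam0 ^ k i * (F.xPlus ^ 2 * F.yMinus))) =O[l]
        fun i => |F.lam0| ^ k i) ∧
      ((fun i => (saddleOrbit (F.localMap (ε i)) (F.lam (ε i)) (k i) (k i)
          (F.xPlus, F.yMinus)).2 - F.yMinus
          + k i * (F.beta 0 * F.lam0 ^ k i * (F.yMinus ^ 2 * F.xPlus))) =O[l]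
        fun i => |F.lam0| ^ k i) := by
  have hx := F.xPlus_pos
  have hy := F.yMinus_pos
  have hx1 := F.xPlus_lt
  have hy1 := F.yMinus_lt
  -- A quarter of the gap to the boundary of `U₀`: points of the ball of radius `ρ`, displaced by at
  -- most `ρ`, stay in the rectangle with margins `2ρ`, which is still strictly inside `U₀`.
  set ρ := min (F.δ₁ - F.xPlus) (F.δ₂ - F.yMinus) / 4 with hρ
  have hρ0 : 0 < ρ := by
    have : 0 < min (F.δ₁ - F.xPlus) (F.δ₂ - F.yMinus) :=
      lt_min (by linarith) (by linarith)
    positivity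
  have hρ1 : 4 * ρ ≤ F.δ₁ - F.xPlus := by
    have := min_le_left (F.δ₁ - F.xPlus) (F.δ₂ - F.yMinus); linarith
  have hρ2 : 4 * ρ ≤ F.δ₂ - F.yMinus := by
    have := min_le_right (F.δ₁ - F.xPlus) (F.δ₂ - F.yMinus); linarith
  set a := F.xPlus + 2 * ρ with ha
  set b := F.yMinus + 2 * ρ with hb
  have hbr : (n + 2 : ℕ) ≤ r := by exact_mod_cast hnr
  obtain ⟨K, θ, hθ, hsad⟩ := F.eventually_isNormalSaddle hr (a := a) (b := b) (by linarith)
    (by linarith) (by linarith) (by linarith) hbr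
  refine ⟨ρ, a, b, hρ0, by linarith, by linarith, ?_⟩
  intro ι l k ε hk hε
  set A := 1 + a + b with hA
  have hA1 : 1 ≤ A := by linarith
  have haA : a ≤ A := by linarith
  have hbA : b ≤ A := by linarith
  set C := n.factorial * (2 ^ n * K ^ 2 * A ^ 3) * 2 ^ n with hC
  have hC0 : 0 ≤ C := by positivity
  have hε0 := F.tendsto_param hk hε
  have hL := F.isBigO_lam_pow hk hε hr
  obtain ⟨D, hD, hLb⟩ := hL.exists_nonneg
  have hlim : ∀ (j : ℕ) (E : ℝ), Tendsto (fun i => E * ((k i : ℝ) ^ j * |F.lam0| ^ k i)) l (𝓝 0) :=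
    fun j E => by simpa using (F.tendsto_pow_mul_abs_lam0_pow hk j).const_mul E
  have hsρ : ∀ z ∈ Metric.ball (F.xPlus, F.yMinus) ρ, ∀ w, ‖w - z‖ ≤ ρ → w ∈ rect a b := by
    intro z hz w hw
    rw [mem_ball_iff_norm] at hz
    have h1 := (norm_fst_le _).trans_lt hz
    have h2 := (norm_snd_le _).trans_lt hz
    have h3 := (norm_fst_le _).trans hw
    have h4 := (norm_snd_le _).trans hw
    simp only [Prod.fst_sub, Prod.snd_sub, Real.norm_eq_abs, abs_lt, abs_le] at h1 h2 h3 h4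
    exact ⟨abs_lt.2 ⟨by linarith, by linarith⟩, abs_lt.2 ⟨by linarith, by linarith⟩⟩
  have ev : ∀ᶠ i in l, IsNormalSaddle (n + 2) a b K θ (F.localMap (ε i)) (F.lam (ε i))
        (F.beta (ε i)) ∧ |F.lam (ε i)| ^ k i ≤ D * |F.lam0| ^ k i ∧
      C * k i * |F.lam (ε i)| ^ k i ≤ 1 ∧ C * k i * |F.lam (ε i)| ^ k i ≤ ρ ∧
      K * A ^ 2 * |F.lam (ε i)| ^ k i ≤ 1 / 2 ∧ (k i : ℝ) ^ 2 * |F.lam (ε i)| ^ k i ≤ 1 := by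
    filter_upwards [hε0.eventually hsad, hLb.bound,
      (hlim 1 (C * D)).eventually (gt_mem_nhds (zero_lt_one' ℝ)),
      (hlim 1 (C * D)).eventually (gt_mem_nhds hρ0),
      (hlim 0 (K * A ^ 2 * D)).eventually (gt_mem_nhds (show (0 : ℝ) < 1 / 2 by norm_num)),
      (hlim 2 D).eventually (gt_mem_nhds (zero_lt_one' ℝ))] with i h1 h2 h3 h4 h5 h6
    have hK := h1.one_le hθ
    simp only [Real.norm_eq_abs, abs_pow, abs_abs] at h2
    refine ⟨h1, h2, ?_, ?_, ?_, ?_⟩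
    · calc _ ≤ C * k i * (D * |F.lam0| ^ k i) := by gcongr
        _ = C * D * ((k i : ℝ) ^ 1 * |F.lam0| ^ k i) := by ring
        _ ≤ _ := h3.le
    · calc _ ≤ C * k i * (D * |F.lam0| ^ k i) := by gcongr
        _ = C * D * ((k i : ℝ) ^ 1 * |F.lam0| ^ k i) := by ring
        _ ≤ _ := h4.le
    · calc _ ≤ K * A ^ 2 * (D * |F.lam0| ^ k i) := by gcongr
        _ = K * A ^ 2 * D * ((k i : ℝ) ^ 0 * |F.lam0| ^ k i) := by ring
        _ ≤ _ := h5.le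
    · calc _ ≤ (k i : ℝ) ^ 2 * (D * |F.lam0| ^ k i) := by gcongr
        _ = D * ((k i : ℝ) ^ 2 * |F.lam0| ^ k i) := by ring
        _ ≤ _ := h6.le
  have horb : ∀ᶠ i in l, ∀ j ≤ k i,
      CnBound n (Metric.ball (F.xPlus, F.yMinus) ρ)
        (fun z => saddleOrbit (F.localMap (ε i)) (F.lam (ε i)) (k i) j z - z)
        (C * j * |F.lam (ε i)| ^ k i) ∧
      MapsTo (saddleOrbit (F.localMap (ε i)) (F.lam (ε i)) (k i) j)
        (Metric.ball (F.xPlus, F.yMinus) ρ) (rect a b) := by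
    filter_upwards [ev] with i ⟨h1, _, h3, h4, _, _⟩ j hj
    exact cnBound_saddleOrbit h1 hθ hn le_rfl hA1 haA hbA Metric.isOpen_ball hsρ le_rfl h3 h4 hj
  have href : (F.xPlus, F.yMinus) ∈ Metric.ball (F.xPlus, F.yMinus) ρ :=
    Metric.mem_ball_self hρ0
  have hfine := (ev.and horb).mono fun i hi =>
    abs_saddleOrbit_sub_le hi.1.1 hθ hA1 haA hbA (k := k i) hC0
      (fun j hj => (hi.2 j hj).2 href)
      (fun j hj => ((hi.2 j hj).1.norm_le href).trans (by gcongr))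
      hi.1.2.2.2.2.1 hi.1.2.2.2.2.2
  -- replacing `β(ε) λ(ε)ᵏ` by `β(0) λ(0)ᵏ`
  have hrep : (fun i => (k i : ℝ) * (F.beta (ε i) * F.lam (ε i) ^ k i)
      - k i * (F.beta 0 * F.lam0 ^ k i)) =O[l] fun i => |F.lam0| ^ k i := by
    have g1 := (F.isBigO_beta_sub hr hk hε).mul hL
    simp only [one_mul] at g1
    have g2 := ((isBigO_refl (fun i => (k i : ℝ)) l).mul
      (F.isBigO_lam_pow_sub hk hε hr)).const_mul_left (F.beta 0)
    have g3 : (fun i => (k i : ℝ) * ((k i : ℝ) * |F.lam0| ^ k i * |F.lam0| ^ k i)) =O[l]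
        fun i => |F.lam0| ^ k i := by
      have := (F.isBigO_pow_mul_one hk 2).mul (isBigO_refl (fun i => |F.lam0| ^ k i) l)
      simp only [one_mul] at this
      exact this.congr_left fun i => by ring
    exact (g1.add (g2.trans g3)).congr_left fun i => by ring
  refine ⟨⟨C * D, by positivity, ?_⟩, horb.mono fun i hi j hj => (hi j hj).2, ?_, ?_⟩
  · filter_upwards [ev, horb] with i h1 h2
    refine (h2 (k i) le_rfl).1.mono ?_
    rw [abs_of_nonneg (by positivity : 0 ≤ (k i : ℝ) * |F.lam0| ^ k i)]
    calc _ ≤ C * k i * (D * |F.lam0| ^ k i) := by gcongr; exact h1.2.1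
      _ = _ := by ring
  · have g : (fun i => (saddleOrbit (F.localMap (ε i)) (F.lam (ε i)) (k i) (k i)
          (F.xPlus, F.yMinus)).1 - F.xPlus
          - k i * (F.beta (ε i) * F.lam (ε i) ^ k i * (F.xPlus ^ 2 * F.yMinus))) =O[l]
        fun i => |F.lam0| ^ k i := (IsBigO.of_bound _ (hfine.mono fun i hi => by
        simp only [Real.norm_eq_abs, abs_pow]; exact hi.1)).trans hL
    exact (g.add (hrep.const_mul_left (F.xPlus ^ 2 * F.yMinus))).congr_left fun i => by
      ring
  · have g : (fun i => (saddleOrbit (F.localMap (ε i)) (F.lam (ε i)) (k i) (k i)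
          (F.xPlus, F.yMinus)).2 - F.yMinus
          + k i * (F.beta (ε i) * F.lam (ε i) ^ k i * (F.yMinus ^ 2 * F.xPlus))) =O[l]
        fun i => |F.lam0| ^ k i := (IsBigO.of_bound _ (hfine.mono fun i hi => by
        simp only [Real.norm_eq_abs, abs_pow]; exact hi.2)).trans hL
    exact (g.sub (hrep.const_mul_left (F.yMinus ^ 2 * F.xPlus))).congr_left fun i => by
      ring

end CubicTangencyFamily

/-! ### Products with bounded factors and cusp polynomials. -/

namespace CnBigO

open Asymptotics

variable {ι E : Type*} [NormedAddCommGroup E] [NormedSpace ℝ E] {n : ℕ} {s : Set E} {l : Filter ι}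
  {f f₁ f₂ : ι → E → ℝ} {g : ι → ℝ} {c : ι → ℝ}

theorem mul_bounded (h₁ : CnBigO n s l f₁ g) (h₂ : CnBigO n s l f₂ fun _ => 1) (hs : IsOpen s) :
    CnBigO n s l (fun i z => f₁ i z * f₂ i z) g :=
  (h₁.mul h₂ hs).trans (by simpa using isBigO_refl g l)

theorem const_mul_bounded (hc : c =O[l] g) (h : CnBigO n s l f fun _ => 1) (hs : IsOpen s) :
    CnBigO n s l (fun i z => c i * f i z) g :=
  (CnBigO.const hc).mul_bounded h hs

theorem bounded_const_mul (hc : c =O[l] fun _ => (1 : ℝ)) (h : CnBigO n s l f g) (hs : IsOpen s) :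
    CnBigO n s l (fun i z => c i * f i z) g :=
  ((CnBigO.const hc).mul h hs).trans (by simpa using isBigO_refl g l)

theorem cuspPoly {w : ι → E → ℝ × ℝ} {a₀ a₁ a₂ a₃ a₄ : ι → ℝ}
    (hw : CnBigO n s l w fun _ => 1) (hs : IsOpen s) (h₀ : a₀ =O[l] fun _ => (1 : ℝ))
    (h₁ : a₁ =O[l] fun _ => (1 : ℝ)) (h₂ : a₂ =O[l] fun _ => (1 : ℝ))
    (h₃ : a₃ =O[l] fun _ => (1 : ℝ)) (h₄ : a₄ =O[l] fun _ => (1 : ℝ)) :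
    CnBigO n s l (fun i z => cuspPoly (a₀ i) (a₁ i) (a₂ i) (a₃ i) (a₄ i) (w i z)) fun _ => 1 := by
  have hx := hw.fst hs
  have hy := hw.snd hs
  refine (((((CnBigO.const h₀).add (bounded_const_mul h₁ hy hs) hs).add
    (bounded_const_mul h₂ hx hs) hs).add (bounded_const_mul h₃ (hx.mul_bounded hy hs) hs) hs).add
    (bounded_const_mul h₄ ((hy.mul_bounded hy hs).mul_bounded hy hs) hs) hs).congr hs
    (Eventually.of_forall fun i z _ => ?_)
  simp only [_root_.cuspPoly]
  ring

end CnBigO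

/-- First-order Taylor estimate in one variable for a function with a Lipschitz derivative. -/
theorem abs_sub_sub_mul_le {g g' g'' : ℝ → ℝ} {t M : ℝ}
    (hg : ∀ s, |s| ≤ |t| → HasDerivAt g (g' s) s) (hg' : ∀ s, |s| ≤ |t| → HasDerivAt g' (g'' s) s)
    (hM : ∀ s, |s| ≤ |t| → |g'' s| ≤ M) : |g t - g 0 - t * g' 0| ≤ M * t ^ 2 := by
  have h1 : ∀ s, |s| ≤ |t| → |g' s - g' 0| ≤ M * |t| := fun s hs =>
    (abs_le_of_hasDerivAt_of_abs_le (g := fun s => g' s - g' 0) (sub_self _)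
      (fun u hu => (hg' u (hu.trans hs)).sub_const _) (fun u hu => hM u (hu.trans hs))).trans
    (mul_le_mul_of_nonneg_left hs ((abs_nonneg _).trans (hM 0 (by simp))))
  have h2 := abs_le_of_hasDerivAt_of_abs_le (g := fun s => g s - g 0 - s * g' 0)
    (g' := fun s => g' s - g' 0) (x := t) (by simp)
    (fun s hs => (((hg s hs).sub_const _).sub ((hasDerivAt_id s).mul_const _)).congr_deriv
      (by simp)) h1
  rw [mul_assoc, abs_mul_abs_self] at h2
  rwa [pow_two]

/-! ### Coefficients and weighted Taylor expansion of the global map. -/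

namespace CubicTangencyFamily

open Asymptotics

variable {r : ℕ∞} {M : Type*} [TopologicalSpace M] [ChartedSpace (ℝ × ℝ) M]
  [IsManifold 𝓘(ℝ, ℝ × ℝ) (r : WithTop ℕ∞) M] {Ω : SymplecticForm r M}
  (F : CubicTangencyFamily r M Ω)

/-- The first component of the global map. -/
noncomputable abbrev globalX (ε z : ℝ × ℝ) : ℝ := (F.globalMap ε z).1

/-- The second component of the global map. -/
noncomputable abbrev globalY (ε z : ℝ × ℝ) : ℝ := (F.globalMap ε z).2

theorem contDiffOn_joint_globalX (hr : 5 ≤ r) :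
    ContDiffOn ℝ 3 (fun p : (ℝ × ℝ) × (ℝ × ℝ) => F.globalX p.1 p.2) (F.V ×ˢ F.PiMinus) :=
  contDiff_fst.comp_contDiffOn (F.contDiffOn_joint_globalMap hr)

theorem contDiffOn_joint_globalY (hr : 5 ≤ r) :
    ContDiffOn ℝ 3 (fun p : (ℝ × ℝ) × (ℝ × ℝ) => F.globalY p.1 p.2) (F.V ×ˢ F.PiMinus) :=
  contDiff_snd.comp_contDiffOn (F.contDiffOn_joint_globalMap hr)

theorem contDiffOn_joint_pdy_globalX (hr : 5 ≤ r) :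
    ContDiffOn ℝ 1 (fun p : (ℝ × ℝ) × (ℝ × ℝ) => pdy (F.globalX p.1) p.2) (F.V ×ˢ F.PiMinus) :=
  (contDiffOn_joint_pdy (g := F.globalX) F.isOpen_V F.isOpen_PiMinus (n := 1)
    ((F.contDiffOn_joint_globalX hr).of_le (by norm_num)))

theorem contDiffOn_joint_pdx_globalY (hr : 5 ≤ r) :
    ContDiffOn ℝ 1 (fun p : (ℝ × ℝ) × (ℝ × ℝ) => pdx (F.globalY p.1) p.2) (F.V ×ˢ F.PiMinus) :=
  (contDiffOn_joint_pdx (g := F.globalY) F.isOpen_V F.isOpen_PiMinus (n := 1)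
    ((F.contDiffOn_joint_globalY hr).of_le (by norm_num)))

theorem contDiffOn_joint_pdy_globalY (hr : 5 ≤ r) :
    ContDiffOn ℝ 2 (fun p : (ℝ × ℝ) × (ℝ × ℝ) => pdy (F.globalY p.1) p.2) (F.V ×ˢ F.PiMinus) :=
  (contDiffOn_joint_pdy (g := F.globalY) F.isOpen_V F.isOpen_PiMinus (n := 2)
    (F.contDiffOn_joint_globalY hr))

theorem contDiffOn_joint_pdx_pdy_globalY (hr : 5 ≤ r) :
    ContDiffOn ℝ 1 (fun p : (ℝ × ℝ) × (ℝ × ℝ) => pdx (pdy (F.globalY p.1)) p.2)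
      (F.V ×ˢ F.PiMinus) :=
  (contDiffOn_joint_pdx (g := fun ε => pdy (F.globalY ε)) F.isOpen_V F.isOpen_PiMinus (n := 1)
    (F.contDiffOn_joint_pdy_globalY hr))

theorem contDiffOn_joint_pdy_pdy_globalY (hr : 5 ≤ r) :
    ContDiffOn ℝ 1 (fun p : (ℝ × ℝ) × (ℝ × ℝ) => pdy (pdy (F.globalY p.1)) p.2)
      (F.V ×ˢ F.PiMinus) :=
  (contDiffOn_joint_pdy (g := fun ε => pdy (F.globalY ε)) F.isOpen_V F.isOpen_PiMinus (n := 1)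
    (F.contDiffOn_joint_pdy_globalY hr))

theorem prod_mem_nhds : F.V ×ˢ F.PiMinus ∈ 𝓝 ((0 : ℝ × ℝ), ((0 : ℝ), F.yMinus)) :=
  (F.isOpen_V.prod F.isOpen_PiMinus).mem_nhds ⟨F.zero_mem_V, F.mem_PiMinus⟩

theorem exists_uniform_cnBound {N : ℕ} (hN : (N : ℕ∞) ≤ r) :
    ∃ δ C : ℝ, 0 < δ ∧ 0 ≤ C ∧ Metric.ball ((0 : ℝ), F.yMinus) δ ⊆ F.PiMinus ∧
      ∀ᶠ ε in 𝓝 (0 : ℝ × ℝ),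
        CnBound N (Metric.ball ((0 : ℝ), F.yMinus) δ) (F.globalMap ε) C := by
  obtain ⟨δ, hδ, h⟩ := Metric.nhds_basis_closedBall.mem_iff.1
    (F.isOpen_PiMinus.mem_nhds F.mem_PiMinus)
  obtain ⟨C, hC, h2⟩ := F.global_smooth.eventually_cnBound F.isOpen_V F.zero_mem_V
    (isCompact_closedBall _ δ) h (S := Metric.ball ((0 : ℝ), F.yMinus) δ)
    Metric.ball_subset_closedBall hN
  exact ⟨δ, C, hδ, hC, Metric.ball_subset_closedBall.trans h, h2⟩

section Coefficients

variable {ι : Type*} {l : Filter ι} {ε : ι → ℝ × ℝ} {y σ : ι → ℝ}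

theorem tendsto_base (hσ : Tendsto σ l (𝓝 0)) (hε : ε =O[l] σ)
    (hy : (fun i => y i - F.yMinus) =O[l] σ) :
    Tendsto (fun i => (ε i, ((0 : ℝ), y i))) l (𝓝 ((0 : ℝ × ℝ), ((0 : ℝ), F.yMinus))) := by
  refine (hε.trans_tendsto hσ).prodMk_nhds (tendsto_const_nhds.prodMk_nhds ?_)
  simpa using (hy.trans_tendsto hσ).add_const F.yMinus

/-- Differentiability at the base point is enough, since parameter and point both deviate from it by
`O(σ)`. -/
theorem isBigO_sub_base {φ : (ℝ × ℝ) × (ℝ × ℝ) → ℝ}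
    (hφ : ContDiffOn ℝ 1 φ (F.V ×ˢ F.PiMinus)) (hσ : Tendsto σ l (𝓝 0)) (hε : ε =O[l] σ)
    (hy : (fun i => y i - F.yMinus) =O[l] σ) :
    (fun i => φ (ε i, (0, y i)) - φ (0, (0, F.yMinus))) =O[l] σ := by
  have h1 := ((hφ.contDiffAt F.prod_mem_nhds).differentiableAt (by simp)).isBigO_sub.comp_tendsto
    (F.tendsto_base hσ hε hy)
  refine h1.trans ?_
  have h2 : (fun i => (ε i, ((0 : ℝ), y i - F.yMinus))) =O[l] σ :=
    hε.prod_left ((isBigO_zero _ _).prod_left hy)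
  refine h2.congr_left fun i => ?_
  simp

/-- The third derivative along the unstable manifold is only continuous in the parameter, but it
varies by `O(τ)` under variations of the parameter and the point of order `τ²`. -/
theorem isBigO_pdy_pdy_pdy_sub (hr : 5 ≤ r) {τ : ι → ℝ} (hτ : Tendsto τ l (𝓝 0))
    (hτ₀ : ∀ᶠ i in l, 0 < τ i) (hε : ε =O[l] fun i => τ i ^ 2)
    (hy : (fun i => y i - F.yMinus) =O[l] fun i => τ i ^ 2) :
    (fun i => pdy (pdy (pdy (F.globalY (ε i)))) (0, y i) -
      pdy (pdy (pdy (F.globalY 0))) (0, F.yMinus)) =O[l] τ := by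
  have h4r : ((4 : ℕ) : ℕ∞) ≤ r := le_trans (by norm_num) hr
  have hτ2 : Tendsto (fun i => τ i ^ 2) l (𝓝 0) := by simpa using hτ.pow 2
  obtain ⟨δ, C, hδ, hC, hsub, hb⟩ := F.exists_uniform_cnBound h4r
  have hj := F.contDiffOn_joint_pdy_pdy_globalY hr
  -- The fourth `y`-derivative is bounded uniformly in `ε`, so the difference quotient of `G_yy`
  -- with step `t` gives `G_yyy` up to `O(t)`.
  have taylor : ∀ {ε : ℝ × ℝ}, CnBound 4 (Metric.ball ((0 : ℝ), F.yMinus) δ) (F.globalMap ε) C →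
      ∀ {y t : ℝ}, |y - F.yMinus| < δ / 2 → |t| < δ / 2 →
      |pdy (pdy (F.globalY ε)) (0, y + t) - pdy (pdy (F.globalY ε)) (0, y)
        - t * pdy (pdy (pdy (F.globalY ε))) (0, y)| ≤ C * t ^ 2 := by
    intro ε h y t hy ht
    have ho : IsOpen (Metric.ball ((0 : ℝ), F.yMinus) δ) := Metric.isOpen_ball
    have h2 : CnBound 2 _ (pdy (pdy (F.globalY ε))) C := ((h.snd ho hC).pdy ho hC).pdy ho hC
    have h1 : CnBound 1 _ (pdy (pdy (pdy (F.globalY ε)))) C := h2.pdy ho hC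
    have h0 : CnBound 0 _ (pdy (pdy (pdy (pdy (F.globalY ε))))) C := h1.pdy ho hC
    have hm : ∀ s, |s| ≤ |t| → ((0 : ℝ), y + s) ∈ Metric.ball ((0 : ℝ), F.yMinus) δ := by
      intro s hs
      rw [mem_ball_iff_norm, Prod.norm_def]
      refine max_lt (by simpa using hδ) ?_
      simp only [Prod.snd_sub, Real.norm_eq_abs]
      have := abs_add_le (y - F.yMinus) s
      rw [show y + s - F.yMinus = y - F.yMinus + s by ring]
      linarith
    have key := abs_sub_sub_mul_le (g := fun s => pdy (pdy (F.globalY ε)) (0, y + s))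
      (g' := fun s => pdy (pdy (pdy (F.globalY ε))) (0, y + s))
      (g'' := fun s => pdy (pdy (pdy (pdy (F.globalY ε)))) (0, y + s)) (t := t) (M := C)
      (fun s hs => HasDerivAt.comp_const_add y s
        (hasDerivAt_pdy (h2.differentiableAt (n := 1) ho (hm s hs))))
      (fun s hs => HasDerivAt.comp_const_add y s
        (hasDerivAt_pdy (h1.differentiableAt (n := 0) ho (hm s hs))))
      (fun s hs => h0.norm_le (hm s hs))
    simpa using key
  -- Strict differentiability gives a Lipschitz bound for `G_yy` between points that both move, here
  -- the two base points shifted by the same `τ`.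
  have hstrict := ((hj.contDiffAt F.prod_mem_nhds).hasStrictFDerivAt one_ne_zero).isBigO_sub
  have hpt : Tendsto (fun i => (ε i, ((0 : ℝ), y i + τ i))) l
      (𝓝 ((0 : ℝ × ℝ), ((0 : ℝ), F.yMinus))) := by
    refine (hε.trans_tendsto hτ2).prodMk_nhds (tendsto_const_nhds.prodMk_nhds ?_)
    simpa using ((hy.trans_tendsto hτ2).add_const F.yMinus).add hτ
  have hpt0 : Tendsto (fun i => ((0 : ℝ × ℝ), ((0 : ℝ), F.yMinus + τ i))) l
      (𝓝 ((0 : ℝ × ℝ), ((0 : ℝ), F.yMinus))) := by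
    refine tendsto_const_nhds.prodMk_nhds (tendsto_const_nhds.prodMk_nhds ?_)
    simpa using hτ.const_add F.yMinus
  have d1 := hstrict.comp_tendsto (hpt.prodMk_nhds hpt0)
  have hd : (fun i => (ε i, ((0 : ℝ), y i - F.yMinus))) =O[l] fun i => τ i ^ 2 :=
    hε.prod_left ((isBigO_zero _ _).prod_left hy)
  have d1' := d1.trans (hd.congr_left fun i => by simp)
  have d2 := F.isBigO_sub_base hj hτ2 hε hy
  have t1 : (fun i => pdy (pdy (F.globalY (ε i))) (0, y i + τ i) -
      pdy (pdy (F.globalY (ε i))) (0, y i)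
        - τ i * pdy (pdy (pdy (F.globalY (ε i)))) (0, y i)) =O[l] fun i => τ i ^ 2 := by
    refine IsBigO.of_bound C ?_
    filter_upwards [(hε.trans_tendsto hτ2).eventually hb,
      (hy.trans_tendsto hτ2).abs.eventually (gt_mem_nhds (show |(0 : ℝ)| < δ / 2 by simpa)),
      hτ.abs.eventually (gt_mem_nhds (show |(0 : ℝ)| < δ / 2 by simpa))] with i h1 h2 h3
    simpa using taylor h1 h2 h3
  have t2 : (fun i => pdy (pdy (F.globalY 0)) (0, F.yMinus + τ i) -
      pdy (pdy (F.globalY 0)) (0, F.yMinus)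
        - τ i * pdy (pdy (pdy (F.globalY 0))) (0, F.yMinus)) =O[l] fun i => τ i ^ 2 := by
    refine IsBigO.of_bound C ?_
    filter_upwards [hτ.abs.eventually (gt_mem_nhds (show |(0 : ℝ)| < δ / 2 by simpa))] with i h3
    simpa using taylor hb.self_of_nhds (y := F.yMinus) (by simpa) h3
  -- The two difference quotients with step `τ` have numerators differing by `O(τ²)`; division by
  -- `τ` leaves the announced `O(τ)`.
  have hmul : (fun i => τ i * (pdy (pdy (pdy (F.globalY (ε i)))) (0, y i) -
      pdy (pdy (pdy (F.globalY 0))) (0, F.yMinus))) =O[l] fun i => τ i ^ 2 := by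
    refine (((d1'.sub d2).sub t1).add t2).congr_left fun i => ?_
    simp only [Function.comp_def]
    ring
  have := (isBigO_refl (fun i => (τ i)⁻¹) l).mul hmul
  refine this.congr' ?_ ?_
  · filter_upwards [hτ₀] with i hi
    field_simp
  · filter_upwards [hτ₀] with i hi
    field_simp

end Coefficients

/-- Weighted Taylor expansion of the global map at the inflection point of the image of the
unstable manifold. -/
theorem exists_taylor_globalMap {N : ℕ} (hN : 3 ≤ N) (hNr : (N : ℕ∞) ≤ r) :
    ∃ δ : ℝ, 0 < δ ∧ ∀ {ι : Type} {l : Filter ι} {ε : ι → ℝ × ℝ} {y : ι → ℝ},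
      Tendsto (fun i => (ε i, y i)) l (𝓝 (0, F.yMinus)) →
      (∀ᶠ i in l, pdy (pdy (F.globalY (ε i))) (0, y i) = 0) →
      (∀ᶠ i in l, ∀ w ∈ Metric.ball (0 : ℝ × ℝ) δ, w + (0, y i) ∈ F.PiMinus) ∧
      ∃ TX TY : ι → ℝ × ℝ → ℝ,
        (∀ i w, F.globalX (ε i) (w + (0, y i)) = cuspPoly (F.globalX (ε i) (0, y i))
          (pdy (F.globalX (ε i)) (0, y i)) 0 0 0 w + TX i w) ∧
        (∀ i w, F.globalY (ε i) (w + (0, y i)) = cuspPoly (F.globalY (ε i) (0, y i))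
          (pdy (F.globalY (ε i)) (0, y i)) (pdx (F.globalY (ε i)) (0, y i))
          (pdx (pdy (F.globalY (ε i))) (0, y i))
          (pdy (pdy (pdy (F.globalY (ε i)))) (0, y i) / 6) w + TY i w) ∧
        CnBigO N (Metric.ball (0 : ℝ × ℝ) δ) l TX (fun _ => 1) ∧
        CnBigO N (Metric.ball (0 : ℝ × ℝ) δ) l TY (fun _ => 1) ∧
        (∀ᶠ i in l, WeightedFlat 2 (TX i)) ∧ ∀ᶠ i in l, WeightedFlat 4 (TY i) := by
  obtain ⟨δ, C, hδ, hC, hsub, hb⟩ := F.exists_uniform_cnBound hNr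
  -- The other half of the radius accommodates the translation from `y⁻` to the moving base point.
  refine ⟨δ / 2, by linarith, ?_⟩
  intro ι l ε y hlim hinf
  have hε : Tendsto ε l (𝓝 0) := (continuous_fst.tendsto _).comp hlim
  have hy : Tendsto y l (𝓝 F.yMinus) := (continuous_snd.tendsto _).comp hlim
  have ho : IsOpen (Metric.ball ((0 : ℝ), F.yMinus) δ) := Metric.isOpen_ball
  have ho' : IsOpen (Metric.ball (0 : ℝ × ℝ) (δ / 2)) := Metric.isOpen_ball
  have h0m : (0 : ℝ × ℝ) ∈ Metric.ball (0 : ℝ × ℝ) (δ / 2) := Metric.mem_ball_self (by linarith)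
  have hmaps : ∀ᶠ i in l, MapsTo (fun w => w + ((0 : ℝ), y i)) (Metric.ball (0 : ℝ × ℝ) (δ / 2))
      (Metric.ball ((0 : ℝ), F.yMinus) δ) := by
    filter_upwards [hy.eventually (Metric.ball_mem_nhds _ (half_pos hδ))] with i hi w hw
    change ‖y i - F.yMinus‖ < δ / 2 at hi
    rw [mem_ball_zero_iff] at hw
    rw [mem_ball_iff_norm]
    change ‖w + ((0 : ℝ), y i) - (0, F.yMinus)‖ < δ
    have h1 : ‖((0 : ℝ), y i - F.yMinus)‖ < δ / 2 := by
      rw [Prod.norm_def]; exact max_lt (by simpa using hδ) hi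
    have h2 : w + ((0 : ℝ), y i) - (0, F.yMinus) = w + ((0 : ℝ), y i - F.yMinus) := by
      ext <;> simp [add_sub_assoc]
    rw [h2]
    linarith [norm_add_le w ((0 : ℝ), y i - F.yMinus)]
  have hbX : ∀ᶠ i in l, CnBound N (Metric.ball (0 : ℝ × ℝ) (δ / 2))
      (fun w => F.globalX (ε i) (w + (0, y i))) C := by
    filter_upwards [hε.eventually hb, hmaps] with i h1 h2
    exact (h1.fst ho hC).comp_add h2
  have hbY : ∀ᶠ i in l, CnBound N (Metric.ball (0 : ℝ × ℝ) (δ / 2))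
      (fun w => F.globalY (ε i) (w + (0, y i))) C := by
    filter_upwards [hε.eventually hb, hmaps] with i h1 h2
    exact (h1.snd ho hC).comp_add h2
  obtain ⟨N, rfl⟩ : ∃ m, N = m + 3 := ⟨N - 3, by omega⟩
  have poly : ∀ {a₀ a₁ a₂ a₃ a₄ : ι → ℝ}, (∀ᶠ i in l, |a₀ i| ≤ C) → (∀ᶠ i in l, |a₁ i| ≤ C) →
      (∀ᶠ i in l, |a₂ i| ≤ C) → (∀ᶠ i in l, |a₃ i| ≤ C) → (∀ᶠ i in l, |a₄ i| ≤ C) →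
      CnBigO (N + 3) (Metric.ball (0 : ℝ × ℝ) (δ / 2)) l
        (fun i => cuspPoly (a₀ i) (a₁ i) (a₂ i) (a₃ i) (a₄ i)) (fun _ => 1) := by
    intro a₀ a₁ a₂ a₃ a₄ h0 h1 h2 h3 h4
    have bd : ∀ {a : ι → ℝ}, (∀ᶠ i in l, |a i| ≤ C) → a =O[l] fun _ => (1 : ℝ) := fun h =>
      IsBigO.of_bound C (h.mono fun i hi => by simpa using hi)
    exact cnBigO_id.cuspPoly ho' (bd h0) (bd h1) (bd h2) (bd h3) (bd h4)
  have hz : ∀ᶠ i in l, |(0 : ℝ)| ≤ C := Eventually.of_forall fun _ => by simpa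
  refine ⟨hmaps.mono fun i hi w hw => hsub (hi hw), fun i w => F.globalX (ε i) (w + (0, y i)) -
    cuspPoly (F.globalX (ε i) (0, y i)) (pdy (F.globalX (ε i)) (0, y i)) 0 0 0 w,
    fun i w => F.globalY (ε i) (w + (0, y i)) - cuspPoly (F.globalY (ε i) (0, y i))
          (pdy (F.globalY (ε i)) (0, y i)) (pdx (F.globalY (ε i)) (0, y i))
          (pdx (pdy (F.globalY (ε i))) (0, y i))
          (pdy (pdy (pdy (F.globalY (ε i)))) (0, y i) / 6) w, fun _ _ => by ring,
    fun _ _ => by ring, ?_, ?_, ?_, ?_⟩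
  · refine CnBigO.sub ⟨C, hC, hbX.mono fun i hi => by simpa using hi⟩ (poly ?_ ?_ hz hz hz) ho'
    · filter_upwards [hbX] with i hi
      simpa using hi.norm_le h0m
    · filter_upwards [hbX] with i hi
      simpa [pdy_comp_add] using (hi.pdy (n := N + 2) ho' hC).norm_le h0m
  · refine CnBigO.sub ⟨C, hC, hbY.mono fun i hi => by simpa using hi⟩ (poly ?_ ?_ ?_ ?_ ?_) ho'
    · filter_upwards [hbY] with i hi
      simpa using hi.norm_le h0m
    · filter_upwards [hbY] with i hi
      simpa [pdy_comp_add] using (hi.pdy (n := N + 2) ho' hC).norm_le h0m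
    · filter_upwards [hbY] with i hi
      simpa [pdx_comp_add] using (hi.pdx (n := N + 2) ho' hC).norm_le h0m
    · filter_upwards [hbY] with i hi
      simpa [pdx_comp_add, pdy_comp_add] using
        ((hi.pdy (n := N + 2) ho' hC).pdx (n := N + 1) ho' hC).norm_le h0m
    · filter_upwards [hbY] with i hi
      have h : |pdy (pdy (pdy (F.globalY (ε i)))) (0, y i)| ≤ C := by
        simpa [pdy_comp_add] using
          (((hi.pdy (n := N + 2) ho' hC).pdy (n := N + 1) ho' hC).pdy (n := N) ho' hC).norm_le h0m
      rw [abs_div, abs_of_pos (show (0 : ℝ) < 6 by norm_num)]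
      linarith
  · filter_upwards [hbX] with i hi
    simpa [pdy_comp_add] using weightedFlat_two_sub_cuspPoly
      ((hi.contDiffAt ho' h0m).of_le (by exact_mod_cast (by omega : 1 ≤ N + 3)))
  · filter_upwards [hbY, hinf] with i hi h2
    simpa [pdx_comp_add, pdy_comp_add] using weightedFlat_four_sub_cuspPoly
      ((hi.contDiffAt ho' h0m).of_le (by exact_mod_cast (by omega : 3 ≤ N + 3)))
      (by simpa [pdy_comp_add] using h2)

end CubicTangencyFamily

/-! ### Splitting parameters of the family and identities at the tangency. -/

namespace CubicTangencyFamily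

open Asymptotics

variable {r : ℕ∞} {M : Type*} [TopologicalSpace M] [ChartedSpace (ℝ × ℝ) M]
  [IsManifold 𝓘(ℝ, ℝ × ℝ) (r : WithTop ℕ∞) M] {Ω : SymplecticForm r M}
  (F : CubicTangencyFamily r M Ω)

theorem iteratedDeriv_unstableHeight {n : ℕ} (hn : (n : ℕ∞) ≤ r) {ε : ℝ × ℝ} (hε : ε ∈ F.V) {y : ℝ}
    (hy : ((0 : ℝ), y) ∈ F.PiMinus) :
    iteratedDeriv n (F.unstableHeight ε) y = pdy^[n] (F.globalY ε) (0, y) :=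
  iteratedDeriv_slice_eq_dsnd (h := F.globalY ε) F.isOpen_PiMinus
    ((contDiff_snd.comp_contDiffOn (F.contDiffOn_globalMap hε)).of_le (by exact_mod_cast hn)) hy

/-- The set of parameters and points of the unstable axis at which the global map is defined. -/
def heightDomain : Set ((ℝ × ℝ) × ℝ) := {p | (p.1, ((0 : ℝ), p.2)) ∈ F.V ×ˢ F.PiMinus}

theorem isOpen_heightDomain : IsOpen F.heightDomain :=
  (F.isOpen_V.prod F.isOpen_PiMinus).preimage (by fun_prop)

theorem contDiffOn_height (hr : 5 ≤ r) :
    ContDiffOn ℝ 3 (fun p : (ℝ × ℝ) × ℝ => F.unstableHeight p.1 p.2) F.heightDomain :=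
  (F.contDiffOn_joint_globalY hr).comp (f := fun p : (ℝ × ℝ) × ℝ => (p.1, ((0 : ℝ), p.2)))
    (by fun_prop) fun _ h => h

theorem dsnd_height (hr : 5 ≤ r) {n : ℕ} (hn : n ≤ 3) {ε : ℝ × ℝ} {y : ℝ}
    (h : (ε, y) ∈ F.heightDomain) :
    dsnd^[n] (fun p : (ℝ × ℝ) × ℝ => F.unstableHeight p.1 p.2) (ε, y)
      = pdy^[n] (F.globalY ε) (0, y) := by
  have hn3 : (n : ℕ∞) ≤ 3 := by exact_mod_cast hn
  rw [← F.iteratedDeriv_unstableHeight ((hn3.trans (by norm_num)).trans hr) h.1 h.2]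
  exact (iteratedDeriv_slice_eq_dsnd (h := fun p : (ℝ × ℝ) × ℝ => F.unstableHeight p.1 p.2)
    F.isOpen_heightDomain ((F.contDiffOn_height hr).of_le (by exact_mod_cast hn)) h).symm

theorem base_mem_heightDomain : ((0 : ℝ × ℝ), F.yMinus) ∈ F.heightDomain :=
  ⟨F.zero_mem_V, F.mem_PiMinus⟩

theorem globalX_base : F.globalX 0 (0, F.yMinus) = F.xPlus := congrArg Prod.fst F.homoclinic

theorem globalY_base : F.globalY 0 (0, F.yMinus) = 0 := congrArg Prod.snd F.homoclinic

theorem pdy_globalY_base (hr : 5 ≤ r) : pdy (F.globalY 0) (0, F.yMinus) = 0 := by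
  have h := F.iteratedDeriv_unstableHeight (n := 1) (le_trans (by norm_num) hr) F.zero_mem_V
    F.mem_PiMinus
  rw [iteratedDeriv_one] at h
  exact h.symm.trans F.tangency.1

theorem pdy_pdy_globalY_base (hr : 5 ≤ r) : pdy (pdy (F.globalY 0)) (0, F.yMinus) = 0 :=
  (F.iteratedDeriv_unstableHeight (n := 2) (le_trans (by norm_num) hr) F.zero_mem_V
    F.mem_PiMinus).symm.trans F.tangency.2.1

theorem d_eq (hr : 5 ≤ r) : F.d = pdy (pdy (pdy (F.globalY 0))) (0, F.yMinus) / 6 :=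
  congrArg (· / 6) (F.iteratedDeriv_unstableHeight (n := 3) (le_trans (by norm_num) hr)
    F.zero_mem_V F.mem_PiMinus)

theorem d_ne_zero : F.d ≠ 0 := div_ne_zero F.tangency.2.2 (by norm_num)

theorem contDiffAt_globalY {n : ℕ} (hn : (n : ℕ∞) ≤ r) {ε z : ℝ × ℝ} (hε : ε ∈ F.V)
    (hz : z ∈ F.PiMinus) : ContDiffAt ℝ n (F.globalY ε) z :=
  (contDiff_snd.comp_contDiffOn (F.contDiffOn_globalMap hε)).contDiffAt
    (F.isOpen_PiMinus.mem_nhds hz) |>.of_le (by exact_mod_cast hn)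

theorem c_eq (hr : 5 ≤ r) : F.c = pdx (F.globalY 0) (0, F.yMinus) :=
  (hasDerivAt_pdx ((F.contDiffAt_globalY (n := 1) (le_trans (by norm_num) hr) F.zero_mem_V
    F.mem_PiMinus).differentiableAt (by simp))).deriv

theorem f11_eq (hr : 5 ≤ r) : F.f11 = pdx (pdy (F.globalY 0)) (0, F.yMinus) := by
  have h2 := F.contDiffAt_globalY (n := 2) (le_trans (by norm_num) hr) F.zero_mem_V F.mem_PiMinus
  rw [pdx_pdy_comm h2]
  have he : (fun y => deriv (fun x => (F.globalMap 0 (x, y)).2) 0) =ᶠ[𝓝 F.yMinus]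
      fun y => pdx (F.globalY 0) (0, y) := by
    have hc : Continuous fun y : ℝ => ((0 : ℝ), y) := by fun_prop
    filter_upwards [hc.continuousAt.eventually (F.isOpen_PiMinus.mem_nhds F.mem_PiMinus)] with y hy
    exact (hasDerivAt_pdx ((F.contDiffAt_globalY (n := 1) (le_trans (by norm_num) hr) F.zero_mem_V
      hy).differentiableAt (by simp))).deriv
  exact he.deriv_eq.trans (hasDerivAt_pdy ((h2.pdx (j := 1)).differentiableAt (by simp))).deriv

/-- The coefficient `F_y` at the homoclinic point, `ε = 0`. -/
noncomputable def b : ℝ := pdy (F.globalX 0) (0, F.yMinus)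

/-- At the tangency `G_y = 0`, so the unit Jacobian reduces to `-F_y G_x`. This relation is
responsible for the unit Jacobian of the limiting Hénon map. -/
theorem b_mul_c (hr : 5 ≤ r) : F.b * F.c = -1 := by
  rw [F.c_eq hr]
  exact F.pdy_mul_pdx_globalMap hr (F.pdy_globalY_base hr)

theorem b_ne_zero (hr : 5 ≤ r) : F.b ≠ 0 := fun h => by simpa [h] using F.b_mul_c hr

/-- Besides the coordinates themselves, the quadratic closeness of their inverse to a linear map `D`
is retained: it makes `λ(ε)` a linear function of `μ` up to `O(‖μ‖²)`. -/
theorem exists_isSplitting (hr : 5 ≤ r) :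
    ∃ (e : OpenPartialHomeomorph (ℝ × ℝ) (ℝ × ℝ)) (yI : ℝ × ℝ → ℝ)
      (D : (ℝ × ℝ) →L[ℝ] ℝ × ℝ), F.IsSplitting e ∧ e 0 = 0 ∧ 0 ∈ e.source ∧ e.source ⊆ F.V ∧
      (∀ ε ∈ e.source, ((0 : ℝ), yI ε) ∈ F.PiMinus ∧ pdy (pdy (F.globalY ε)) (0, yI ε) = 0 ∧
        e ε = (F.globalY ε (0, yI ε), pdy (F.globalY ε) (0, yI ε))) ∧
      ((fun ε => yI ε - F.yMinus) =O[𝓝 0] fun ε => ‖ε‖) ∧ (e.symm =O[𝓝 0] fun μ => ‖μ‖) ∧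
      (fun μ => e.symm μ - D μ) =O[𝓝 0] fun μ => ‖μ‖ ^ 2 := by
  set h : (ℝ × ℝ) × ℝ → ℝ := fun p => F.unstableHeight p.1 p.2 with hh
  have hn : ∀ {n : ℕ}, n ≤ 3 → ∀ {ε : ℝ × ℝ} {y : ℝ}, (ε, y) ∈ F.heightDomain →
      dsnd^[n] h (ε, y) = pdy^[n] (F.globalY ε) (0, y) := fun hn _ _ => F.dsnd_height hr hn
  have hd1 : ContDiffOn ℝ 2 (dsnd h) F.heightDomain :=
    ContDiffOn.dsnd (n := 2) F.isOpen_heightDomain (F.contDiffOn_height hr)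
  have hnhds := F.isOpen_heightDomain.mem_nhds F.base_mem_heightDomain
  set Ψ := fun ε : ℝ × ℝ => ((inCoords (F.coords ε) ((F.f ε)^[F.q]) (0, F.yMinus)).2,
      deriv (fun y => (inCoords (F.coords ε) ((F.f ε)^[F.q]) (0, y)).2) F.yMinus) with hΨ
  have hc : Continuous fun ε : ℝ × ℝ => (ε, F.yMinus) := by fun_prop
  have hev : (fun ε => (h (ε, F.yMinus), dsnd h (ε, F.yMinus))) =ᶠ[𝓝 0] Ψ := by
    filter_upwards [hc.continuousAt.eventually hnhds] with ε hε
    refine Prod.ext rfl ?_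
    refine ((hn (n := 1) (by norm_num) hε).trans
      (F.iteratedDeriv_unstableHeight (n := 1) (le_trans (by norm_num) hr) hε.1 hε.2).symm).trans ?_
    rw [iteratedDeriv_one]
    rfl
  have hdiff : DifferentiableAt ℝ (fun ε => (h (ε, F.yMinus), dsnd h (ε, F.yMinus))) 0 := by
    have hc' : DifferentiableAt ℝ (fun ε : ℝ × ℝ => (ε, F.yMinus)) 0 := by fun_prop
    exact DifferentiableAt.prodMk
      (DifferentiableAt.comp (g := h) (f := fun ε : ℝ × ℝ => (ε, F.yMinus)) (0 : ℝ × ℝ)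
        (((F.contDiffOn_height hr).contDiffAt hnhds).differentiableAt (by simp)) hc')
      (DifferentiableAt.comp (g := dsnd h) (f := fun ε : ℝ × ℝ => (ε, F.yMinus)) (0 : ℝ × ℝ)
        ((hd1.contDiffAt hnhds).differentiableAt (by simp)) hc')
  set D : (ℝ × ℝ) ≃L[ℝ] ℝ × ℝ :=
    (LinearEquiv.ofBijective (fderiv ℝ Ψ 0 : (ℝ × ℝ) →ₗ[ℝ] ℝ × ℝ)
      F.transverse).toContinuousLinearEquiv
  have hD : HasFDerivAt (fun ε => (h (ε, F.yMinus), dsnd h (ε, F.yMinus)))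
      (D : (ℝ × ℝ) →L[ℝ] ℝ × ℝ) 0 := by
    have : (D : (ℝ × ℝ) →L[ℝ] ℝ × ℝ) = fderiv ℝ Ψ 0 := by ext <;> rfl
    rw [this, ← hev.fderiv_eq]
    exact hdiff.hasFDerivAt
  have hbase : ∀ {n : ℕ}, n ≤ 3 → dsnd^[n] h (0, F.yMinus) = pdy^[n] (F.globalY 0) (0, F.yMinus) :=
    fun h3 => hn h3 F.base_mem_heightDomain
  have h3 : dsnd (dsnd (dsnd h)) (0, F.yMinus) ≠ 0 := by
    have := F.d_ne_zero
    rw [F.d_eq hr] at this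
    refine fun h0 => this ?_
    rw [show pdy (pdy (pdy (F.globalY 0))) (0, F.yMinus) = 0 from (hbase (n := 3) le_rfl).symm.trans
      h0, zero_div]
  obtain ⟨e, yI, h0, he, he', hyI, hyI0, hspec, hy, hO, hO2⟩ :=
    exists_splitting_coordinates F.isOpen_heightDomain (F.contDiffOn_height hr)
      F.base_mem_heightDomain F.globalY_base
      ((hbase (n := 1) (by norm_num)).trans (F.pdy_globalY_base hr))
      ((hbase (n := 2) (by norm_num)).trans (F.pdy_pdy_globalY_base hr)) h3 hD
  have hspec' : ∀ ε ∈ e.source, (ε, yI ε) ∈ F.heightDomain ∧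
      pdy (pdy (F.globalY ε)) (0, yI ε) = 0 ∧
      e ε = (F.globalY ε (0, yI ε), pdy (F.globalY ε) (0, yI ε)) := by
    intro ε hε
    obtain ⟨h1, h2, h4⟩ := hspec ε hε
    refine ⟨h1, (hn (n := 2) (by norm_num) h1).symm.trans h2, h4.trans ?_⟩
    exact Prod.ext rfl (hn (n := 1) (by norm_num) h1)
  have hsV : e.source ⊆ F.V := fun ε hε => (hspec' ε hε).1.1
  refine ⟨e, yI, D.symm, ⟨h0, hsV, he, he', yI, hyI, hyI0, fun ε hε => ?_⟩, ?_, h0, hsV,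
    fun ε hε => ⟨(hspec' ε hε).1.2, (hspec' ε hε).2⟩, hy, hO, hO2⟩
  · obtain ⟨h1, h2, h4⟩ := hspec' ε hε
    refine ⟨h1.2, (F.iteratedDeriv_unstableHeight (n := 2) (le_trans (by norm_num) hr) h1.1
      h1.2).trans h2, h4.trans (Prod.ext rfl ?_)⟩
    have := F.iteratedDeriv_unstableHeight (n := 1) (le_trans (by norm_num) hr) h1.1 h1.2
    rw [iteratedDeriv_one] at this
    exact this.symm
  · rw [(hspec' 0 h0).2.2, hyI0, F.globalY_base, F.pdy_globalY_base hr]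
    rfl

end CubicTangencyFamily

/-! ### Triangular affine changes of variables. -/

/-- The real number `t`, replaced by `1` if it vanishes. -/
noncomputable def orOne (t : ℝ) : ℝ := if t = 0 then 1 else t

theorem orOne_ne_zero (t : ℝ) : orOne t ≠ 0 := by
  unfold orOne; split_ifs with h <;> simp [h]

theorem orOne_of_ne_zero {t : ℝ} (h : t ≠ 0) : orOne t = t := if_neg h

/-- The affine map `z ↦ (p x + t y + a₁, q y + a₂)`, with `p` or `q` replaced by `1` if it
vanishes. -/
noncomputable def triangularAffine (p q t : ℝ) (a : ℝ × ℝ) : (ℝ × ℝ) ≃ᵃ[ℝ] (ℝ × ℝ) :=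
  LinearEquiv.toAffineEquiv
    { toFun := fun z => (orOne p * z.1 + t * z.2, orOne q * z.2)
      map_add' := fun z w => by ext <;> simp <;> ring
      map_smul' := fun c z => by ext <;> simp <;> ring
      invFun := fun w => ((w.1 - t * (w.2 / orOne q)) / orOne p, w.2 / orOne q)
      left_inv := fun z => by
        have := orOne_ne_zero p
        have := orOne_ne_zero q
        ext <;> simp <;> field_simp
        ring
      right_inv := fun w => by
        have := orOne_ne_zero p
        have := orOne_ne_zero q
        ext <;> simp <;> field_simp <;> ring }
  |>.trans (AffineEquiv.constVAdd ℝ (ℝ × ℝ) a)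

theorem triangularAffine_apply {p q : ℝ} (hp : p ≠ 0) (hq : q ≠ 0) (t : ℝ) (a z : ℝ × ℝ) :
    triangularAffine p q t a z = (a.1 + (p * z.1 + t * z.2), a.2 + q * z.2) := by
  rw [← orOne_of_ne_zero hp, ← orOne_of_ne_zero hq]
  simp only [triangularAffine, orOne_of_ne_zero (orOne_ne_zero _)]
  rfl

theorem triangularAffine_symm_apply {p q : ℝ} (hp : p ≠ 0) (hq : q ≠ 0) (a w : ℝ × ℝ) :
    (triangularAffine p q 0 a).symm w = ((w.1 - a.1) / p, (w.2 - a.2) / q) := by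
  rw [AffineEquiv.symm_apply_eq, triangularAffine_apply hp hq]
  ext <;> simp <;> field_simp <;> ring

/-! ### The scale `s`, the renormalized parameters and the renormalized coordinates. -/

namespace CubicTangencyFamily

open Asymptotics

variable {r : ℕ∞} {M : Type*} [TopologicalSpace M] [ChartedSpace (ℝ × ℝ) M]
  [IsManifold 𝓘(ℝ, ℝ × ℝ) (r : WithTop ℕ∞) M] {Ω : SymplecticForm r M}
  (F : CubicTangencyFamily r M Ω)

/-- The scale `√(|λᵏ / d|)` of the first return map. -/
noncomputable def scale (k : ℕ) : ℝ := |F.lam0| ^ ((k : ℝ) / 2) / √|F.d|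

theorem scale_pos (k : ℕ) : 0 < F.scale k :=
  div_pos (Real.rpow_pos_of_pos (abs_pos.2 F.lam0_ne_zero) _)
    (Real.sqrt_pos.2 (abs_pos.2 F.d_ne_zero))

theorem scale_sq (k : ℕ) : F.scale k ^ 2 = |F.lam0| ^ k / |F.d| := by
  rw [scale, div_pow, Real.sq_sqrt (abs_nonneg _), ← Real.rpow_natCast (_ ^ _),
    ← Real.rpow_mul (abs_nonneg _)]
  congr 1
  rw [← Real.rpow_natCast]
  congr 1
  push_cast
  ring

theorem abs_d_mul_scale_sq (k : ℕ) : |F.d| * F.scale k ^ 2 = |F.lam0| ^ k := by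
  rw [scale_sq]
  have := abs_pos.2 F.d_ne_zero
  field_simp

theorem inv_scale (k : ℕ) : (F.scale k)⁻¹ = √|F.d| * |F.lam0| ^ (-((k : ℝ) / 2)) := by
  rw [scale, inv_div, Real.rpow_neg (abs_nonneg _), div_eq_mul_inv]

section Scale

variable {ι : Type*} {l : Filter ι} {k : ι → ℕ}

theorem isBigO_scale_sq : (fun i => |F.lam0| ^ k i) =O[l] fun i => F.scale (k i) ^ 2 := by
  refine ((isBigO_refl (fun i => F.scale (k i) ^ 2) l).const_mul_left |F.d|).congr_left fun i => ?_
  exact F.abs_d_mul_scale_sq _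

theorem scale_sq_isBigO : (fun i => F.scale (k i) ^ 2) =O[l] fun i => |F.lam0| ^ k i := by
  refine ((isBigO_refl (fun i => |F.lam0| ^ k i) l).const_mul_left |F.d|⁻¹).congr_left fun i => ?_
  rw [F.scale_sq, div_eq_inv_mul]

/-- As `s²` is proportional to `|λ|ᵏ`, this is the square root of the limit for `k²ʲ|λ|ᵏ`; it lets
any power of `k` be absorbed by one factor of the scale. -/
theorem tendsto_pow_mul_scale (hk : Tendsto k l atTop) (j : ℕ) :
    Tendsto (fun i => (k i : ℝ) ^ j * F.scale (k i)) l (𝓝 0) := by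
  have h := ((F.tendsto_pow_mul_abs_lam0_pow hk (2 * j)).const_mul |F.d|⁻¹).sqrt
  rw [mul_zero, Real.sqrt_zero] at h
  refine h.congr fun i => ?_
  rw [← Real.sqrt_sq (mul_nonneg (pow_nonneg (Nat.cast_nonneg (k i)) j) (F.scale_pos (k i)).le)]
  congr 1
  rw [mul_pow, F.scale_sq]
  ring

theorem tendsto_scale (hk : Tendsto k l atTop) :
    Tendsto (fun i => F.scale (k i)) l (𝓝 0) := by
  simpa using F.tendsto_pow_mul_scale hk 0

theorem isBigO_mul_scale (hk : Tendsto k l atTop) :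
    (fun i => (k i : ℝ) * |F.lam0| ^ k i) =O[l] fun i => F.scale (k i) := by
  have h := ((F.tendsto_pow_mul_scale hk 1).isBigO_one ℝ).mul
    (isBigO_refl (fun i => F.scale (k i)) l)
  refine ((h.const_mul_left |F.d|).congr_left fun i => ?_).trans (by simpa using isBigO_refl _ l)
  rw [← F.abs_d_mul_scale_sq]; ring

theorem pow_isBigO_scale (hk : Tendsto k l atTop) :
    (fun i => |F.lam0| ^ k i) =O[l] fun i => F.scale (k i) := by
  have h := ((F.tendsto_scale hk).isBigO_one ℝ).mul (isBigO_refl (fun i => F.scale (k i)) l)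
  refine ((h.const_mul_left |F.d|).congr_left fun i => ?_).trans (by simpa using isBigO_refl _ l)
  rw [← F.abs_d_mul_scale_sq]; ring

theorem mul_scale_isBigO (hk : Tendsto k l atTop) :
    (fun i => (k i : ℝ) * |F.lam0| ^ k i * F.scale (k i)) =O[l] fun i => |F.lam0| ^ k i := by
  have h := ((F.tendsto_pow_mul_scale hk 1).isBigO_one ℝ).mul
    (isBigO_refl (fun i => |F.lam0| ^ k i) l)
  refine (h.congr_left fun i => ?_).trans (by simpa using isBigO_refl _ l)
  ring

end Scale

/-- The height of the image of the strip relative to its width, `c x⁺ - y⁻`. -/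
noncomputable def kappa : ℝ := F.c * F.xPlus - F.yMinus

/-- The derivative of `log |λ|` along the direction of the parameter plane whose image under the
splitting of the tangency is `μ`, where `D` is the inverse of that splitting. -/
noncomputable def logDeriv (D : (ℝ × ℝ) →L[ℝ] ℝ × ℝ) : (ℝ × ℝ) →L[ℝ] ℝ :=
  F.lam0⁻¹ • (fderiv ℝ F.lam 0).comp D

/-- Chain rule with quadratic errors: that of `λ` at zero and that of the parametrization by `μ`. -/
theorem isBigO_lam_div_sub_logDeriv (hr : 5 ≤ r) {e : ℝ × ℝ → ℝ × ℝ} {D : (ℝ × ℝ) →L[ℝ] ℝ × ℝ}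
    (he : e =O[𝓝 0] fun μ => ‖μ‖) (heD : (fun μ => e μ - D μ) =O[𝓝 0] fun μ => ‖μ‖ ^ 2) :
    (fun μ => F.lam (e μ) / F.lam0 - 1 - F.logDeriv D μ) =O[𝓝 0] fun μ => ‖μ‖ ^ 2 := by
  have h0 : Tendsto e (𝓝 0) (𝓝 0) := he.trans_tendsto (by simpa using tendsto_norm_zero)
  have h1 := (((F.contDiffAt_lam hr).of_le (by norm_num)).isBigO_sub_sub_fderiv).comp_tendsto h0
  simp only [Function.comp_def, sub_zero] at h1
  have h2 : (fun μ => ‖e μ‖ ^ 2) =O[𝓝 0] fun μ => ‖μ‖ ^ 2 := he.norm_left.pow 2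
  have h3 := ((fderiv ℝ F.lam 0).isBigO_comp (fun μ => e μ - D μ) (𝓝 0)).trans heD
  refine (((h1.trans h2).add h3).const_mul_left F.lam0⁻¹).congr_left fun μ => ?_
  have := F.lam0_ne_zero
  simp only [map_sub, logDeriv, smul_apply, ContinuousLinearMap.comp_apply,
    smul_eq_mul]
  change F.lam0⁻¹ * (F.lam (e μ) - F.lam0 - _ + _) = _
  field_simp
  ring

/-- The correction of the splitting parameter `μ₁` in the renormalized parameter `M₁`. -/
noncomputable def correction (D : (ℝ × ℝ) →L[ℝ] ℝ × ℝ) (k : ℕ) (μ : ℝ × ℝ) : ℝ :=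
  k * F.lam0 ^ k * F.kappa * (F.logDeriv D μ + F.lam0 ^ k * (F.beta 0 * F.xPlus * F.yMinus))

/-- The renormalization of the splitting parameters. -/
noncomputable def paramChange (D : (ℝ × ℝ) →L[ℝ] ℝ × ℝ) (k : ℕ) : (ℝ × ℝ) ≃ᵃ[ℝ] (ℝ × ℝ) :=
  triangularAffine
    ((F.lam0 ^ k * F.scale k)⁻¹ * (1 + k * F.lam0 ^ k * F.kappa * F.logDeriv D (1, 0)))
    (F.lam0 ^ k)⁻¹
    ((F.lam0 ^ k * F.scale k)⁻¹ * (k * F.lam0 ^ k * F.kappa * F.logDeriv D (0, 1)))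
    ((F.lam0 ^ k * F.scale k)⁻¹ * (F.lam0 ^ k * F.kappa +
      k * F.lam0 ^ k * F.kappa * (F.lam0 ^ k * (F.beta 0 * F.xPlus * F.yMinus))),
      F.f11 * F.xPlus)

/-- The correction is affine in `μ`, so adding it to `μ₁` only changes the entries of a triangular
matrix and a translation. The diagonal entry can vanish only for finitely many `k`, where the
definition substitutes an irrelevant value to remain invertible. -/
theorem paramChange_apply {D : (ℝ × ℝ) →L[ℝ] ℝ × ℝ} {k : ℕ}
    (h : 1 + k * F.lam0 ^ k * F.kappa * F.logDeriv D (1, 0) ≠ 0) (μ : ℝ × ℝ) :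
    F.paramChange D k μ = ((F.lam0 ^ k * F.scale k)⁻¹ *
      (μ.1 + F.lam0 ^ k * F.kappa + F.correction D k μ),
      (F.lam0 ^ k)⁻¹ * μ.2 + F.f11 * F.xPlus) := by
  have h1 : F.lam0 ^ k ≠ 0 := pow_ne_zero _ F.lam0_ne_zero
  have h2 := (F.scale_pos k).ne'
  have h3 : F.logDeriv D μ = μ.1 * F.logDeriv D (1, 0) + μ.2 * F.logDeriv D (0, 1) := by
    rw [← smul_eq_mul, ← smul_eq_mul, ← map_smul, ← map_smul, ← map_add]
    congr 1
    ext <;> simp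
  rw [paramChange, triangularAffine_apply (mul_ne_zero (inv_ne_zero (mul_ne_zero h1 h2)) h)
    (inv_ne_zero h1), correction, h3]
  ext
  · simp only; ring
  · simp only; ring

/-- The renormalization of the coordinates, for a given position `yI` of the inflection point. -/
noncomputable def coordChange (yI : ℝ × ℝ → ℝ) (k : ℕ) (ε : ℝ × ℝ) : (ℝ × ℝ) ≃ᵃ[ℝ] (ℝ × ℝ) :=
  triangularAffine (F.b * F.scale k) (F.lam ε ^ k * F.scale k) 0
    -- The origin is the image of the inflection point in `x`, and in `y` it anticipates the shift
    -- produced by the passage, so that the orbit of the origin lands near height `y⁻(ε)`.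
    (F.globalX ε (0, yI ε), F.lam ε ^ k * (yI ε -
      ((saddleOrbit (F.localMap ε) (F.lam ε) k k (F.xPlus, F.yMinus)).2 - F.yMinus)))

end CubicTangencyFamily

/-! ### The constant, linear and cubic coefficients of the rescaled map. -/

namespace CubicTangencyFamily

open Asymptotics

variable {r : ℕ∞} {M : Type*} [TopologicalSpace M] [ChartedSpace (ℝ × ℝ) M]
  [IsManifold 𝓘(ℝ, ℝ × ℝ) (r : WithTop ℕ∞) M] {Ω : SymplecticForm r M}
  (F : CubicTangencyFamily r M Ω)

theorem lam0_pow_isBigO {ι : Type*} {l : Filter ι} {k : ι → ℕ} :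
    (fun i => F.lam0 ^ k i) =O[l] fun i => |F.lam0| ^ k i :=
  IsBigO.of_norm_le fun i => by simp

/-- Back substitution in a triangular system: `μ₂ = O(λᵏ)` from the second row, then `μ₁` from the
first, whose diagonal factor `1 + O(kλᵏ)` tends to one. -/
theorem isBigO_paramChange_inv {ι : Type*} {l : Filter ι} {k : ι → ℕ} {m μ : ι → ℝ × ℝ}
    {D : (ℝ × ℝ) →L[ℝ] ℝ × ℝ} (hk : Tendsto k l atTop) (hm : m =O[l] fun _ => (1 : ℝ))
    (h : ∀ i, F.paramChange D (k i) (μ i) = m i) :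
    (μ =O[l] fun i => |F.lam0| ^ k i) ∧ ∀ᶠ i in l,
      (m i).1 = (F.lam0 ^ k i * F.scale (k i))⁻¹ *
        ((μ i).1 + F.lam0 ^ k i * F.kappa + F.correction D (k i) (μ i)) ∧
      (m i).2 = (F.lam0 ^ k i)⁻¹ * (μ i).2 + F.f11 * F.xPlus := by
  have hkL : Tendsto (fun i => (k i : ℝ) * F.lam0 ^ k i) l (𝓝 0) := by
    refine squeeze_zero_norm (fun i => le_of_eq ?_)
      (by simpa using F.tendsto_pow_mul_abs_lam0_pow hk 1)
    simp
  have hX : Tendsto (fun i => 1 + (k i : ℝ) * F.lam0 ^ k i * F.kappa * F.logDeriv D (1, 0)) l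
      (𝓝 1) := by
    simpa using ((hkL.mul_const F.kappa).mul_const (F.logDeriv D (1, 0))).const_add 1
  have hX0 := hX.eventually_ne one_ne_zero
  have hexp := hX0.mono fun i hi => (h i).symm.trans (F.paramChange_apply hi (μ i))
  have hm1 : (fun i => (m i).1) =O[l] fun _ => (1 : ℝ) :=
    (isBigO_fst_prod' (f' := m)).trans hm
  have hm2 : (fun i => (m i).2) =O[l] fun _ => (1 : ℝ) :=
    (isBigO_snd_prod' (f' := m)).trans hm
  have hL := F.lam0_pow_isBigO (l := l) (k := k)
  have bd : ∀ {f g : ι → ℝ}, (f =O[l] fun i => |F.lam0| ^ k i) → (g =O[l] fun _ => (1 : ℝ)) →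
      (fun i => f i * g i) =O[l] fun i => |F.lam0| ^ k i := fun hf hg => by
    simpa using hf.mul hg
  have hμ2 : (fun i => (μ i).2) =O[l] fun i => |F.lam0| ^ k i := by
    refine (bd hL (hm2.sub (isBigO_const_const (F.f11 * F.xPlus) one_ne_zero l))).congr' ?_
      (EventuallyEq.refl _ _)
    filter_upwards [hexp] with i hi
    rw [hi]
    have := pow_ne_zero (k i) F.lam0_ne_zero
    simp only; field_simp; ring
  have hkL1 : (fun i => (k i : ℝ) * F.lam0 ^ k i) =O[l] fun _ => (1 : ℝ) := hkL.isBigO_one ℝ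
  have hμ1 : (fun i => (μ i).1) =O[l] fun i => |F.lam0| ^ k i := by
    have t1 := bd hL (((F.tendsto_scale hk).isBigO_one ℝ).mul hm1 |>.congr_right
      fun _ => one_mul (1 : ℝ))
    have t2 := hL.const_mul_left F.kappa
    have t3 := bd hμ2 (hkL1.const_mul_left (F.kappa * F.logDeriv D (0, 1)))
    have t4 := bd hL (hkL1.const_mul_left (F.kappa * (F.beta 0 * F.xPlus * F.yMinus)))
    refine (bd (((t1.sub t2).sub t3).sub t4) ((hX.inv₀ one_ne_zero).isBigO_one ℝ)).congr' ?_
      (EventuallyEq.refl _ _)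
    filter_upwards [hX0] with i hi
    have := pow_ne_zero (k i) F.lam0_ne_zero
    have := (F.scale_pos (k i)).ne'
    have h3 : F.logDeriv D (μ i) =
        (μ i).1 * F.logDeriv D (1, 0) + (μ i).2 * F.logDeriv D (0, 1) := by
      rw [← smul_eq_mul, ← smul_eq_mul, ← map_smul, ← map_smul, ← map_add]
      congr 1
      ext <;> simp
    have h4 : (m i).1 = _ := congrArg Prod.fst ((h i).symm.trans (F.paramChange_apply hi (μ i)))
    simp only at h4
    rw [h4, correction, h3, ← div_eq_mul_inv, div_eq_iff hi]
    field_simp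
    ring
  exact ⟨hμ1.prod_left hμ2, hexp.mono fun i hi => ⟨congrArg Prod.fst hi, congrArg Prod.snd hi⟩⟩

section Brackets

variable {ι : Type*} {l : Filter ι} {k : ι → ℕ} {m μ ε : ι → ℝ × ℝ} {D : (ℝ × ℝ) →L[ℝ] ℝ × ℝ}

/-- With `q = λ(ε)ᵏ/λ(0)ᵏ → 1` the two expressions are `-(q - 1)/q` and `(q - 1)²/q`, and the square
`k²λ²ᵏ` is absorbed by `λᵏ`. -/
theorem isBigO_inv_lam_pow_sub (hr : 5 ≤ r) (hk : Tendsto k l atTop)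
    (hε : ε =O[l] fun i => |F.lam0| ^ k i) :
    (fun i => F.lam0 ^ k i / F.lam (ε i) ^ k i - 1) =O[l] (fun i => (k i : ℝ) * |F.lam0| ^ k i) ∧
    (fun i => F.lam0 ^ k i / F.lam (ε i) ^ k i - 1 + (F.lam (ε i) ^ k i / F.lam0 ^ k i - 1)) =O[l]
      fun i => |F.lam0| ^ k i := by
  have h1 := F.isBigO_lam_pow_div_sub hk hε hr
  have hlim := F.tendsto_lam_pow_div hk hε hr
  have hinv : (fun i => (F.lam (ε i) ^ k i / F.lam0 ^ k i)⁻¹) =O[l] fun _ => (1 : ℝ) :=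
    (hlim.inv₀ one_ne_zero).isBigO_one ℝ
  have hne := hlim.eventually_ne one_ne_zero
  have hk2 : (fun i => (k i : ℝ) * |F.lam0| ^ k i * ((k i : ℝ) * |F.lam0| ^ k i)) =O[l]
      fun i => |F.lam0| ^ k i := by
    have := (F.isBigO_pow_mul_one hk 2).mul (isBigO_refl (fun i => |F.lam0| ^ k i) l)
    simp only [one_mul] at this
    exact this.congr_left fun i => by ring
  constructor
  · have := (h1.mul hinv).neg_left
    simp only [mul_one] at this
    refine this.congr' ?_ (EventuallyEq.refl _ _)
    filter_upwards [hne] with i hi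
    rw [← inv_div (F.lam (ε i) ^ k i)]
    generalize F.lam (ε i) ^ k i / F.lam0 ^ k i = t at hi ⊢
    field_simp
    ring
  · have := (h1.mul h1).mul hinv
    simp only [mul_one] at this
    refine (this.trans hk2).congr' ?_ (EventuallyEq.refl _ _)
    filter_upwards [hne] with i hi
    rw [← inv_div (F.lam (ε i) ^ k i)]
    generalize F.lam (ε i) ^ k i / F.lam0 ^ k i = t at hi ⊢
    field_simp
    ring

/-- The constant term of the rescaled return map. -/
theorem isBigO_constant_term (hr : 5 ≤ r) (hk : Tendsto k l atTop)
    (hε : ε =O[l] fun i => |F.lam0| ^ k i) (hμ : μ =O[l] fun i => |F.lam0| ^ k i)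
    (hm : m =O[l] fun _ => (1 : ℝ))
    (hm1 : ∀ᶠ i in l, (m i).1 = (F.lam0 ^ k i * F.scale (k i))⁻¹ *
        ((μ i).1 + F.lam0 ^ k i * F.kappa + F.correction D (k i) (μ i)))
    (hlog : (fun i => F.lam (ε i) / F.lam0 - 1 - F.logDeriv D (μ i)) =O[l] fun i => ‖μ i‖ ^ 2)
    {c x y eu ev : ι → ℝ} (hc : (fun i => c i - F.c) =O[l] fun i => |F.lam0| ^ k i)
    (hx : (fun i => x i - F.xPlus) =O[l] fun i => |F.lam0| ^ k i)
    (hy : (fun i => y i - F.yMinus) =O[l] fun i => |F.lam0| ^ k i)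
    (hu : (fun i => eu i - k i * (F.beta 0 * F.lam0 ^ k i * (F.xPlus ^ 2 * F.yMinus))) =O[l]
      fun i => |F.lam0| ^ k i)
    (hv : (fun i => ev i + k i * (F.beta 0 * F.lam0 ^ k i * (F.yMinus ^ 2 * F.xPlus))) =O[l]
      fun i => |F.lam0| ^ k i) :
    (fun i => (F.scale (k i))⁻¹ *
        ((μ i).1 / F.lam (ε i) ^ k i + c i * (x i + eu i) - (y i - ev i)) - (m i).1) =O[l]
      fun i => F.scale (k i) := by
  obtain ⟨hq1, hq2⟩ := F.isBigO_inv_lam_pow_sub hr hk hε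
  have hL := F.lam0_pow_isBigO (l := l) (k := k)
  have hL1 : (fun i => |F.lam0| ^ k i) =O[l] fun _ => (1 : ℝ) := by
    simpa using F.isBigO_pow_mul_one hk 0
  have bd : ∀ {f g : ι → ℝ}, (f =O[l] fun i => |F.lam0| ^ k i) → (g =O[l] fun _ => (1 : ℝ)) →
      (fun i => f i * g i) =O[l] fun i => |F.lam0| ^ k i := fun hf hg => by
    simpa using hf.mul hg
  have hm1' : (fun i => (m i).1) =O[l] fun _ => (1 : ℝ) :=
    (isBigO_fst_prod' (f' := m)).trans hm
  have hℓ : (fun i => F.logDeriv D (μ i)) =O[l] fun i => |F.lam0| ^ k i :=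
    ((F.logDeriv D).isBigO_comp _ _).trans hμ
  have hkL1 : (fun i => (k i : ℝ) * |F.lam0| ^ k i) =O[l] fun _ => (1 : ℝ) := by
    simpa using F.isBigO_pow_mul_one hk 1
  -- `λ(ε)ᵏ` to first order in `μ`
  have hq : (fun i => F.lam0 ^ k i / F.lam (ε i) ^ k i - 1 + k i * F.logDeriv D (μ i)) =O[l]
      fun i => |F.lam0| ^ k i := by
    have h1 := F.isBigO_lam_pow_div_sub_sub hk hε hr
    have h2 : (fun i => (k i : ℝ) * (F.lam (ε i) / F.lam0 - 1 - F.logDeriv D (μ i))) =O[l]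
        fun i => |F.lam0| ^ k i := by
      have h3 := (isBigO_refl (fun i => (k i : ℝ)) l).mul (hlog.trans (hμ.norm_left.pow 2))
      have h4 := hkL1.mul (isBigO_refl (fun i => |F.lam0| ^ k i) l)
      simp only [one_mul] at h4
      exact h3.trans (h4.congr_left fun i => by ring)
    exact ((hq2.sub h1).sub h2).congr_left fun i => by ring
  -- For bounded `M₁` the ratio `μ₁/λ(0)ᵏ` is `-κ + O(s)`. Hence in its product with `λ(0)ᵏ/λ(ε)ᵏ -
  -- 1 = O(kλᵏ)` it may be replaced by `-κ`, the error being `O(skλᵏ) = O(λᵏ)`.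
  have hdev : (fun i => (μ i).1 / F.lam0 ^ k i + F.kappa) =O[l] fun i => F.scale (k i) := by
    have h1 : (fun i => F.scale (k i) * (m i).1) =O[l] fun i => F.scale (k i) := by
      simpa using (isBigO_refl (fun i => F.scale (k i)) l).mul hm1'
    have h2 : (fun i => (k i : ℝ) * F.logDeriv D (μ i)) =O[l]
        fun i => (k i : ℝ) * |F.lam0| ^ k i := (isBigO_refl _ _).mul hℓ
    have h3 : (fun i => (k i : ℝ) * F.lam0 ^ k i) =O[l]
        fun i => (k i : ℝ) * |F.lam0| ^ k i := (isBigO_refl _ _).mul hL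
    have h4 := ((h2.const_mul_left F.kappa).add
      (h3.const_mul_left (F.kappa * (F.beta 0 * F.xPlus * F.yMinus)))).trans
      (F.isBigO_mul_scale hk)
    refine (h1.sub h4).congr' ?_ (EventuallyEq.refl _ _)
    filter_upwards [hm1] with i hi
    have := pow_ne_zero (k i) F.lam0_ne_zero
    have := (F.scale_pos (k i)).ne'
    rw [hi, correction]
    field_simp
    ring
  have heu1 : eu =O[l] fun _ => (1 : ℝ) := by
    have h3 : (fun i => (k i : ℝ) * F.lam0 ^ k i) =O[l]
        fun i => (k i : ℝ) * |F.lam0| ^ k i := (isBigO_refl _ _).mul hL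
    exact ((hu.trans hL1).add ((h3.trans hkL1).const_mul_left
      (F.beta 0 * (F.xPlus ^ 2 * F.yMinus)))).congr_left fun i => by ring
  have hx1 : x =O[l] fun _ => (1 : ℝ) :=
    ((hx.trans hL1).add (isBigO_const_const F.xPlus one_ne_zero l)).congr_left fun i => by ring
  have t1 : (fun i => ((μ i).1 / F.lam0 ^ k i + F.kappa) *
      (F.lam0 ^ k i / F.lam (ε i) ^ k i - 1)) =O[l] fun i => |F.lam0| ^ k i :=
    (hdev.mul hq1).trans ((F.mul_scale_isBigO hk).congr_left fun i => by ring)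
  have t2 := hq.const_mul_left F.kappa
  have t3 := bd hc hx1
  have t4 := hx.const_mul_left F.c
  have t5 := bd hc heu1
  have t6 := hu.const_mul_left F.c
  -- All terms of order `kλᵏ` cancel against the correction: `-κ` times `-kℓ(μ)` from the
  -- multiplier, and `kβλᵏ(c x⁺² y⁻ - y⁻² x⁺) = kβλᵏ x⁺y⁻ κ` from the passage.
  have total := ((((((t1.sub t2).add t3).add t4).sub hy).add t5).add t6).add hv
  have total' : (fun i => (μ i).1 / F.lam (ε i) ^ k i + c i * (x i + eu i) - (y i - ev i)
      - F.scale (k i) * (m i).1) =O[l] fun i => F.scale (k i) ^ 2 := by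
    refine (total.trans F.isBigO_scale_sq).congr' ?_ (EventuallyEq.refl _ _)
    filter_upwards [hm1] with i hi
    have h1 := pow_ne_zero (k i) F.lam0_ne_zero
    have h2 := (F.scale_pos (k i)).ne'
    have h3 : (μ i).1 / F.lam (ε i) ^ k i
        = (μ i).1 / F.lam0 ^ k i * (F.lam0 ^ k i / F.lam (ε i) ^ k i) := by field_simp
    have h4 : F.scale (k i) * (m i).1 = (μ i).1 / F.lam0 ^ k i + F.kappa +
        k i * F.kappa * (F.logDeriv D (μ i) + F.lam0 ^ k i * (F.beta 0 * F.xPlus * F.yMinus)) := by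
      rw [hi, correction]; field_simp
    rw [h3, h4]
    simp only [kappa]
    ring
  have := (isBigO_refl (fun i => (F.scale (k i))⁻¹) l).mul total'
  refine this.congr (fun i => ?_) (fun i => ?_)
  · have h2 := (F.scale_pos (k i)).ne'
    field_simp
  · have h2 := (F.scale_pos (k i)).ne'
    field_simp

/-- The linear term of the rescaled return map. -/
theorem isBigO_linear_term (hr : 5 ≤ r) (hk : Tendsto k l atTop)
    (hε : ε =O[l] fun i => |F.lam0| ^ k i) (hμ : μ =O[l] fun i => |F.lam0| ^ k i)
    (hm2 : ∀ᶠ i in l, (m i).2 = (F.lam0 ^ k i)⁻¹ * (μ i).2 + F.f11 * F.xPlus)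
    {c u : ι → ℝ} (hc : (fun i => c i - F.f11) =O[l] fun i => F.scale (k i))
    (hu : (fun i => u i - F.xPlus) =O[l] fun i => F.scale (k i)) :
    (fun i => (μ i).2 / F.lam (ε i) ^ k i + c i * u i - (m i).2) =O[l]
      fun i => F.scale (k i) := by
  obtain ⟨hq1, -⟩ := F.isBigO_inv_lam_pow_sub hr hk hε
  have h1 : (fun i => (μ i).2 / F.lam0 ^ k i) =O[l] fun _ => (1 : ℝ) := by
    have h2 := ((isBigO_snd_prod' (f' := μ)).trans hμ).mul
      (isBigO_refl (fun i => (F.lam0 ^ k i)⁻¹) l)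
    refine (h2.congr_left fun i => (div_eq_mul_inv _ _).symm).trans ?_
    refine IsBigO.of_norm_le fun i => ?_
    have := pow_ne_zero (k i) (abs_ne_zero.2 F.lam0_ne_zero)
    simp [this]
  have hu1 : u =O[l] fun _ => (1 : ℝ) :=
    ((hu.trans ((F.tendsto_scale hk).isBigO_one ℝ)).add
      (isBigO_const_const F.xPlus one_ne_zero l)).congr_left fun i => by ring
  have t1 := h1.mul (hq1.trans (F.isBigO_mul_scale hk))
  have t2 := hc.mul hu1
  simp only [one_mul, mul_one] at t1 t2
  refine ((t1.add t2).add (hu.const_mul_left F.f11)).congr' ?_ (EventuallyEq.refl _ _)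
  filter_upwards [hm2] with i hi
  have := pow_ne_zero (k i) F.lam0_ne_zero
  rw [hi]
  field_simp
  ring

/-- The cubic term of the rescaled return map. -/
theorem isBigO_cubic_term (hr : 5 ≤ r) (hk : Tendsto k l atTop)
    (hε : ε =O[l] fun i => |F.lam0| ^ k i) {d : ι → ℝ}
    (hd : (fun i => d i - F.d) =O[l] fun i => F.scale (k i)) :
    (fun i => d i * F.scale (k i) ^ 2 / F.lam (ε i) ^ k i - Real.sign (F.d * F.lam0 ^ k i)) =O[l]
      fun i => F.scale (k i) := by
  obtain ⟨hq1, -⟩ := F.isBigO_inv_lam_pow_sub hr hk hε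
  have hd1 : d =O[l] fun _ => (1 : ℝ) :=
    ((hd.trans ((F.tendsto_scale hk).isBigO_one ℝ)).add
      (isBigO_const_const F.d one_ne_zero l)).congr_left fun i => by ring
  have hs1 : (fun i => F.scale (k i) ^ 2 / F.lam0 ^ k i) =O[l] fun _ => (1 : ℝ) := by
    refine IsBigO.of_bound (|F.d|⁻¹) (Eventually.of_forall fun i => ?_)
    have := pow_ne_zero (k i) (abs_ne_zero.2 F.lam0_ne_zero)
    rw [F.scale_sq]
    simp only [norm_div, Real.norm_eq_abs, abs_pow, abs_abs, norm_one, mul_one]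
    field_simp
    rfl
  -- This fixes the choice of the scale: `s² = |λᵏ/d|` normalizes the cubic coefficient to its sign.
  have hsign : ∀ i, F.d * (F.scale (k i) ^ 2 / F.lam0 ^ k i) = Real.sign (F.d * F.lam0 ^ k i) := by
    intro i
    have h1 := pow_ne_zero (k i) F.lam0_ne_zero
    have h2 := F.d_ne_zero
    have h3 : F.d * F.lam0 ^ k i ≠ 0 := mul_ne_zero h2 h1
    rw [F.scale_sq, ← abs_pow]
    rcases lt_or_gt_of_ne h1 with ha | ha <;> rcases lt_or_gt_of_ne h2 with hb | hb
    · rw [abs_of_neg ha, abs_of_neg hb, Real.sign_of_pos (mul_pos_of_neg_of_neg hb ha)]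
      field_simp
    · rw [abs_of_neg ha, abs_of_pos hb, Real.sign_of_neg (mul_neg_of_pos_of_neg hb ha)]
      field_simp
    · rw [abs_of_pos ha, abs_of_neg hb, Real.sign_of_neg (mul_neg_of_neg_of_pos hb ha)]
      field_simp
    · rw [abs_of_pos ha, abs_of_pos hb, Real.sign_of_pos (mul_pos hb ha)]
      field_simp
  have t1 := (hd1.mul hs1).mul (hq1.trans (F.isBigO_mul_scale hk))
  have t2 := hd.mul hs1
  simp only [one_mul, mul_one] at t1 t2
  refine (t1.add t2).congr_left fun i => ?_
  rw [← hsign]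
  have := pow_ne_zero (k i) F.lam0_ne_zero
  field_simp
  ring

end Brackets

end CubicTangencyFamily

/-! ### The passage near the saddle in renormalized coordinates. -/

namespace CubicTangencyFamily

open Asymptotics

variable {r : ℕ∞} {M : Type*} [TopologicalSpace M] [ChartedSpace (ℝ × ℝ) M]
  [IsManifold 𝓘(ℝ, ℝ × ℝ) (r : WithTop ℕ∞) M] {Ω : SymplecticForm r M}
  (F : CubicTangencyFamily r M Ω)

/-- The displacement of the homoclinic point by the rescaled passage near the saddle. -/
noncomputable def passageShift (k : ℕ) (ε : ℝ × ℝ) : ℝ × ℝ :=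
  saddleOrbit (F.localMap ε) (F.lam ε) k k (F.xPlus, F.yMinus) - (F.xPlus, F.yMinus)

/-- The passage near the saddle in the renormalized coordinates. -/
theorem exists_rescaled_passage (hr : 5 ≤ r) {n : ℕ} (hn : 1 ≤ n) (hnr : (n : ℕ∞) + 2 ≤ r)
    {R : ℝ} (hR : 0 < R) {ι : Type} {l : Filter ι} {k : ι → ℕ} {ε : ι → ℝ × ℝ}
    (hk : Tendsto k l atTop) (hε : ε =O[l] fun i => |F.lam0| ^ k i) {x y : ι → ℝ}
    (hx : (fun i => x i - F.xPlus) =O[l] fun i => |F.lam0| ^ k i)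
    (hy : (fun i => y i - F.yMinus) =O[l] fun i => |F.lam0| ^ k i) :
    ((fun i => (F.passageShift (k i) (ε i)).1
        - k i * (F.beta 0 * F.lam0 ^ k i * (F.xPlus ^ 2 * F.yMinus))) =O[l]
      fun i => |F.lam0| ^ k i) ∧
    ((fun i => (F.passageShift (k i) (ε i)).2
        + k i * (F.beta 0 * F.lam0 ^ k i * (F.yMinus ^ 2 * F.xPlus))) =O[l]
      fun i => |F.lam0| ^ k i) ∧
    ∃ α : ι → ℝ × ℝ → ℝ × ℝ,
      CnBigO n (Metric.ball 0 R) l α (fun i => F.scale (k i)) ∧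
      ∀ᶠ i in l, ∀ z ∈ Metric.ball (0 : ℝ × ℝ) R,
        (∀ j ≤ k i, (F.localMap (ε i))^[j] (x i + F.b * F.scale (k i) * z.1,
          F.lam (ε i) ^ k i * (y i - (F.passageShift (k i) (ε i)).2 + F.scale (k i) * z.2)) ∈
            rect F.δ₁ F.δ₂) ∧
        (F.localMap (ε i))^[k i] (x i + F.b * F.scale (k i) * z.1,
          F.lam (ε i) ^ k i * (y i - (F.passageShift (k i) (ε i)).2 + F.scale (k i) * z.2)) =
          (F.lam (ε i) ^ k i * (x i + (F.passageShift (k i) (ε i)).1 +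
            F.scale (k i) * (F.b * z.1 + (α i z).1)), y i + F.scale (k i) * (z.2 + (α i z).2)) := by
  obtain ⟨ρ, a₀, b₀, hρ, ha, hb, hpass⟩ := F.exists_passage hr hn hnr
  obtain ⟨hf, hmaps, hu, hv⟩ := hpass hk hε
  have hL := F.lam0_pow_isBigO (l := l) (k := k)
  have hLs := F.pow_isBigO_scale hk
  refine ⟨hu, hv, ?_⟩
  set f : ι → ℝ × ℝ → ℝ × ℝ := fun i z =>
    saddleOrbit (F.localMap (ε i)) (F.lam (ε i)) (k i) (k i) z - z with hf_def
  set q₀ : ι → ℝ × ℝ := fun i => (x i, y i - (F.passageShift (k i) (ε i)).2) with hq₀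
  set A : ι → ℝ × ℝ →L[ℝ] ℝ × ℝ := fun i => diagScale (F.b * F.scale (k i)) (F.scale (k i)) with hA
  have hkLs : (fun i => (k i : ℝ) * F.lam0 ^ k i) =O[l] fun i => F.scale (k i) :=
    ((isBigO_refl (fun i => (k i : ℝ)) l).mul hL).trans (F.isBigO_mul_scale hk)
  have hv' : (fun i => (F.passageShift (k i) (ε i)).2) =O[l] fun i => F.scale (k i) :=
    ((hv.trans hLs).sub (hkLs.const_mul_left (F.beta 0 * (F.yMinus ^ 2 * F.xPlus)))).congr_left
      fun i => by simp only [passageShift, Prod.snd_sub]; ring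
  have hq : (fun i => q₀ i - (F.xPlus, F.yMinus)) =O[l] fun i => F.scale (k i) := by
    refine ((hx.trans hLs).prod_left ((hy.trans hLs).sub hv')).congr_left fun i => ?_
    ext <;> simp [hq₀]; ring
  have hAO : A =O[l] fun i => F.scale (k i) := by
    refine IsBigO.of_bound (|F.b| + 1) (Eventually.of_forall fun i => ?_)
    have hs := F.scale_pos (k i)
    refine ContinuousLinearMap.opNorm_le_bound _ (by positivity) fun z => ?_
    rw [Real.norm_eq_abs, abs_of_pos hs, diagScale_apply, Prod.norm_def]
    refine max_le ?_ ?_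
    · rw [norm_mul, norm_mul, Real.norm_eq_abs, Real.norm_eq_abs, abs_of_pos hs]
      refine mul_le_mul ?_ (norm_fst_le z) (norm_nonneg _) (by positivity)
      nlinarith
    · rw [norm_mul, Real.norm_eq_abs, abs_of_pos hs]
      refine mul_le_mul ?_ (norm_snd_le z) (norm_nonneg _) (by positivity)
      nlinarith [abs_nonneg F.b]
  have hs0 := F.tendsto_scale hk
  -- The displacement of the homoclinic point is subtracted before dividing by `s`: by itself it is
  -- known only as `O(kλᵏ)`, which would leave `O(ks)`. The increments over a chart of size `s` gain
  -- the missing factor.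
  refine ⟨fun i z => (F.scale (k i))⁻¹ • (f i (q₀ i + A i z) - f i (F.xPlus, F.yMinus)),
    (CnBigO.comp_affine_sub hR hn hf hAO hq hs0
      (Eventually.of_forall fun i => F.scale_pos (k i)) hρ).trans (F.isBigO_mul_scale hk), ?_⟩
  have hball : ∀ᶠ i in l, ∀ z ∈ Metric.ball (0 : ℝ × ℝ) R,
      q₀ i + A i z ∈ Metric.ball (F.xPlus, F.yMinus) ρ := by
    have h1 : Tendsto (fun i => ‖q₀ i - (F.xPlus, F.yMinus)‖ + ‖A i‖ * R) l (𝓝 0) := by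
      simpa using (hq.trans_tendsto hs0).norm.add ((hAO.trans_tendsto hs0).norm.mul_const R)
    filter_upwards [h1.eventually (gt_mem_nhds hρ)] with i hi z hz
    rw [mem_ball_zero_iff] at hz
    rw [mem_ball_iff_norm, add_sub_right_comm]
    refine (norm_add_le _ _).trans_lt (lt_of_le_of_lt ?_ hi)
    gcongr
    exact ((A i).le_opNorm z).trans (by gcongr)
  have hε0 := F.tendsto_param hk hε
  filter_upwards [hball, hmaps, hε0.eventually F.V_mem_nhds] with i h1 h2 h3 z hz
  have hpt : ((x i + F.b * F.scale (k i) * z.1,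
      F.lam (ε i) ^ k i * (y i - (F.passageShift (k i) (ε i)).2 + F.scale (k i) * z.2)) : ℝ × ℝ)
      = diagScale 1 (F.lam (ε i) ^ k i) (q₀ i + A i z) := by
    ext <;> simp [hq₀, hA]
  have hs := (F.scale_pos (k i)).ne'
  rw [hpt]
  refine ⟨fun j hj => ?_, ?_⟩
  · rw [iterate_diagScale (F.lam_ne_zero _ h3) _ _ hj]
    have hle : ∀ t : ℕ, |F.lam (ε i) ^ t| ≤ 1 := fun t => by
      rw [abs_pow]; exact pow_le_one₀ (abs_nonneg _) (F.abs_lam_lt_one _ h3).le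
    have h4 := diagScale_mem_rect (hle j) (hle (k i - j)) (h2 j hj (h1 z hz))
    exact ⟨h4.1.trans ha, h4.2.trans hb⟩
  · rw [iterate_diagScale (F.lam_ne_zero _ h3) _ _ le_rfl]
    ext
    · simp [hf_def, hq₀, hA, passageShift]
      field_simp
      ring_nf
      tauto
    · simp [hf_def, hq₀, hA, passageShift]
      field_simp
      ring

end CubicTangencyFamily

/-! ### Convergence of the renormalized return maps. -/

namespace CubicTangencyFamily

open Asymptotics

variable {r : ℕ∞} {M : Type*} [TopologicalSpace M] [ChartedSpace (ℝ × ℝ) M]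
  [IsManifold 𝓘(ℝ, ℝ × ℝ) (r : WithTop ℕ∞) M] {Ω : SymplecticForm r M}
  (F : CubicTangencyFamily r M Ω)

/-- In the renormalized coordinates and parameters, the first return maps are defined on a given
ball and are asymptotic to the cubic Hénon maps. -/
theorem renormalization (hr : 5 ≤ r) {n : ℕ} (hn : 3 ≤ n) (hnr : (n : ℕ∞) + 2 ≤ r)
    {R : ℝ} (hR : 0 < R) {PiPlus : Set (ℝ × ℝ)} (hPi : PiPlus ∈ 𝓝 (F.xPlus, (0 : ℝ)))
    {ι : Type} {l : Filter ι} {k : ι → ℕ} {m μ ε : ι → ℝ × ℝ} {D : (ℝ × ℝ) →L[ℝ] ℝ × ℝ}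
    (hk : Tendsto k l atTop) (hε : ε =O[l] fun i => |F.lam0| ^ k i)
    (hμ : μ =O[l] fun i => |F.lam0| ^ k i) (hm : m =O[l] fun _ => (1 : ℝ))
    (hm1 : ∀ᶠ i in l, (m i).1 = (F.lam0 ^ k i * F.scale (k i))⁻¹ *
        ((μ i).1 + F.lam0 ^ k i * F.kappa + F.correction D (k i) (μ i)))
    (hm2 : ∀ᶠ i in l, (m i).2 = (F.lam0 ^ k i)⁻¹ * (μ i).2 + F.f11 * F.xPlus)
    (hlog : (fun i => F.lam (ε i) / F.lam0 - 1 - F.logDeriv D (μ i)) =O[l] fun i => ‖μ i‖ ^ 2)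
    {yI : ℝ × ℝ → ℝ} (hy : (fun i => yI (ε i) - F.yMinus) =O[l] fun i => |F.lam0| ^ k i)
    (hinf : ∀ᶠ i in l, pdy (pdy (F.globalY (ε i))) (0, yI (ε i)) = 0)
    (hμ_eq : ∀ᶠ i in l, μ i = (F.globalY (ε i) (0, yI (ε i)),
      pdy (F.globalY (ε i)) (0, yI (ε i)))) :
    (∀ᶠ i in l, ∀ z ∈ Metric.ball (0 : ℝ × ℝ) R,
      F.coordChange yI (k i) (ε i) z ∈ F.strip PiPlus (k i) (ε i)) ∧
    CnBigO n (Metric.ball 0 R) l (fun i z => (F.coordChange yI (k i) (ε i)).symm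
      (F.firstReturn (k i) (ε i) (F.coordChange yI (k i) (ε i) z)) -
        cubicHenon 1 (Real.sign (F.d * F.lam0 ^ k i)) (m i) z) (fun i => F.scale (k i)) := by
  set y : ι → ℝ := fun i => yI (ε i) with hy_def
  set x : ι → ℝ := fun i => F.globalX (ε i) (0, y i) with hx_def
  set s : ι → ℝ := fun i => F.scale (k i) with hs_def
  set Λ : ι → ℝ := fun i => F.lam (ε i) ^ k i with hΛ_def
  set ν : ι → ℝ := fun i => Real.sign (F.d * F.lam0 ^ k i) with hν_def
  have hspos : ∀ i, 0 < s i := fun i => F.scale_pos (k i)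
  have hs0 : Tendsto s l (𝓝 0) := F.tendsto_scale hk
  have hs1 : s =O[l] fun _ => (1 : ℝ) := hs0.isBigO_one ℝ
  have hL0 : Tendsto (fun i => |F.lam0| ^ k i) l (𝓝 0) := by
    simpa using F.tendsto_pow_mul_abs_lam0_pow hk 0
  have hL1 := hL0.isBigO_one ℝ
  have hLs : (fun i => |F.lam0| ^ k i) =O[l] s := F.pow_isBigO_scale hk
  have hV := (F.tendsto_param hk hε).eventually F.V_mem_nhds
  -- the coefficients of the global map
  have hx : (fun i => x i - F.xPlus) =O[l] fun i => |F.lam0| ^ k i := by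
    have := F.isBigO_sub_base ((F.contDiffOn_joint_globalX hr).of_le (by norm_num)) hL0 hε hy
    rw [F.globalX_base] at this
    exact this
  have hb : (fun i => pdy (F.globalX (ε i)) (0, y i) - F.b) =O[l] fun i => |F.lam0| ^ k i :=
    F.isBigO_sub_base (F.contDiffOn_joint_pdy_globalX hr) hL0 hε hy
  have hc : (fun i => pdx (F.globalY (ε i)) (0, y i) - F.c) =O[l] fun i => |F.lam0| ^ k i := by
    rw [F.c_eq hr]
    exact F.isBigO_sub_base (F.contDiffOn_joint_pdx_globalY hr) hL0 hε hy
  have hf : (fun i => pdx (pdy (F.globalY (ε i))) (0, y i) - F.f11) =O[l]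
      fun i => |F.lam0| ^ k i := by
    rw [F.f11_eq hr]
    exact F.isBigO_sub_base (F.contDiffOn_joint_pdx_pdy_globalY hr) hL0 hε hy
  have hd : (fun i => pdy (pdy (pdy (F.globalY (ε i)))) (0, y i) / 6 - F.d) =O[l] s := by
    rw [F.d_eq hr]
    refine ((F.isBigO_pdy_pdy_pdy_sub hr hs0 (Eventually.of_forall hspos)
      (hε.trans F.isBigO_scale_sq) (hy.trans F.isBigO_scale_sq)).const_mul_left 6⁻¹).congr_left
      fun i => by ring
  set cε : ι → ℝ := fun i => pdx (F.globalY (ε i)) (0, y i)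
  set bε : ι → ℝ := fun i => pdy (F.globalX (ε i)) (0, y i)
  set fε : ι → ℝ := fun i => pdx (pdy (F.globalY (ε i))) (0, y i)
  set dε : ι → ℝ := fun i => pdy (pdy (pdy (F.globalY (ε i)))) (0, y i) / 6
  -- the passage near the saddle and the brackets
  obtain ⟨hu, hv, α, hα, hpass⟩ := F.exists_rescaled_passage hr (by omega) hnr hR hk hε hx hy
  set eu : ι → ℝ := fun i => (F.passageShift (k i) (ε i)).1
  set ev : ι → ℝ := fun i => (F.passageShift (k i) (ε i)).2
  have B1 := F.isBigO_constant_term hr hk hε hμ hm hm1 hlog hc hx hy hu hv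
  have hkLs : (fun i => (k i : ℝ) * F.lam0 ^ k i) =O[l] s :=
    ((isBigO_refl (fun i => (k i : ℝ)) l).mul F.lam0_pow_isBigO).trans (F.isBigO_mul_scale hk)
  have hU : (fun i => x i + eu i - F.xPlus) =O[l] s :=
    ((hx.trans hLs).add ((hu.trans hLs).add
      (hkLs.const_mul_left (F.beta 0 * (F.xPlus ^ 2 * F.yMinus))))).congr_left fun i => by ring
  have hev : ev =O[l] s :=
    ((hv.trans hLs).sub (hkLs.const_mul_left (F.beta 0 * (F.yMinus ^ 2 * F.xPlus)))).congr_left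
      fun i => by ring
  have B2 := F.isBigO_linear_term hr hk hε hμ hm2 (hf.trans hLs) hU
  have B3 := F.isBigO_cubic_term hr hk hε hd
  -- the variables of the global map
  have hball : IsOpen (Metric.ball (0 : ℝ × ℝ) R) := Metric.isOpen_ball
  have hX : CnBigO n (Metric.ball (0 : ℝ × ℝ) R) l (fun (_ : ι) (z : ℝ × ℝ) => z.1)
      (fun _ => 1) := cnBigO_id.fst hball
  have hY : CnBigO n (Metric.ball (0 : ℝ × ℝ) R) l (fun (_ : ι) (z : ℝ × ℝ) => z.2)
      (fun _ => 1) := cnBigO_id.snd hball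
  have hα1 := hα.fst hball
  have hα2 := hα.snd hball
  set η : ι → ℝ × ℝ → ℝ := fun i z => z.2 + (α i z).2 with hη_def
  set u : ι → ℝ × ℝ → ℝ := fun i z => x i + eu i + s i * (F.b * z.1 + (α i z).1) with hu_def
  have hη : CnBigO n (Metric.ball (0 : ℝ × ℝ) R) l η (fun _ => 1) :=
    hY.add (hα2.trans hs1) hball
  have hbX : CnBigO n (Metric.ball (0 : ℝ × ℝ) R) l (fun i z => F.b * z.1 + (α i z).1)
      (fun _ => 1) :=
    ((CnBigO.bounded_const_mul (isBigO_const_const F.b one_ne_zero l) hX hball)).add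
      (hα1.trans hs1) hball
  have hU1 : (fun i => x i + eu i) =O[l] fun _ => (1 : ℝ) :=
    ((hU.trans hs1).add (isBigO_const_const F.xPlus one_ne_zero l)).congr_left fun i => by ring
  have hu1 : CnBigO n (Metric.ball (0 : ℝ × ℝ) R) l u (fun _ => 1) :=
    (CnBigO.const hU1).add (CnBigO.bounded_const_mul hs1 hbX hball) hball
  -- The coordinate `x = λᵏ u` on arrival has size `s²`, in accordance with its weight two.
  have hΛs : (fun i => Λ i / s i ^ 2) =O[l] fun _ => (1 : ℝ) := by
    have h1 := ((F.isBigO_lam_pow hk hε hr).trans F.isBigO_scale_sq).mul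
      (isBigO_refl (fun i => (s i ^ 2)⁻¹) l)
    refine h1.congr (fun i => (div_eq_mul_inv _ _).symm) fun i => ?_
    exact mul_inv_cancel₀ (pow_ne_zero _ (hspos i).ne')
  have hψ : CnBigO n (Metric.ball (0 : ℝ × ℝ) R) l (fun i z => (Λ i / s i ^ 2 * u i z, η i z))
      (fun _ => 1) := (CnBigO.bounded_const_mul hΛs hu1 hball).prodMk hη hball
  obtain ⟨R₀, hR₀, hψR⟩ := hψ.exists_norm_le
  -- The weighted estimate for a remainder of weight four needs at least four derivatives, hence the
  -- order `n + 1 ≥ 4`.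
  have hNr : ((n + 1 : ℕ) : ℕ∞) ≤ r := le_trans (by
    push_cast; exact add_le_add_right (by norm_num) _) hnr
  obtain ⟨δ, hδ, htaylor⟩ := F.exists_taylor_globalMap (N := n + 1) (by omega) hNr
  have hlim : Tendsto (fun i => (ε i, y i)) l (𝓝 (0, F.yMinus)) := by
    refine (F.tendsto_param hk hε).prodMk_nhds ?_
    simpa using (hy.trans_tendsto hL0).add_const F.yMinus
  obtain ⟨hPiM, TX, TY, hTX, hTY, hTXO, hTYO, hTXw, hTYw⟩ := htaylor hlim hinf
  have hψmaps : ∀ᶠ i in l, MapsTo (fun z => (Λ i / s i ^ 2 * u i z, η i z))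
      (Metric.ball (0 : ℝ × ℝ) R) (Metric.ball (0 : ℝ × ℝ) (R₀ + 1)) := by
    filter_upwards [hψR] with i hi z hz
    rw [mem_ball_zero_iff]
    linarith [hi z hz]
  have hRX := ((hTXO.comp_diagScale_of_weightedFlat hδ (by omega) hTXw hs0
    (Eventually.of_forall hspos) (R := R₀ + 1) (by linarith)).mono_order (Nat.le_succ n)).comp hψ
      hball Metric.isOpen_ball hψmaps
  have hRY := ((hTYO.comp_diagScale_of_weightedFlat hδ (by omega) hTYw hs0
    (Eventually.of_forall hspos) (R := R₀ + 1) (by linarith)).mono_order (Nat.le_succ n)).comp hψ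
      hball Metric.isOpen_ball hψmaps
  -- The remainder of weight four, divided by the vertical scale `λᵏ s`, is `s⁴/(λᵏ s) = O(s)`.
  have hΛinv : (fun i => (Λ i * s i)⁻¹ * s i ^ 4) =O[l] s := by
    have h1 := ((F.tendsto_lam_pow_div hk hε hr).inv₀ one_ne_zero).isBigO_one ℝ
    have h2 : (fun i => (F.lam0 ^ k i)⁻¹ * s i ^ 2) =O[l] fun _ => (1 : ℝ) := by
      have h3 := (isBigO_refl (fun i => (F.lam0 ^ k i)⁻¹) l).mul (F.scale_sq_isBigO (k := k))
      refine h3.trans (IsBigO.of_norm_le fun i => ?_)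
      have := pow_ne_zero (k i) (abs_ne_zero.2 F.lam0_ne_zero)
      simp [this]
    have h4 := (h1.mul h2).mul (isBigO_refl s l)
    simp only [one_mul] at h4
    refine h4.congr_left fun i => ?_
    have h5 := pow_ne_zero (k i) F.lam0_ne_zero
    have h6 := (hspos i).ne'
    simp only [inv_div, mul_inv, hΛ_def]
    field_simp
  have hpt : ∀ i, F.lam (ε i) ≠ 0 → ∀ z, F.coordChange yI (k i) (ε i) z =
      (x i + F.b * s i * z.1, Λ i * (y i - ev i + s i * z.2)) := by
    intro i hi z
    rw [coordChange, triangularAffine_apply (mul_ne_zero (F.b_ne_zero hr) (hspos i).ne')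
      (mul_ne_zero (pow_ne_zero _ hi) (hspos i).ne')]
    ext
    · simp only [zero_mul, add_zero]; rfl
    · change Λ i * (y i - ev i) + Λ i * s i * z.2 = _
      simp only
      ring
  have hdiag : ∀ i z, ((Λ i * u i z, y i + s i * η i z) : ℝ × ℝ) =
      diagScale (s i ^ 2) (s i) (Λ i / s i ^ 2 * u i z, η i z) + (0, y i) := by
    intro i z
    have h6 := (hspos i).ne'
    ext
    · simp only [diagScale_apply, Prod.fst_add, add_zero]; field_simp
    · simp only [diagScale_apply, Prod.snd_add]; ring
  refine ⟨?_, ?_⟩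
  · have hsmall : ∀ᶠ i in l, ∀ z ∈ Metric.ball (0 : ℝ × ℝ) R,
        diagScale (s i ^ 2) (s i) (Λ i / s i ^ 2 * u i z, η i z) ∈ Metric.ball (0 : ℝ × ℝ) δ := by
      have h1 : Tendsto (fun i => s i * (R₀ + 1)) l (𝓝 0) := by simpa using hs0.mul_const (R₀ + 1)
      filter_upwards [hψmaps, h1.eventually (gt_mem_nhds hδ), hs0.eventually
        (gt_mem_nhds zero_lt_one)] with i h2 h3 h4 z hz
      have h5 := h2 hz
      rw [mem_ball_zero_iff] at h5 ⊢
      have h6 := (norm_fst_le _).trans h5.le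
      have h7 := (norm_snd_le _).trans h5.le
      have h8 := hspos i
      refine lt_of_le_of_lt ?_ h3
      rw [diagScale_apply, Prod.norm_def]
      refine max_le ?_ ?_
      · rw [norm_mul, Real.norm_eq_abs (s i ^ 2), abs_of_pos (by positivity)]
        refine mul_le_mul ?_ h6 (norm_nonneg _) h8.le
        nlinarith
      · rw [norm_mul, Real.norm_eq_abs (s i), abs_of_pos h8]
        exact mul_le_mul_of_nonneg_left h7 h8.le
    have hPlus : ∀ᶠ i in l, ∀ z ∈ Metric.ball (0 : ℝ × ℝ) R,
        ((x i + F.b * s i * z.1, Λ i * (y i - ev i + s i * z.2)) : ℝ × ℝ) ∈ PiPlus := by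
      obtain ⟨τ, hτ, hsub⟩ := Metric.mem_nhds_iff.1 hPi
      have hΛ0 : Tendsto Λ l (𝓝 0) := (F.isBigO_lam_pow hk hε hr).trans_tendsto hL0
      have hy1 : Tendsto (fun i => |y i - ev i| + s i * R) l (𝓝 (|F.yMinus| + 0 * R)) := by
        refine Tendsto.add (Tendsto.abs ?_) (hs0.mul_const R)
        simpa using ((hy.trans_tendsto hL0).add_const F.yMinus).sub (hev.trans_tendsto hs0)
      have t1 : Tendsto (fun i => |x i - F.xPlus| + |F.b| * s i * R) l (𝓝 0) := by
        simpa using (hx.trans_tendsto hL0).abs.add ((hs0.const_mul |F.b|).mul_const R)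
      have t2 : Tendsto (fun i => |Λ i| * (|y i - ev i| + s i * R)) l (𝓝 0) := by
        simpa using hΛ0.abs.mul hy1
      filter_upwards [t1.eventually (gt_mem_nhds hτ), t2.eventually (gt_mem_nhds hτ)]
        with i h1 h2 z hz
      rw [mem_ball_zero_iff] at hz
      have h6 := (norm_fst_le _).trans hz.le
      have h7 := (norm_snd_le _).trans hz.le
      rw [Real.norm_eq_abs] at h6 h7
      have h8 := hspos i
      refine hsub ?_
      rw [mem_ball_iff_norm, Prod.norm_def]
      refine max_lt (lt_of_le_of_lt ?_ h1) (lt_of_le_of_lt ?_ h2)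
      · simp only [Prod.fst_sub, Real.norm_eq_abs]
        rw [add_sub_right_comm]
        refine (abs_add_le _ _).trans ?_
        rw [abs_mul, abs_mul, abs_of_pos h8]
        gcongr
      · simp only [Prod.snd_sub, Real.norm_eq_abs, sub_zero, abs_mul]
        gcongr
        refine (abs_add_le _ _).trans ?_
        rw [abs_mul, abs_of_pos h8]
        gcongr
    filter_upwards [hV, hpass, hPlus, hPiM, hsmall] with i h1 h2 h3 h4 h5 z hz
    rw [hpt i (F.lam_ne_zero _ h1)]
    refine ⟨h3 z hz, fun j hj => (h2 z hz).1 j hj.le, ?_⟩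
    rw [(h2 z hz).2]
    have h6 := h4 _ (h5 z hz)
    rw [← hdiag] at h6
    exact h6
  · have hb0 := F.b_ne_zero hr
    have EX : CnBigO n (Metric.ball (0 : ℝ × ℝ) R) l (fun i z => (bε i / F.b - 1) * η i z +
        (α i z).2 + (F.b * s i)⁻¹ * TX i (diagScale (s i ^ 2) (s i)
          (Λ i / s i ^ 2 * u i z, η i z))) s := by
      have h1 : (fun i => bε i / F.b - 1) =O[l] s :=
        ((hb.trans hLs).const_mul_left F.b⁻¹).congr_left fun i => by
          change F.b⁻¹ * (bε i - F.b) = _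
          field_simp
      have h2 := (CnBigO.const ((isBigO_refl (fun i => (F.b * s i)⁻¹) l))).mul hRX hball
      refine ((CnBigO.const_mul_bounded h1 hη hball).add hα2 hball).add (h2.trans ?_) hball
      refine ((isBigO_refl s l).const_mul_left F.b⁻¹).congr_left fun i => ?_
      have := (hspos i).ne'
      field_simp
    have hη3 : CnBigO n (Metric.ball (0 : ℝ × ℝ) R) l
        (fun i z => η i z * η i z * η i z) (fun _ => 1) :=
      (hη.mul_bounded hη hball).mul_bounded hη hball
    -- This is the cofactor in `η³ - y³ = (η - y)(η² + ηy + y²)`, where `η - y` is the small second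
    -- component of `α`.
    have hq : CnBigO n (Metric.ball (0 : ℝ × ℝ) R) l
        (fun i z => η i z * η i z + η i z * z.2 + z.2 * z.2) (fun _ => 1) :=
      ((hη.mul_bounded hη hball).add (hη.mul_bounded hY hball) hball).add
        (hY.mul_bounded hY hball) hball
    have hν1 : ν =O[l] fun _ => (1 : ℝ) := by
      refine IsBigO.of_bound 1 (Eventually.of_forall fun i => ?_)
      rcases Real.sign_apply_eq (F.d * F.lam0 ^ k i) with h | h | h <;> simp [hν_def, h]
    have hm2' : (fun i => (m i).2) =O[l] fun _ => (1 : ℝ) :=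
      (isBigO_snd_prod' (f' := m)).trans hm
    -- The coefficient of `x` in the rescaled second component is `c(ε) b`, which tends to `c b =
    -- -1`.
    have hcb : (fun i => cε i * F.b + 1) =O[l] s :=
      ((hc.trans hLs).const_mul_left F.b).congr_left fun i => by
        have := F.b_mul_c hr
        change F.b * (cε i - F.c) = _
        linear_combination (-1 : ℝ) * this
    have hc1 : cε =O[l] fun _ => (1 : ℝ) :=
      ((hc.trans hL1).add (isBigO_const_const F.c one_ne_zero l)).congr_left fun i => by ring
    have hf1 : (fun i => fε i * s i) =O[l] s := by
      have := ((hf.trans hL1).add (isBigO_const_const F.f11 one_ne_zero l)).mul (isBigO_refl s l)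
      simp only [one_mul] at this
      exact this.congr_left fun i => by ring
    have hRY' := ((CnBigO.const (isBigO_refl (fun i => (Λ i * s i)⁻¹) l)).mul hRY hball).trans hΛinv
    -- The exact difference from the Hénon map, term by term: error of the constant; of the
    -- coefficient of `x`; displacement `α` in `x`; error of the linear coefficient; displacement in
    -- the linear term; the part of `f₁₁ x y` of order `s`; error of the cubic coefficient;
    -- displacement in the cube; Taylor remainder.
    have EY := (((((((((CnBigO.const B1).add (CnBigO.const_mul_bounded hcb hX hball) hball).add
      (CnBigO.bounded_const_mul hc1 hα1 hball) hball).add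
      (CnBigO.const_mul_bounded B2 hη hball) hball).add
      (CnBigO.bounded_const_mul hm2' hα2 hball) hball).add
      (CnBigO.const_mul_bounded hf1 (hbX.mul_bounded hη hball) hball) hball).add
      (CnBigO.const_mul_bounded B3 hη3 hball) hball).add
      (CnBigO.bounded_const_mul hν1 (hα2.mul_bounded hq hball) hball) hball).add hRY' hball)
    refine (EX.prodMk EY hball).congr hball ?_
    filter_upwards [hV, hpass, hμ_eq] with i h1 h2 h3 z hz
    have hlam := F.lam_ne_zero _ h1
    have hΛ0 : Λ i ≠ 0 := pow_ne_zero _ hlam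
    have hs0' := (hspos i).ne'
    have hFR : F.firstReturn (k i) (ε i) (F.coordChange yI (k i) (ε i) z) =
        F.globalMap (ε i) (diagScale (s i ^ 2) (s i) (Λ i / s i ^ 2 * u i z, η i z) + (0, y i)) := by
      rw [firstReturn, hpt i hlam, (h2 z hz).2, ← hdiag]
    have hGX := hTX i (diagScale (s i ^ 2) (s i) (Λ i / s i ^ 2 * u i z, η i z))
    have hGY := hTY i (diagScale (s i ^ 2) (s i) (Λ i / s i ^ 2 * u i z, η i z))
    have hμ1 : F.globalY (ε i) (0, y i) = (μ i).1 := by rw [h3]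
    have hμ2 : pdy (F.globalY (ε i)) (0, y i) = (μ i).2 := by rw [h3]
    rw [hμ1, hμ2] at hGY
    have hsymm : ∀ w, (F.coordChange yI (k i) (ε i)).symm w =
        ((w.1 - x i) / (F.b * s i), (w.2 - Λ i * (y i - ev i)) / (Λ i * s i)) := fun w =>
      triangularAffine_symm_apply (mul_ne_zero hb0 hs0') (mul_ne_zero hΛ0 hs0') _ w
    beta_reduce
    rw [hFR, hsymm]
    generalize hW : diagScale (s i ^ 2) (s i) (Λ i / s i ^ 2 * u i z, η i z) = W at hGX hGY ⊢
    have hW1 : W.1 = Λ i * u i z := by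
      rw [← hW]; simp only [diagScale_apply]; field_simp
    have hW2 : W.2 = s i * η i z := by rw [← hW]; rfl
    refine Prod.ext ?_ ?_
    · change (F.globalX (ε i) (W + (0, y i)) - x i) / (F.b * s i) - z.2 =
        (bε i / F.b - 1) * η i z + (α i z).2 + (F.b * s i)⁻¹ * TX i W
      rw [hGX]
      change (cuspPoly (x i) (bε i) 0 0 0 W + TX i W - x i) / (F.b * s i) - z.2 = _
      simp only [cuspPoly, hW2, hη_def]
      field_simp
      ring
    · change (F.globalY (ε i) (W + (0, y i)) - Λ i * (y i - ev i)) / (Λ i * s i) -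
          ((m i).1 + (m i).2 * z.2 - 1 * z.1 + ν i * z.2 ^ 3) =
        (s i)⁻¹ * ((μ i).1 / Λ i + cε i * (x i + eu i) - (y i - ev i)) - (m i).1 +
          (cε i * F.b + 1) * z.1 + cε i * (α i z).1 +
          ((μ i).2 / Λ i + fε i * (x i + eu i) - (m i).2) * η i z + (m i).2 * (α i z).2 +
          fε i * s i * ((F.b * z.1 + (α i z).1) * η i z) +
          (dε i * s i ^ 2 / Λ i - ν i) * (η i z * η i z * η i z) +
          ν i * ((α i z).2 * (η i z * η i z + η i z * z.2 + z.2 * z.2)) + (Λ i * s i)⁻¹ * TY i W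
      rw [hGY]
      change (cuspPoly (μ i).1 (μ i).2 (cε i) (fε i) (dε i) W + TY i W - Λ i * (y i - ev i)) /
        (Λ i * s i) - _ = _
      simp only [cuspPoly, hW1, hW2, hη_def, hu_def]
      field_simp
      ring

end CubicTangencyFamily

/-! ### Assembly: smoothness of the return map, order of the correction, and the theorem. -/

theorem AffineEquiv.contDiff_of_finiteDimensional {E : Type*} [NormedAddCommGroup E]
    [NormedSpace ℝ E] [FiniteDimensional ℝ E] (A : E ≃ᵃ[ℝ] E) {n : WithTop ℕ∞} :
    ContDiff ℝ n A := by
  have h : (A : E → E) = fun z => (LinearMap.toContinuousLinearMap A.toAffineMap.linear) z + A 0 :=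
    A.toAffineMap.decomp
  rw [h]
  fun_prop

namespace CubicTangencyFamily

open Asymptotics

variable {r : ℕ∞} {M : Type*} [TopologicalSpace M] [ChartedSpace (ℝ × ℝ) M]
  [IsManifold 𝓘(ℝ, ℝ × ℝ) (r : WithTop ℕ∞) M] {Ω : SymplecticForm r M}
  (F : CubicTangencyFamily r M Ω)

theorem contDiffOn_firstReturn_comp {PiPlus s : Set (ℝ × ℝ)} {k : ℕ} {ε : ℝ × ℝ} (hε : ε ∈ F.V)
    {A : ℝ × ℝ → ℝ × ℝ} (hA : ContDiffOn ℝ (r : WithTop ℕ∞) A s)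
    (hs : ∀ z ∈ s, A z ∈ F.strip PiPlus k ε) :
    ContDiffOn ℝ (r : WithTop ℕ∞) (fun z => F.firstReturn k ε (A z)) s := by
  have hiter : ∀ j ≤ k, ContDiffOn ℝ (r : WithTop ℕ∞) (fun z => (F.localMap ε)^[j] (A z)) s := by
    intro j
    induction j with
    | zero => exact fun _ => hA
    | succ j ih =>
      intro hj
      simp only [Function.iterate_succ_apply']
      exact (F.contDiffOn_localMap hε).comp (ih (by omega)) fun z hz => (hs z hz).2.1 j (by omega)
  exact (F.contDiffOn_globalMap hε).comp (hiter k le_rfl) fun z hz => (hs z hz).2.2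

/-- The bracket is `O(λᵏ)` because `μ` is, and the prefactor supplies `kλᵏ`. -/
theorem correction_isBigO {ι : Type*} {l : Filter ι} {k : ι → ℕ} {μ : ι → ℝ × ℝ}
    {D : (ℝ × ℝ) →L[ℝ] ℝ × ℝ} (hμ : μ =O[l] fun i => |F.lam0| ^ k i) :
    (fun i => F.correction D (k i) (μ i)) =O[l] fun i => (k i : ℝ) * |F.lam0| ^ (2 * k i) := by
  have hL := F.lam0_pow_isBigO (l := l) (k := k)
  have h1 := (((F.logDeriv D).isBigO_comp μ l).trans hμ).add
    (hL.const_mul_left (F.beta 0 * F.xPlus * F.yMinus))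
  have h2 := ((isBigO_refl (fun i => (k i : ℝ)) l).mul ((hL.const_mul_left F.kappa).mul h1))
  refine h2.congr (fun i => ?_) fun i => ?_
  · rw [correction]; ring
  · ring

end CubicTangencyFamily

theorem lemma3 {M : Type*} [TopologicalSpace M] [ChartedSpace (ℝ × ℝ) M]
    (r : ℕ∞) (hr : 5 ≤ r) [IsManifold 𝓘(ℝ, ℝ × ℝ) (r : WithTop ℕ∞) M]
    (Ω : SymplecticForm r M) (F : CubicTangencyFamily r M Ω)
    (PiPlus : Set (ℝ × ℝ)) (hPiPlus : PiPlus ∈ 𝓝 (F.xPlus, (0 : ℝ))) :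
    -- the splitting parameters `μ = e ε`
    ∃ e : OpenPartialHomeomorph (ℝ × ℝ) (ℝ × ℝ), F.IsSplitting e ∧
    -- linear changes `μ ↦ (M₁, M₂)` of the parameters and `(x, y)` of the coordinates
    ∃ (P : ℕ → ((ℝ × ℝ) ≃ᵃ[ℝ] (ℝ × ℝ))) (A : ℕ → ℝ × ℝ → ((ℝ × ℝ) ≃ᵃ[ℝ] (ℝ × ℝ))),
    ∀ R : ℝ, 0 < R → ∀ n : ℕ, (n : ℕ∞) + 2 ≤ r →
    ∃ (C : ℝ) (k₀ : ℕ), ∀ k : ℕ, k₀ ≤ k → ∀ m : ℝ × ℝ, ‖m‖ ≤ R →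
    ∀ μ ε : ℝ × ℝ, μ = (P k).symm m → ε = e.symm μ →
      μ ∈ e.target ∧
      (∃ ρ₁ ρ₂ : ℝ, |ρ₁| ≤ C * (k * |F.lam0| ^ (2 * k)) ∧ |ρ₂| ≤ C * (k * |F.lam0| ^ (2 * k)) ∧
        m.1 = √|F.d| * |F.lam0| ^ (-((k : ℝ) / 2)) * (F.lam0 ^ k)⁻¹ *
          (μ.1 - F.lam0 ^ k * (F.yMinus - F.c * F.xPlus) + ρ₁) ∧
        m.2 = (F.lam0 ^ k)⁻¹ * (μ.2 + F.f11 * F.lam0 ^ k * F.xPlus + ρ₂)) ∧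
      (∀ z ∈ Metric.ball (0 : ℝ × ℝ) R, A k ε z ∈ F.strip PiPlus k ε) ∧
      ContDiffOn ℝ (r : WithTop ℕ∞) (fun z => (A k ε).symm (F.firstReturn k ε (A k ε z)))
        (Metric.ball (0 : ℝ × ℝ) R) ∧
      ∀ j : ℕ, j ≤ n → ∀ z ∈ Metric.ball (0 : ℝ × ℝ) R,
        ‖iteratedFDeriv ℝ j (fun z => (A k ε).symm (F.firstReturn k ε (A k ε z)) -
          cubicHenon 1 (Real.sign (F.d * F.lam0 ^ k)) m z) z‖ ≤ C * |F.lam0| ^ ((k : ℝ) / 2) := by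

  obtain ⟨e, yI, D, hsplit, he0, h0, hsV, hspec, hyI, hsymm, hsymmD⟩ := F.exists_isSplitting hr
  refine ⟨e, hsplit, F.paramChange D, F.coordChange yI, ?_⟩
  intro R hR n hn
  -- The index is the pair of `k` and the renormalized parameters, and the second factor is a
  -- principal filter. So "eventually" along `l` means for all large `k` and every `m` in the ball,
  -- with constants common to all of them.
  set l : Filter (ℕ × (ℝ × ℝ)) := atTop ×ˢ 𝓟 {m | ‖m‖ ≤ R} with hl
  set μ : ℕ × (ℝ × ℝ) → ℝ × ℝ := fun i => (F.paramChange D i.1).symm i.2 with hμ_def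
  set ε : ℕ × (ℝ × ℝ) → ℝ × ℝ := fun i => e.symm (μ i) with hε_def
  have hk : Tendsto (Prod.fst : ℕ × (ℝ × ℝ) → ℕ) l atTop := tendsto_fst
  have hm : (Prod.snd : ℕ × (ℝ × ℝ) → ℝ × ℝ) =O[l] fun _ => (1 : ℝ) := by
    refine Asymptotics.IsBigO.of_bound R ?_
    rw [hl, eventually_prod_principal_iff]
    exact Eventually.of_forall fun k m hm => by simpa using hm
  obtain ⟨hμ, hexp⟩ := F.isBigO_paramChange_inv hk hm (μ := μ) (D := D) fun i =>
    (F.paramChange D i.1).apply_symm_apply i.2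
  have hL0 : Tendsto (fun i : ℕ × (ℝ × ℝ) => |F.lam0| ^ i.1) l (𝓝 0) := by
    simpa using F.tendsto_pow_mul_abs_lam0_pow hk 0
  have hμ0 : Tendsto μ l (𝓝 0) := hμ.trans_tendsto hL0
  have hε : ε =O[l] fun i => |F.lam0| ^ i.1 := (hsymm.comp_tendsto hμ0).trans hμ.norm_left
  have hε0 : Tendsto ε l (𝓝 0) := hε.trans_tendsto hL0
  have htarget : ∀ᶠ i in l, μ i ∈ e.target :=
    hμ0.eventually (e.open_target.mem_nhds (he0 ▸ e.map_source h0))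
  have hsource : ∀ᶠ i in l, ε i ∈ e.source := htarget.mono fun i hi => e.map_target hi
  have hlog := (F.isBigO_lam_div_sub_logDeriv hr hsymm hsymmD).comp_tendsto hμ0
  have hy : (fun i => yI (ε i) - F.yMinus) =O[l] fun i => |F.lam0| ^ i.1 :=
    (hyI.comp_tendsto hε0).trans hε.norm_left
  -- The renormalization estimate requires order at least three; since `r ≥ 5` this is always
  -- available, and the bounds for smaller `n` are contained in it.
  have hn' : ((max n 3 : ℕ) : ℕ∞) + 2 ≤ r := by
    rcases max_choice n 3 with h | h <;> rw [h]
    · exact hn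
    · exact le_trans (by norm_num) hr
  obtain ⟨hstrip, C₁, hC₁, hmap⟩ := F.renormalization hr (le_max_right n 3) hn' hR hPiPlus hk hε hμ
    hm (hexp.mono fun i hi => hi.1) (hexp.mono fun i hi => hi.2) hlog hy
    (hsource.mono fun i hi => (hspec _ hi).2.1) (by
      filter_upwards [htarget, hsource] with i h1 h2
      rw [← (hspec _ h2).2.2]
      exact (e.right_inv h1).symm)
  obtain ⟨C₂, hC₂, hcorr⟩ := (F.correction_isBigO (D := D) hμ).exists_nonneg
  have hall := ((((htarget.and hsource).and hexp).and hstrip).and hmap).and hcorr.bound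
  rw [hl, eventually_prod_principal_iff] at hall
  obtain ⟨k₀, hk₀⟩ := eventually_atTop.1 hall
  refine ⟨max (C₁ / √|F.d|) C₂, k₀, fun k hk m hmR μ' ε' hμ' hε' => ?_⟩
  subst hμ' hε'
  obtain ⟨⟨⟨⟨⟨h1, h2⟩, h3, h4⟩, h5⟩, h6⟩, h7⟩ := hk₀ k hk m hmR
  have hA := (F.coordChange yI k (ε (k, m))).contDiff_of_finiteDimensional (n := r)
  have hA' := (F.coordChange yI k (ε (k, m))).symm.contDiff_of_finiteDimensional (n := r)
  -- The error in `M₁` is the correction itself, while `M₂` needs none: its `O(kλ²ᵏ)` term would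
  -- change the map only by `O(kλᵏ)`.
  refine ⟨h1, ⟨F.correction D k (μ (k, m)), 0, ?_, ?_, ?_, ?_⟩, h5, ?_, ?_⟩
  · rw [Real.norm_eq_abs, Real.norm_eq_abs,
      abs_of_nonneg (by positivity : (0 : ℝ) ≤ k * |F.lam0| ^ (2 * k))] at h7
    exact h7.trans (by gcongr; exact le_max_right _ _)
  · rw [abs_zero]
    have : 0 ≤ max (C₁ / √|F.d|) C₂ := le_max_of_le_right hC₂
    positivity
  · change m.1 = _ at h3
    rw [h3, ← F.inv_scale, CubicTangencyFamily.kappa, mul_inv]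
    ring
  · change m.2 = _ at h4
    have := pow_ne_zero k F.lam0_ne_zero
    rw [h4]
    field_simp
    ring
  · exact hA'.comp_contDiffOn (F.contDiffOn_firstReturn_comp (hsV h2) hA.contDiffOn h5)
  · intro j hj z hz
    refine (h6.2 j (hj.trans (le_max_left _ _)) z hz).trans ?_
    rw [abs_of_pos (F.scale_pos _), CubicTangencyFamily.scale, mul_div_assoc', div_eq_mul_inv,
      mul_right_comm, ← div_eq_mul_inv]
    gcongr
    exact le_max_left _ _
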